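/- **Theorem 4.4.** Setting. Let $d,N\ge 1$, and let $\Omega\subset\mathbb R^d$ be open, bounded and connected with $C^\infty$ boundary. Let $D,\beta>0$. Let $K_2(x,y)=-\nabla_xU(x-y)+Q(x,y)$ be a bounded two-body force of class $C^1(\Omega^2)$, where $U$ is an even differentiable pair potential, $Q(\cdot,y)$ is differentiable and $\nabla_x\cdot Q=0$. Let $R:\Omega\times[0,\infty)\to\mathbb R^d$ be a one-body force with $\nabla_x\cdot R=0$ that is infinitely differentiable in time and $C^1$ in space. All of these are fixed (known). An external potential is a function $V:\Omega\times[0,\infty)\to\mathbb R$ such that, for every $t$, $V(\cdot,t)\in C^2(\Omega)$ and $\nabla V(\cdot,t)$ extends continuously to $\partial\Omega$. Time derivatives at $t=0$ are from the right. For a set $s$ of particles containing $i$, put $F^{s}_i(x^N,t)=-\nabla V(x_i,t)+R(x_i,t)+\sum_{j\in s,\,j\ne i}K_2(x_i,x_j)$, and for a set $a\subseteq s$ put $\hat O_{a,s}P=D\sum_{i\in a}\nabla_{x_i}\cdot[\nabla_{x_i}P-\beta F^s_iP]$; write $F_{N,i}=F_i^{\{1,\dots,N\}}$. Solutions. $P:\Omega^N\times[0,\infty)\to[0,\infty)$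 is, at every time, a symmetric probability density, and satisfies $\partial_tP=D\sum_{i=1}^N\nabla_{x_i}\cdot[\nabla_{x_i}P-\beta F_{N,i}P]$ on $\Omega^N\times[0,\infty)$. Its currents $J_{N,i}=-D\nabla_{x_i}P+D\beta PF_{N,i}$ satisfy $\int_\Omega\nabla_{x_i}\cdot J_{N,i}\,dx_i=0$ for all $i$, all $t$ and all positions of the other particles. For $1\le n\le N$ let $$\rho_n(x^n,t)=\frac{N!}{(N-n)!}\int_{\Omega^{N-n}}P(x^n,y^{N-n},t)\,dy^{N-n},\qquad \rho=\rho_1,$$ and let $E_{n,i}(x^n,t)=\int_\Omega\rho_{n+1}(x^n,y,t)K_2(x_i,y)\,dy$ for $n<N$, $E_{n,i}=0$ for $n\ge N$. The solution $P$ is assumed to be well behaved: $P\in C^2(\Omega^N\times[0,\infty))$; at every time, $P$ and $\nabla_{x^N}P$ extend continuously to $\partial\Omega^N$; with $[n]=\{1,\dots,n\}$, the functions $\partial_tP$, $\nabla_{x^N}P$, $\nabla_xK_2$, and, for $1\le n\le N$, $\hat O_{[n],[n]}P$, $\hat O_{[n],[N]}P$ and $\hat O_{[N]\setminus[n],[N]}P$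 are bounded; and for $1\le n<N$ the integrals $E_{n,i}$ exist and are $C^1$ on $\Omega^n\times[0,\infty)$. Analytic accessibility. (A1) For each $x\in\Omega$ the function $t\mapsto V(x,t)$ is real analytic on $[0,\infty)$; for every $k\ge0$, $\partial_t^kV\in C^2(\Omega\times[0,\infty))$, $\partial_t^kV(\cdot,0)$ extends continuously to $\partial\Omega$, and $\nabla_x\partial_t^kV$, as a function on $\Omega\times[0,\infty)$, extends continuously to $\partial\Omega\times\{0\}$. (A2) For $1\le n\le N$, $\rho_n$ is infinitely differentiable in time and, for every $k\ge0$, $\partial_t^k\rho_n\in C^2(\Omega^n\times[0,\infty))$ is bounded and $\partial_t^kR\in C^1(\Omega\times[0,\infty))$. No normal flux. The one-body current is $j=-D(\nabla\rho+\beta\rho\nabla V-\beta\rho R)+D\beta E_{1,1}$. There is no normal flux if $\nu(x)\cdot j(y,t)\to0$ as $\Omega\ni y\to x$, for all $x\in\partial\Omega$ and $t\ge0$, where $\nu$ is the outward unit normal. Claim. Let $V,V'$ be external potentials with well-behaved solutions $P,P'$ as above (for the same $N,\Omega,D,\beta,U,Q,R$), both analytically accessible and both without normal flux, with $P(\cdot,0)=P'(\cdot,0)>0$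 on $\Omega^N$. If their one-body densities agree, $\rho=\rho'$ on $\Omega\times[0,\infty)$, then $V$ and $V'$ are diffusion equivalent for $\rho$, i.e. $V-V'$ depends on $t$ only on $\{(x,t):\rho(x,t)>0\}$; moreover there is $c:[0,\infty)\to\mathbb R$ with $V(x,t)-V'(x,t)=c(t)$ for all $x\in\Omega$, $t\ge0$. -/

import Mathlib

open Set Filter Topology MeasureTheory
open scoped ContDiff

noncomputable section

namespace Overdamped

/-- Euclidean `d`-space. -/
abbrev E (d : ℕ) : Type := EuclideanSpace ℝ (Fin d)

/-- Configurations of `n` particles in `d`-space. -/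
abbrev Conf (d n : ℕ) : Type := Fin n → E d

/-! ### Domains with smooth boundary -/

/-- `g` is a smooth defining function of `Ω` near the boundary point `x`: near `x`, the set `Ω` is
`{g < 0}`, and the gradient of `g` does not vanish at `x`. -/
def IsLocalDefiningFunction {d : ℕ} (Ω : Set (E d)) (x : E d) (g : E d → ℝ) : Prop :=
  ContDiff ℝ ∞ g ∧ gradient g x ≠ 0 ∧ ∀ᶠ y in 𝓝 x, (y ∈ Ω ↔ g y < 0)

/-- The boundary of `Ω` is smooth. -/
def HasSmoothBoundary {d : ℕ} (Ω : Set (E d)) : Prop :=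
  ∀ x ∈ frontier Ω, ∃ g : E d → ℝ, IsLocalDefiningFunction Ω x g

/-- `ν` is the outward unit normal of `Ω` at the boundary point `x`. -/
def IsOutwardUnitNormal {d : ℕ} (Ω : Set (E d)) (x ν : E d) : Prop :=
  ∃ g : E d → ℝ, IsLocalDefiningFunction Ω x g ∧ ν = ‖gradient g x‖⁻¹ • gradient g x

/-- `f`, given on `S`, has a continuous extension to `S ∪ B`. -/
def ExtendsContinuously {X Y : Type*} [TopologicalSpace X] [TopologicalSpace Y]
    (S B : Set X) (f : X → Y) : Prop :=
  ∃ g : X → Y, ContinuousOn g (S ∪ B) ∧ EqOn f g S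

/-! ### Differential operators -/

/-- Divergence of a vector field on `d`-space. -/
def diverg {d : ℕ} (G : E d → E d) (x : E d) : ℝ :=
  ∑ a : Fin d, fderiv ℝ G x (EuclideanSpace.single a 1) a

/-- Gradient with respect to the position of the `i`-th particle. -/
def gradAt {d n : ℕ} (i : Fin n) (f : Conf d n → ℝ) (x : Conf d n) : E d :=
  gradient (fun y : E d => f (Function.update x i y)) (x i)

/-- Divergence with respect to the position of the `i`-th particle. -/
def divAt {d n : ℕ} (i : Fin n) (G : Conf d n → E d) (x : Conf d n) : ℝ :=
  diverg (fun y : E d => G (Function.update x i y)) (x i)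

/-- The `k`-th time derivative on `[0, ∞)` (from the right at time `0`). -/
def timeDeriv {X F : Type*} [NormedAddCommGroup F] [NormedSpace ℝ F] (k : ℕ) (f : X → ℝ → F)
    (x : X) (t : ℝ) : F :=
  iteratedDerivWithin k (f x) (Ici 0) t

/-- `f` is `C^k` on `S × [0, ∞)`. -/
def SpaceTimeC {X F : Type*} [NormedAddCommGroup X] [NormedSpace ℝ X]
    [NormedAddCommGroup F] [NormedSpace ℝ F] (k : WithTop ℕ∞) (S : Set X) (f : X → ℝ → F) : Prop :=
  ContDiffOn ℝ k (fun p : X × ℝ => f p.1 p.2) (S ×ˢ Ici 0)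

/-- `f` is bounded on `S × [0, ∞)`. -/
def SpaceTimeBounded {X F : Type*} [Norm F] (S : Set X) (f : X → ℝ → F) : Prop :=
  ∃ C : ℝ, ∀ x ∈ S, ∀ t : ℝ, 0 ≤ t → ‖f x t‖ ≤ C

/-! ### The fixed physical data -/

/-- The two-body force `K₂(x, y) = -∇ₓ U(x - y) + Q(x, y)`. -/
def twoBodyForce {d : ℕ} (U : E d → ℝ) (Q : E d → E d → E d) (x y : E d) : E d :=
  -gradient (fun z : E d => U (z - y)) x + Q x y

/-- Everything in an overdamped system that is considered as known, apart from the number of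
particles and the initial state: the domain, the diffusion constant, the inverse temperature, the
interparticle interaction and the one-body non-conservative force. -/
structure Setting (d : ℕ) where
  /-- the domain -/
  Ω : Set (E d)
  isOpen_Ω : IsOpen Ω
  isBounded_Ω : Bornology.IsBounded Ω
  isConnected_Ω : IsConnected Ω
  smooth_Ω : HasSmoothBoundary Ω
  /-- the diffusion constant -/
  D : ℝ
  D_pos : 0 < D
  /-- the inverse temperature -/
  β : ℝ
  β_pos : 0 < β
  /-- the pair potential, as a function of the relative position -/
  U : E d → ℝ
  U_even : ∀ z, U (-z) = U z
  U_diff : ∀ x ∈ Ω, ∀ y ∈ Ω, DifferentiableAt ℝ U (x - y)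
  /-- the non-conservative two-body force of a particle at `y` on a particle at `x` -/
  Q : E d → E d → E d
  Q_diff : ∀ x ∈ Ω, ∀ y ∈ Ω, DifferentiableAt ℝ (fun z => Q z y) x
  Q_divFree : ∀ x ∈ Ω, ∀ y ∈ Ω, diverg (fun z => Q z y) x = 0
  K₂_contDiff : ContDiffOn ℝ 1 (fun p : E d × E d => twoBodyForce U Q p.1 p.2) (Ω ×ˢ Ω)
  K₂_bounded : ∃ C : ℝ, ∀ x ∈ Ω, ∀ y ∈ Ω, ‖twoBodyForce U Q x y‖ ≤ C
  /-- the non-conservative one-body force -/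
  R : E d → ℝ → E d
  R_time : ∀ x ∈ Ω, ContDiffOn ℝ ∞ (R x) (Ici 0)
  R_space : ∀ t : ℝ, 0 ≤ t → ContDiffOn ℝ 1 (fun x => R x t) Ω
  R_divFree : ∀ x ∈ Ω, ∀ t : ℝ, 0 ≤ t → diverg (fun z => R z t) x = 0

namespace Setting

variable {d : ℕ} (S : Setting d)

/-- The set `Ωⁿ` of configurations of `n` particles in the domain. -/
def dom (n : ℕ) : Set (Conf d n) := Set.univ.pi fun _ => S.Ω

/-- The two-body force of the system. -/
def K₂ (x y : E d) : E d := twoBodyForce S.U S.Q x y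

/-- The external potentials that are allowed: twice continuously differentiable in space, with a
gradient that extends continuously to the boundary, at every time. -/
structure IsPotential (V : E d → ℝ → ℝ) : Prop where
  contDiff : ∀ t : ℝ, 0 ≤ t → ContDiffOn ℝ 2 (fun x => V x t) S.Ω
  gradient_extends : ∀ t : ℝ, 0 ≤ t →
    ExtendsContinuously S.Ω (frontier S.Ω) (fun x => gradient (fun z => V z t) x)

/-- The one-body force `K₁ = -∇V + R`. -/
def K₁ (V : E d → ℝ → ℝ) (x : E d) (t : ℝ) : E d :=
  -gradient (fun z => V z t) x + S.R x t

/-- The total force on particle `i` when only the particles in `s` act on it,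
`K₁(xᵢ, t) + ∑_{j ∈ s, j ≠ i} K₂(xᵢ, xⱼ)`. For `s` the set of all particles this is `F_{N,i}`; for
`s` the set of the first `n` particles it is `F_{n,i}` at the first `n` positions. -/
def force {N : ℕ} (V : E d → ℝ → ℝ) (s : Finset (Fin N)) (i : Fin N) (x : Conf d N) (t : ℝ) :
    E d :=
  S.K₁ V (x i) t + ∑ j ∈ s.erase i, S.K₂ (x i) (x j)

/-- The Smoluchowski operator that acts on the particles in `a`, with the forces exerted by the
particles in `s`: `D ∑_{i ∈ a} ∇ᵢ · [∇ᵢ f - β F_i f]`. -/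
def smolOp {N : ℕ} (V : E d → ℝ → ℝ) (a s : Finset (Fin N)) (f : Conf d N → ℝ → ℝ)
    (x : Conf d N) (t : ℝ) : ℝ :=
  S.D * ∑ i ∈ a, divAt i
    (fun z => gradAt i (fun w => f w t) z - (S.β * f z t) • S.force V s i z t) x

/-- The first `n` of `N` particles. -/
def first (N n : ℕ) : Finset (Fin N) := Finset.univ.filter fun i => (i : ℕ) < n

/-- The component for particle `i` of the `N`-body current,
`J_{N,i} = -D ∇ᵢ P + D β P F_{N,i}`. -/
def current {N : ℕ} (V : E d → ℝ → ℝ) (P : Conf d N → ℝ → ℝ) (i : Fin N) (x : Conf d N) (t : ℝ) :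
    E d :=
  -(S.D • gradAt i (fun w => P w t) x) + (S.D * S.β * P x t) • S.force V Finset.univ i x t

/-- The configuration of `N` particles that consists of `x` followed by `y` (used for `n ≤ N`). -/
def join {N n : ℕ} (x : Conf d n) (y : Conf d (N - n)) : Conf d N :=
  fun i => if h : (i : ℕ) < n then x ⟨i, h⟩ else y ⟨i - n, by omega⟩

/-- The `n`-body density `ρₙ(xⁿ, t) = N! / (N - n)! ∫ P(xⁿ, y^{N-n}, t) dy^{N-n}`, for `n ≤ N`. -/
def density {N : ℕ} (P : Conf d N → ℝ → ℝ) (n : ℕ) (x : Conf d n) (t : ℝ) : ℝ :=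
  (N.descFactorial n : ℝ) * ∫ y in S.dom (N - n), P (join x y) t

/-- The one-body density. -/
def density₁ {N : ℕ} (P : Conf d N → ℝ → ℝ) (x : E d) (t : ℝ) : ℝ :=
  S.density P 1 (fun _ => x) t

/-- The integrand `ρ_{n+1}(xⁿ, y, t) K₂(xᵢ, y)` of the average interaction force. -/
def meanForceIntegrand {N n : ℕ} (P : Conf d N → ℝ → ℝ) (i : Fin n) (x : Conf d n) (t : ℝ)
    (y : E d) : E d :=
  S.density P (n + 1) (Fin.snoc (α := fun _ => E d) x y) t • S.K₂ (x i) y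

/-- The average `n`-body interaction force
`E_{n,i}(xⁿ, t) = ∫ ρ_{n+1}(xⁿ, y, t) K₂(xᵢ, y) dy`, and `0` for `n ≥ N`. -/
def meanForce {N n : ℕ} (P : Conf d N → ℝ → ℝ) (i : Fin n) (x : Conf d n) (t : ℝ) : E d :=
  if n < N then ∫ y in S.Ω, S.meanForceIntegrand P i x t y else 0

/-- The one-body current
`j = -D [∇ + β ∇V - β R] ρ + D β ∫ ρ₂(x, y, t) K₂(x, y) dy`. -/
def current₁ {N : ℕ} (V : E d → ℝ → ℝ) (P : Conf d N → ℝ → ℝ) (x : E d) (t : ℝ) : E d :=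
  -(S.D • (gradient (fun z => S.density₁ P z t) x
      + (S.β * S.density₁ P x t) • gradient (fun z => V z t) x
      - (S.β * S.density₁ P x t) • S.R x t))
    + (S.D * S.β) • S.meanForce P (0 : Fin 1) (fun _ => x) t

/-- `P` is a time-dependent symmetric probability density of `N` particles in the domain. -/
structure IsProbDensity {N : ℕ} (P : Conf d N → ℝ → ℝ) : Prop where
  nonneg : ∀ x ∈ S.dom N, ∀ t : ℝ, 0 ≤ t → 0 ≤ P x t
  symm : ∀ σ : Equiv.Perm (Fin N), ∀ x ∈ S.dom N, ∀ t : ℝ, 0 ≤ t → P (x ∘ σ) t = P x t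
  normalized : ∀ t : ℝ, 0 ≤ t → ∫ x in S.dom N, P x t = 1

/-- `P` is a well-behaved solution of the `N`-body Smoluchowski equation in the external potential
`V`, whose `N`-body current has, for each particle, no net flux out of the domain. -/
structure IsSolution {N : ℕ} (V : E d → ℝ → ℝ) (P : Conf d N → ℝ → ℝ) : Prop
    extends S.IsProbDensity P where
  smoluchowski : ∀ x ∈ S.dom N, ∀ t : ℝ, 0 ≤ t →
    timeDeriv 1 P x t = S.smolOp V Finset.univ Finset.univ P x t
  /- the boundary condition `∫ ∇ᵢ · J_{N,i} dxᵢ = 0` -/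
  no_net_flux : ∀ i : Fin N, ∀ x ∈ S.dom N, ∀ t : ℝ, 0 ≤ t →
    ∫ y in S.Ω, divAt i (fun z => S.current V P i z t) (Function.update x i y) = 0
  contDiff : SpaceTimeC 2 (S.dom N) P
  extends_P : ∀ t : ℝ, 0 ≤ t →
    ExtendsContinuously (S.dom N) (frontier (S.dom N)) (fun x => P x t)
  extends_grad : ∀ i : Fin N, ∀ t : ℝ, 0 ≤ t →
    ExtendsContinuously (S.dom N) (frontier (S.dom N)) (gradAt i fun x => P x t)
  bdd_timeDeriv : SpaceTimeBounded (S.dom N) (timeDeriv 1 P)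
  bdd_op : ∀ n : ℕ, 1 ≤ n → n ≤ N →
    SpaceTimeBounded (S.dom N) (S.smolOp V (first N n) (first N n) P)
  bdd_op_minus : ∀ n : ℕ, 1 ≤ n → n ≤ N →
    SpaceTimeBounded (S.dom N) (S.smolOp V (first N n) Finset.univ P)
  bdd_op_plus : ∀ n : ℕ, 1 ≤ n → n ≤ N →
    SpaceTimeBounded (S.dom N) (S.smolOp V (first N n)ᶜ Finset.univ P)
  bdd_grad_K₂ : ∃ C : ℝ, ∀ x ∈ S.Ω, ∀ y ∈ S.Ω, ‖fderiv ℝ (fun z => S.K₂ z y) x‖ ≤ C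
  bdd_grad : ∀ i : Fin N, SpaceTimeBounded (S.dom N) (fun x t => gradAt i (fun w => P w t) x)
  meanForce_exists : ∀ n : ℕ, 1 ≤ n → n < N → ∀ i : Fin n, ∀ x ∈ S.dom n, ∀ t : ℝ, 0 ≤ t →
    IntegrableOn (S.meanForceIntegrand P i x t) S.Ω
  meanForce_contDiff : ∀ n : ℕ, 1 ≤ n → n < N → ∀ i : Fin n,
    SpaceTimeC 1 (S.dom n) (S.meanForce P i)

/-- The system with external potential `V` and `N`-body density `P` is analytically accessible. -/
structure IsAnalyticallyAccessible {N : ℕ} (V : E d → ℝ → ℝ) (P : Conf d N → ℝ → ℝ) : Prop where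
  V_analytic : ∀ x ∈ S.Ω, AnalyticOn ℝ (V x) (Ici 0)
  V_contDiff : ∀ k : ℕ, SpaceTimeC 2 S.Ω (timeDeriv k V)
  V_extends : ∀ k : ℕ, ExtendsContinuously S.Ω (frontier S.Ω) (fun x => timeDeriv k V x 0)
  /- `∇ₓ ∂ₜᵏ V`, as a function on `Ω × [0, ∞)`, extends continuously to `∂Ω × {0}` -/
  gradV_extends : ∀ k : ℕ, ExtendsContinuously (S.Ω ×ˢ Ici (0 : ℝ)) (frontier S.Ω ×ˢ {(0 : ℝ)})
    (fun p : E d × ℝ => gradient (fun z => timeDeriv k V z p.2) p.1)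
  density_time : ∀ n : ℕ, 1 ≤ n → n ≤ N → ∀ x ∈ S.dom n,
    ContDiffOn ℝ ∞ (S.density P n x) (Ici 0)
  density_contDiff : ∀ n : ℕ, 1 ≤ n → n ≤ N → ∀ k : ℕ,
    SpaceTimeC 2 (S.dom n) (timeDeriv k (S.density P n))
  density_bounded : ∀ n : ℕ, 1 ≤ n → n ≤ N → ∀ k : ℕ,
    SpaceTimeBounded (S.dom n) (timeDeriv k (S.density P n))
  R_contDiff : ∀ k : ℕ, SpaceTimeC 1 S.Ω (timeDeriv k S.R)

/-- The normal one-body current, extended to the boundary, vanishes at all times. -/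
def NoNormalFlux {N : ℕ} (V : E d → ℝ → ℝ) (P : Conf d N → ℝ → ℝ) : Prop :=
  ∀ t : ℝ, 0 ≤ t → ∀ x ∈ frontier S.Ω, ∀ ν : E d, IsOutwardUnitNormal S.Ω x ν →
    Tendsto (fun y => inner ℝ ν (S.current₁ V P y t)) (𝓝[S.Ω] x) (𝓝 0)

/-- `V` and `V'` are diffusion equivalent for the one-body density `ρ`: their difference is a
function of time only on the support `{(x, t) | ρ(x, t) > 0}` of `ρ`. -/
def DiffusionEquivalent (ρ V V' : E d → ℝ → ℝ) : Prop :=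
  ∃ c : ℝ → ℝ, ∀ x ∈ S.Ω, ∀ t : ℝ, 0 ≤ t → 0 < ρ x t → V x t - V' x t = c t

end Setting

end Overdamped

end

/-! Write `W = V - V'` and `Δ = P - P'`. Since the potentials are analytic in time and `Ω` is
connected, it is enough that the gradient of `∂ₜᵏ W` vanishes at time `0` for every `k`. This is an
induction on `k` (`gradAgreeUpTo`). If it holds below order `k`, the Smoluchowski equation and the
common initial state force `∂ₜˡ Δ = 0` at time `0` for all `l ≤ k` (`timeDeriv_eq_zero`), so `Δ =
O(t^(k+1))`. To order `t^k` the one-body currents then differ only by `-Dβ (t^k / k!) ρ(·, 0) ∇w`,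
where `w = ∂ₜᵏ W(·, 0)`: diffusion, the force `R` and the interaction contribute at higher order or
cancel. Equality of the one-body densities makes `ρ ∇w` divergence free (`isWeaklyDivFree`), and the
absence of normal flux makes it tangent to the boundary (`isTangentField`). Testing this field with
`w` itself gives `∫ ρ |∇w|² = 0`; as `ρ(·, 0) > 0`, the gradient of `w` vanishes
(`gradient_eq_zero_of_weaklyDivFree`).

The equations are never differentiated repeatedly in time. All quantities are compared with powers
of `t`, uniformly in space (`UniformO`), and coefficients are read off from integral identities
valid at every time (`setIntegral_eq_zero_of_uniformO`). Space derivatives that are not controlled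
up to the boundary are moved onto test functions.

The normal component of `ρ ∇w` is only known to tend to `0` at each boundary point. The divergence
theorem is therefore proved by cutting off thin boundary layers: their mass stays bounded, while
compactness makes the normal component uniformly small on them
(`exists_ball_setIntegral_fderiv_mul_eq_zero`). -/

namespace Overdamped

/-! ### Uniform estimates for small times -/

/-- `f` is `O(t ^ m)` on `[0, T]`, uniformly on `A`. -/
def UniformO {X F : Type*} [Norm F] (A : Set X) (T : ℝ) (m : ℕ) (f : X → ℝ → F) : Prop :=
  ∃ C : ℝ, 0 ≤ C ∧ ∀ x ∈ A, ∀ t ∈ Icc 0 T, ‖f x t‖ ≤ C * t ^ m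

namespace UniformO

variable {X F : Type*} [NormedAddCommGroup F] {A B : Set X} {T : ℝ} {m n : ℕ}
  {f g : X → ℝ → F}

theorem mono (h : UniformO A T m f) (hB : B ⊆ A) : UniformO B T m f := by
  obtain ⟨C, hC, h⟩ := h
  exact ⟨C, hC, fun x hx => h x (hB hx)⟩

theorem comp {Y : Type*} {A' : Set Y} (h : UniformO A T m f) (e : Y → X) (he : MapsTo e A' A) :
    UniformO A' T m (fun y => f (e y)) := by
  obtain ⟨C, hC, h⟩ := h
  exact ⟨C, hC, fun x hx => h _ (he hx)⟩

theorem of_norm_le {G : Type*} [NormedAddCommGroup G] {g : X → ℝ → G}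
    (h : UniformO A T m f) (hg : ∀ x ∈ A, ∀ t ∈ Icc 0 T, ‖g x t‖ ≤ ‖f x t‖) :
    UniformO A T m g := by
  obtain ⟨C, hC, h⟩ := h
  exact ⟨C, hC, fun x hx t ht => (hg x hx t ht).trans (h x hx t ht)⟩

theorem congr (h : UniformO A T m f) (hg : ∀ x ∈ A, ∀ t ∈ Icc 0 T, g x t = f x t) :
    UniformO A T m g :=
  h.of_norm_le fun x hx t ht => by rw [hg x hx t ht]

theorem of_le (h : UniformO A T n f) (hmn : m ≤ n) : UniformO A T m f := by
  obtain ⟨C, hC, h⟩ := h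
  refine ⟨C * |T| ^ (n - m), by positivity, fun x hx t ht => (h x hx t ht).trans ?_⟩
  have : t ^ n = t ^ (n - m) * t ^ m := by rw [← pow_add]; congr 1; omega
  rw [this, mul_assoc]
  have h1 : t ^ (n - m) ≤ |T| ^ (n - m) :=
    pow_le_pow_left₀ ht.1 (ht.2.trans (le_abs_self T)) _
  have h2 : 0 ≤ t ^ m := pow_nonneg ht.1 m
  gcongr

theorem add (hf : UniformO A T m f) (hg : UniformO A T m g) :
    UniformO A T m (fun x t => f x t + g x t) := by
  obtain ⟨C, hC, hf⟩ := hf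
  obtain ⟨C', hC', hg⟩ := hg
  refine ⟨C + C', by positivity, fun x hx t ht => (norm_add_le _ _).trans ?_⟩
  rw [add_mul]
  exact add_le_add (hf x hx t ht) (hg x hx t ht)

theorem neg (hf : UniformO A T m f) : UniformO A T m (fun x t => -f x t) :=
  hf.of_norm_le fun x _ t _ => by rw [norm_neg]

theorem sub (hf : UniformO A T m f) (hg : UniformO A T m g) :
    UniformO A T m (fun x t => f x t - g x t) := by
  simpa only [sub_eq_add_neg] using hf.add hg.neg

theorem zero : UniformO A T m (fun (_ : X) (_ : ℝ) => (0 : F)) :=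
  ⟨0, le_rfl, fun x _ t _ => by simp⟩

theorem sum {ι : Type*} (s : Finset ι) {f : ι → X → ℝ → F}
    (h : ∀ i ∈ s, UniformO A T m (f i)) : UniformO A T m (fun x t => ∑ i ∈ s, f i x t) := by
  classical
  induction s using Finset.induction_on with
  | empty => simpa using zero
  | insert a s ha ih =>
    simp only [Finset.sum_insert ha]
    exact (h a (by simp)).add (ih fun i hi => h i (by simp [hi]))

theorem of_bound {C : ℝ} (h : ∀ x ∈ A, ∀ t ∈ Icc 0 T, ‖f x t‖ ≤ C) : UniformO A T 0 f :=
  ⟨max C 0, le_max_right _ _, fun x hx t ht => by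
    simpa using Or.inl (h x hx t ht)⟩

theorem mul_of_norm_le {G H : Type*} [NormedAddCommGroup G] [NormedAddCommGroup H]
    {g : X → ℝ → G} {h : X → ℝ → H}
    (hf : UniformO A T m f) (hg : UniformO A T n g)
    (hh : ∀ x ∈ A, ∀ t ∈ Icc 0 T, ‖h x t‖ ≤ ‖f x t‖ * ‖g x t‖) : UniformO A T (m + n) h := by
  obtain ⟨C, hC, hf⟩ := hf
  obtain ⟨C', hC', hg⟩ := hg
  refine ⟨C * C', by positivity, fun x hx t ht => (hh x hx t ht).trans ?_⟩
  have h1 := mul_le_mul (hf x hx t ht) (hg x hx t ht) (norm_nonneg _)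
    (mul_nonneg hC (pow_nonneg ht.1 m))
  exact h1.trans_eq (by ring)

theorem smul [NormedSpace ℝ F] {a : X → ℝ → ℝ} (ha : UniformO A T m a) (hf : UniformO A T n f) :
    UniformO A T (m + n) (fun x t => a x t • f x t) :=
  ha.mul_of_norm_le hf fun _ _ _ _ => (norm_smul _ _).le

theorem const_smul [NormedSpace ℝ F] (c : ℝ) (hf : UniformO A T m f) :
    UniformO A T m (fun x t => c • f x t) := by
  have := (of_bound (A := A) (T := T) (f := fun _ _ => c) (C := ‖c‖) fun _ _ _ _ => le_rfl).smul hf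
  simpa using this

theorem inner [InnerProductSpace ℝ F] (hf : UniformO A T m f) (hg : UniformO A T n g) :
    UniformO A T (m + n) (fun x t => inner ℝ (f x t) (g x t)) :=
  hf.mul_of_norm_le hg fun _ _ _ _ => norm_inner_le_norm _ _

theorem clm {𝕂 : Type*} [NormedSpace ℝ F] [NormedAddCommGroup 𝕂] [NormedSpace ℝ 𝕂]
    (L : F →L[ℝ] 𝕂) (hf : UniformO A T m f) : UniformO A T m (fun x t => L (f x t)) :=
  (hf.const_smul ‖L‖).of_norm_le fun _ _ _ _ => by
    rw [norm_smul, norm_norm]; exact L.le_opNorm _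

/-- No measurability of the integrand is needed: a Bochner integral that does not exist is `0` and
obeys the bound too. -/
theorem setIntegral {X Y : Type*} [MeasurableSpace Y] {μ : Measure Y} {A : Set X} {B : Set Y}
    [NormedSpace ℝ F] {f : X → Y → ℝ → F}
    (h : UniformO (A ×ˢ B) T m fun p t => f p.1 p.2 t) (hB : μ B < ⊤) :
    UniformO A T m (fun x t => ∫ y in B, f x y t ∂μ) := by
  obtain ⟨C, hC, h⟩ := h
  refine ⟨C * μ.real B, by positivity, fun x hx t ht => ?_⟩
  refine (norm_setIntegral_le_of_norm_le_const hB fun y hy => h (x, y) ⟨hx, hy⟩ t ht).trans_eq ?_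
  ring

end UniformO

/-- Dividing by `t ^ k` leaves `|a| ≤ C * t`, which fails for small `t` unless `a = 0`. -/
theorem eq_zero_of_mul_pow_le {a C T : ℝ} {k : ℕ} (hT : 0 < T)
    (h : ∀ t ∈ Ioc 0 T, |a| * t ^ k ≤ C * t ^ (k + 1)) : a = 0 := by
  by_contra ha
  have ha' : 0 < |a| := abs_pos.mpr ha
  have h1 : ∀ t ∈ Ioc 0 T, |a| ≤ C * t := fun t ht => by
    have h2 := h t ht
    have h3 : 0 < t ^ k := pow_pos ht.1 k
    rw [pow_succ'] at h2
    exact le_of_mul_le_mul_right (by linarith) h3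
  have hC : 0 < C := by
    have := h1 T ⟨hT, le_rfl⟩
    by_contra hC
    nlinarith
  -- At this time `C * t` is at most `|a| / 2`.
  have h4 := h1 (min T (|a| / (2 * C))) ⟨by positivity, min_le_left _ _⟩
  have h5 : C * min T (|a| / (2 * C)) ≤ C * (|a| / (2 * C)) := by gcongr; exact min_le_right _ _
  have h6 : C * (|a| / (2 * C)) = |a| / 2 := by field_simp
  linarith

/-- Taylor's formula at `0`, when all lower derivatives vanish at `0`. -/
theorem norm_sub_pow_smul_le {F : Type*} [NormedAddCommGroup F] [NormedSpace ℝ F] {T C : ℝ} :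
    ∀ (k : ℕ) (g : ℕ → ℝ → F),
    (∀ l t, 0 ≤ t → HasDerivWithinAt (g l) (g (l + 1) t) (Ici 0) t) →
    (∀ l < k, g l 0 = 0) → (∀ t ∈ Icc 0 T, ‖g (k + 1) t‖ ≤ C) →
    ∀ t ∈ Icc 0 T, ‖g 0 t - (t ^ k / k.factorial : ℝ) • g k 0‖ ≤ C * t ^ (k + 1) := by
  intro k
  induction k with
  | zero =>
    intro g hg _ hC t ht
    have := norm_image_sub_le_of_norm_deriv_le_segment' (f := g 0) (f' := g 1) (a := 0) (b := t)
      (C := C) (fun x hx => (hg 0 x hx.1).mono Icc_subset_Ici_self)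
      (fun x hx => hC x ⟨hx.1, hx.2.le.trans ht.2⟩) t ⟨ht.1, le_rfl⟩
    simpa using this
  | succ k ih =>
    intro g hg h0 hC t ht
    -- The derivative of the remainder `f` below is the remainder of order `k` of the shifted
    -- family, so the mean value inequality lifts the bound by one order.
    have h1 := ih (fun l => g (l + 1)) (fun l => hg (l + 1))
      (fun l hl => h0 (l + 1) (by omega)) hC
    have hC0 : 0 ≤ C := (norm_nonneg _).trans (hC 0 ⟨le_rfl, ht.1.trans ht.2⟩)
    set f : ℝ → F := fun s => g 0 s - (s ^ (k + 1) / (k + 1).factorial : ℝ) • g (k + 1) 0 with hf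
    have hpow : ∀ s : ℝ, HasDerivAt (fun s : ℝ => s ^ (k + 1) / ((k + 1).factorial : ℝ))
        (s ^ k / k.factorial) s := fun s => by
      have h2 := (hasDerivAt_pow (k + 1) s).div_const ((k + 1).factorial : ℝ)
      refine h2.congr_deriv ?_
      rw [Nat.factorial_succ]
      have : (k.factorial : ℝ) ≠ 0 := by positivity
      push_cast
      field_simp
    have hder : ∀ s, 0 ≤ s →
        HasDerivWithinAt f (g 1 s - (s ^ k / k.factorial : ℝ) • g (k + 1) 0) (Ici 0) s := by
      intro s hs
      exact (hg 0 s hs).sub ((hpow s).hasDerivWithinAt.smul_const _)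
    have := norm_image_sub_le_of_norm_deriv_le_segment' (f := f) (a := 0) (b := t)
      -- The bound on the derivative is taken at the right end point and multiplied by the length
      -- `t`; the factorial that could be gained is not needed.
      (C := C * t ^ (k + 1)) (fun x hx => (hder x hx.1).mono Icc_subset_Ici_self)
      (fun x hx => by
        refine (h1 x ⟨hx.1, hx.2.le.trans ht.2⟩).trans ?_
        gcongr
        exacts [hx.1, hx.2.le]) t ⟨ht.1, le_rfl⟩
    have hf0 : f 0 = 0 := by simp [hf, h0 0 (by omega)]
    rw [hf0] at this
    rw [sub_zero, sub_zero, mul_assoc, ← pow_succ] at this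
    exact this

/-- A bound on the next derivative that is uniform in `x` makes the Taylor remainder uniform. This
is how leading coefficients are isolated. -/
theorem uniformO_sub_pow_smul {X F : Type*} [NormedAddCommGroup F] [NormedSpace ℝ F] {A : Set X}
    {T : ℝ} {k : ℕ} {g : ℕ → X → ℝ → F}
    (hg : ∀ x ∈ A, ∀ l t, 0 ≤ t → HasDerivWithinAt (g l x) (g (l + 1) x t) (Ici 0) t)
    (h0 : ∀ x ∈ A, ∀ l < k, g l x 0 = 0) (hb : UniformO A T 0 (g (k + 1))) :
    UniformO A T (k + 1) (fun x t => g 0 x t - (t ^ k / k.factorial : ℝ) • g k x 0) := by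
  obtain ⟨C, hC, hb⟩ := hb
  refine ⟨C, hC, fun x hx t ht => ?_⟩
  refine norm_sub_pow_smul_le k (fun l => g l x) (hg x hx) (h0 x hx) (fun s hs => ?_) t ht
  simpa using hb x hx s hs

theorem uniformO_of_vanishing {X F : Type*} [NormedAddCommGroup F] [NormedSpace ℝ F] {A : Set X}
    {T : ℝ} {k : ℕ} {g : ℕ → X → ℝ → F}
    (hg : ∀ x ∈ A, ∀ l t, 0 ≤ t → HasDerivWithinAt (g l x) (g (l + 1) x t) (Ici 0) t)
    (h0 : ∀ x ∈ A, ∀ l < k, g l x 0 = 0) (hb : UniformO A T 0 (g k)) :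
    UniformO A T k (g 0) := by
  cases k with
  | zero => exact hb
  | succ k =>
    -- The expansion of order `k` is used; its leading coefficient is zero as well.
    refine (uniformO_sub_pow_smul hg (fun x hx l hl => h0 x hx l (by omega)) hb).congr
      fun x hx t _ => ?_
    rw [h0 x hx k (by omega), smul_zero, sub_zero]

/-! ### Time derivatives -/

theorem hasDerivWithinAt_timeDeriv {X F : Type*} [NormedAddCommGroup F] [NormedSpace ℝ F]
    {f : X → ℝ → F} {x : X} (hf : ContDiffOn ℝ ∞ (f x) (Ici 0)) (k : ℕ) {t : ℝ} (ht : 0 ≤ t) :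
    HasDerivWithinAt (timeDeriv k f x) (timeDeriv (k + 1) f x t) (Ici 0) t := by
  have h := hf.differentiableOn_iteratedDerivWithin (m := k) (by exact_mod_cast WithTop.coe_lt_top _)
    (uniqueDiffOn_Ici 0) t ht
  have := h.hasDerivWithinAt
  rw [← iteratedDerivWithin_succ] at this
  exact this

theorem timeDeriv_zero {X F : Type*} [NormedAddCommGroup F] [NormedSpace ℝ F]
    (f : X → ℝ → F) : timeDeriv 0 f = f := by
  funext x t
  simp [timeDeriv]

/-! ### Slices and mixed derivatives of functions on space-time. -/

section SpaceTime

variable {X F : Type*} [NormedAddCommGroup X] [NormedSpace ℝ X] [NormedAddCommGroup F]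
  [NormedSpace ℝ F] {S : Set X} {u u' : X → ℝ → F}

theorem uniqueDiffOn_prod_Ici (hS : IsOpen S) : UniqueDiffOn ℝ (S ×ˢ Ici (0 : ℝ)) :=
  hS.uniqueDiffOn.prod (uniqueDiffOn_Ici 0)

theorem SpaceTimeC.contDiffOn {k : WithTop ℕ∞} (h : SpaceTimeC k S u) {t : ℝ} (ht : 0 ≤ t) :
    ContDiffOn ℝ k (fun x => u x t) S :=
  ContDiffOn.comp (g := fun p : X × ℝ => u p.1 p.2) (f := fun x => (x, t)) h
    (by fun_prop) fun _ hx => ⟨hx, ht⟩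

theorem hasFDerivAt_of_spaceTime (hS : IsOpen S) {L : X × ℝ →L[ℝ] F} {x : X} {t : ℝ} (hx : x ∈ S)
    (h : HasFDerivWithinAt (fun p : X × ℝ => u p.1 p.2) L (S ×ˢ Ici 0) (x, t)) (ht : 0 ≤ t) :
    HasFDerivAt (fun z => u z t) (L.comp (ContinuousLinearMap.inl ℝ X ℝ)) x := by
  have h1 : HasFDerivWithinAt (fun z : X => (z, t)) (ContinuousLinearMap.inl ℝ X ℝ) S x :=
    (hasFDerivAt_prodMk_left x t).hasFDerivWithinAt
  have h2 : MapsTo (fun z : X => (z, t)) S (S ×ˢ Ici 0) := fun y hy => ⟨hy, ht⟩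
  exact (HasFDerivWithinAt.comp (g := fun p : X × ℝ => u p.1 p.2) x h h1 h2).hasFDerivAt
    (hS.mem_nhds hx)

theorem hasDerivWithinAt_of_spaceTime {L : X × ℝ →L[ℝ] F} {x : X} {t : ℝ} (hx : x ∈ S)
    (h : HasFDerivWithinAt (fun p : X × ℝ => u p.1 p.2) L (S ×ˢ Ici 0) (x, t)) :
    HasDerivWithinAt (u x) (L (0, 1)) (Ici 0) t := by
  have h1 : HasFDerivWithinAt (fun s : ℝ => (x, s)) (ContinuousLinearMap.inr ℝ X ℝ) (Ici 0) t :=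
    (hasFDerivAt_prodMk_right x t).hasFDerivWithinAt
  have h2 : MapsTo (fun s : ℝ => (x, s)) (Ici 0) (S ×ˢ Ici 0) := fun y hy => ⟨hx, hy⟩
  exact (HasFDerivWithinAt.comp (g := fun p : X × ℝ => u p.1 p.2) t h h1 h2).hasDerivWithinAt
    |>.congr_deriv (by simp)

theorem SpaceTimeC.continuousOn_fderiv (hS : IsOpen S) (h : SpaceTimeC 1 S u) :
    ContinuousOn (fun p : X × ℝ => fderiv ℝ (fun z => u z p.2) p.1) (S ×ˢ Ici 0) := by
  have h1 := ContDiffOn.continuousOn_fderivWithin h (uniqueDiffOn_prod_Ici hS) le_rfl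
  refine (h1.clm_comp (continuousOn_const (c := ContinuousLinearMap.inl ℝ X ℝ))).congr ?_
  rintro ⟨x, t⟩ ⟨hx, ht⟩
  have := (ContDiffOn.differentiableOn h one_ne_zero (x, t) ⟨hx, ht⟩).hasFDerivWithinAt
  exact (hasFDerivAt_of_spaceTime hS hx this ht).fderiv

/-- Time derivatives and space derivatives commute. -/
theorem SpaceTimeC.hasDerivWithinAt_fderiv (hS : IsOpen S) (h : SpaceTimeC 2 S u)
    (hu : ∀ x ∈ S, ∀ t, 0 ≤ t → HasDerivWithinAt (u x) (u' x t) (Ici 0) t) {x : X} (hx : x ∈ S)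
    {t : ℝ} (ht : 0 ≤ t) :
    HasDerivWithinAt (fun s => fderiv ℝ (fun z => u z s) x) (fderiv ℝ (fun z => u' z t) x)
      (Ici 0) t := by
  set f : X × ℝ → F := fun p => u p.1 p.2
  set s := S ×ˢ Ici (0 : ℝ)
  have hs : UniqueDiffOn ℝ s := uniqueDiffOn_prod_Ici hS
  have hdf : ∀ p ∈ s, HasFDerivWithinAt f (fderivWithin ℝ f s p) s p := fun p hp =>
    (ContDiffOn.differentiableOn h two_ne_zero p hp).hasFDerivWithinAt
  have hA : ContDiffOn ℝ 1 (fderivWithin ℝ f s) s :=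
    ContDiffOn.fderivWithin h hs (by norm_num)
  have hx' : (x, t) ∈ s := ⟨hx, ht⟩
  have hd2 : HasFDerivWithinAt (fderivWithin ℝ f s) (fderivWithin ℝ (fderivWithin ℝ f s) s (x, t))
      s (x, t) := (hA.differentiableOn one_ne_zero _ hx').hasFDerivWithinAt
  have hsym : IsSymmSndFDerivWithinAt ℝ f s (x, t) := by
    -- At `t = 0` the point lies on the boundary of the half-space; the second derivative is still
    -- symmetric because the point is in the closure of the interior.
    refine ContDiffWithinAt.isSymmSndFDerivWithinAt (ContDiffOn.contDiffWithinAt h hx')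
      (by simp) hs ?_ hx'
    rw [interior_prod_eq, hS.interior_eq, interior_Ici, closure_prod_eq, closure_Ioi]
    exact ⟨subset_closure hx, ht⟩
  have h1 : HasDerivWithinAt (fun r => fderivWithin ℝ f s (x, r))
      (fderivWithin ℝ (fderivWithin ℝ f s) s (x, t) (0, 1)) (Ici 0) t :=
    hasDerivWithinAt_of_spaceTime (u := fun y r => fderivWithin ℝ f s (y, r)) hx hd2
  have h2 : HasDerivWithinAt
      (fun r => (fderivWithin ℝ f s (x, r)).comp (ContinuousLinearMap.inl ℝ X ℝ))
      ((fderivWithin ℝ (fderivWithin ℝ f s) s (x, t) (0, 1)).comp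
        (ContinuousLinearMap.inl ℝ X ℝ)) (Ici 0) t := by
    have := h1.clm_comp (hasDerivWithinAt_const t (Ici 0) (ContinuousLinearMap.inl ℝ X ℝ))
    simpa using this
  have h3 : HasFDerivAt (fun z => u' z t)
      ((fderivWithin ℝ (fderivWithin ℝ f s) s (x, t) (0, 1)).comp
        (ContinuousLinearMap.inl ℝ X ℝ)) x := by
    have h4 : HasFDerivAt (fun z => fderivWithin ℝ f s (z, t))
        ((fderivWithin ℝ (fderivWithin ℝ f s) s (x, t)).comp (ContinuousLinearMap.inl ℝ X ℝ)) x :=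
      hasFDerivAt_of_spaceTime (u := fun y r => fderivWithin ℝ f s (y, r)) hS hx hd2 ht
    have h5 := h4.clm_apply (hasFDerivAt_const ((0, 1) : X × ℝ) x)
    -- Near `x` the function `u'` is the time component of the full derivative, so its space
    -- derivative is the mixed second derivative in the other order.
    have h6 : HasFDerivAt (fun z => u' z t) _ x := h5.congr_of_eventuallyEq (by
      filter_upwards [hS.mem_nhds hx] with z hz
      exact (uniqueDiffOn_Ici 0 t ht).eq_deriv _ (hu z hz t ht)
        (hasDerivWithinAt_of_spaceTime hz (hdf (z, t) ⟨hz, ht⟩)))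
    convert h6 using 1
    ext v
    simp [hsym (0, 1) (v, 0)]
  rw [h3.fderiv]
  refine h2.congr (fun r hr => ?_) ?_
  · exact (hasFDerivAt_of_spaceTime hS hx (hdf (x, r) ⟨hx, hr⟩) hr).fderiv
  · exact (hasFDerivAt_of_spaceTime hS hx (hdf (x, t) hx') ht).fderiv

/-- Makes the space derivatives of the successive time derivatives a chain to which Taylor's formula
in time applies. -/
theorem hasDerivWithinAt_fderiv_timeDeriv (hS : IsOpen S)
    (hu : ∀ x ∈ S, ContDiffOn ℝ ∞ (u x) (Ici 0)) (h : ∀ k, SpaceTimeC 2 S (timeDeriv k u)) (k : ℕ)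
    {x : X} (hx : x ∈ S) {t : ℝ} (ht : 0 ≤ t) :
    HasDerivWithinAt (fun s => fderiv ℝ (fun z => timeDeriv k u z s) x)
      (fderiv ℝ (fun z => timeDeriv (k + 1) u z t) x) (Ici 0) t :=
  (h k).hasDerivWithinAt_fderiv hS (fun y hy _ hs => hasDerivWithinAt_timeDeriv (hu y hy) k hs)
    hx ht

end SpaceTime

theorem uniformO_of_continuousOn {X F : Type*} [TopologicalSpace X] [NormedAddCommGroup F]
    {K : Set X} {T : ℝ} (hK : IsCompact K) {f : X → ℝ → F}
    (hf : ContinuousOn (fun p : X × ℝ => f p.1 p.2) (K ×ˢ Ici 0)) : UniformO K T 0 f := by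
  obtain ⟨C, hC⟩ := (hK.prod (isCompact_Icc (a := (0 : ℝ)) (b := T))).exists_bound_of_continuousOn
    (hf.mono (prod_mono_right Icc_subset_Ici_self))
  exact UniformO.of_bound fun x hx t ht => hC (x, t) ⟨hx, ht⟩

/-! ### The identity theorem on a half-line -/

/-- Near `0` the function is the restriction of a two-sided analytic `g`, whose Taylor coefficients
are the one-sided derivatives. They vanish, so `f` is zero just to the right of `0`, and the
identity theorem on the open half-line does the rest. -/
theorem eqOn_zero_of_analyticOn_Ici {f : ℝ → ℝ} (hf : AnalyticOn ℝ f (Ici 0))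
    (h0 : ∀ k, iteratedDerivWithin k f (Ici 0) 0 = 0) : EqOn f 0 (Ici 0) := by
  obtain ⟨g, -, hfg, hg⟩ := (hf 0 self_mem_Ici).exists_analyticAt
  rw [insert_eq_of_mem self_mem_Ici] at hfg
  have hg0 : ∀ k, iteratedDeriv k g 0 = 0 := fun k => by
    have h1 := iteratedDerivWithin_eq_iteratedDeriv (n := k) (uniqueDiffOn_Ici (0 : ℝ))
      hg.contDiffAt self_mem_Ici
    rw [← h1]
    exact (iteratedDerivWithin_congr hfg self_mem_Ici).symm.trans (h0 k)
  have hgz : ∀ᶠ t in 𝓝 0, g t = 0 := by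
    have h1 := hg.hasFPowerSeriesAt
    simp only [hg0, zero_div] at h1
    have h2 : FormalMultilinearSeries.ofScalars ℝ (fun _ : ℕ => (0 : ℝ)) = 0 := by
      ext n
      simp [FormalMultilinearSeries.ofScalars]
    rw [h2] at h1
    exact h1.eventually_eq_zero
  have hfa : AnalyticOnNhd ℝ f (Ioi 0) :=
    isOpen_Ioi.analyticOn_iff_analyticOnNhd.mp (hf.mono Ioi_subset_Ici_self)
  -- The identity theorem needs a point with a full neighbourhood of zeros; `0` itself is not in the
  -- open half-line.
  have hz : ∀ᶠ t in 𝓝[>] (0 : ℝ), ∀ᶠ s in 𝓝 t, f s = 0 := by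
    filter_upwards [self_mem_nhdsWithin, (eventually_eventually_nhds.mpr hgz).filter_mono
      nhdsWithin_le_nhds] with t ht h1
    filter_upwards [h1, Ioi_mem_nhds ht] with s hs hs'
    rw [hfg (Ioi_subset_Ici_self hs'), hs]
  obtain ⟨t, ht, htpos⟩ := (hz.and self_mem_nhdsWithin).exists
  have h1 := hfa.eqOn_zero_of_preconnected_of_eventuallyEq_zero isPreconnected_Ioi htpos ht
  intro s hs
  rcases (mem_Ici.mp hs).eq_or_lt with rfl | hs
  · simpa using h0 0
  · exact h1 hs

end Overdamped

namespace Overdamped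

variable {d n : ℕ}

/-! ### Gradients and divergences as linear images of the derivative -/

/-- The gradient as a continuous linear function of the derivative. -/
noncomputable def gradL (d : ℕ) : (E d →L[ℝ] ℝ) →L[ℝ] E d :=
  ∑ a : Fin d, ((ContinuousLinearMap.apply ℝ ℝ (EuclideanSpace.single a (1 : ℝ) : E d)).smulRight
    (EuclideanSpace.single a (1 : ℝ) : E d))

/-- The divergence as a continuous linear function of the derivative. -/
noncomputable def divL (d : ℕ) : (E d →L[ℝ] E d) →L[ℝ] ℝ :=
  ∑ a : Fin d, (EuclideanSpace.proj a : E d →L[ℝ] ℝ).comp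
    (ContinuousLinearMap.apply ℝ (E d) (EuclideanSpace.single a (1 : ℝ) : E d))

theorem sum_smul_single (v : E d) :
    ∑ a, v a • (EuclideanSpace.single a (1 : ℝ) : E d) = v := by
  ext b
  simp [Pi.single_apply]

theorem gradient_eq (f : E d → ℝ) (x : E d) : gradient f x = gradL d (fderiv ℝ f x) := by
  refine ext_inner_right ℝ fun v => ?_
  rw [gradient, InnerProductSpace.toDual_symm_apply]
  conv_lhs => rw [← sum_smul_single v]
  simp only [gradL, map_sum, map_smul, _root_.sum_apply,
    ContinuousLinearMap.smulRight_apply, ContinuousLinearMap.apply_apply, sum_inner,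
    inner_smul_left, EuclideanSpace.inner_single_left, smul_eq_mul]
  simp [mul_comm]

theorem inner_gradient (f : E d → ℝ) (x v : E d) : inner ℝ (gradient f x) v = fderiv ℝ f x v := by
  rw [gradient, InnerProductSpace.toDual_symm_apply]

theorem diverg_eq (G : E d → E d) (x : E d) : diverg G x = divL d (fderiv ℝ G x) := by
  simp [diverg, divL]

/-- The inclusion of `d`-space as the `i`-th factor of the configuration space. -/
noncomputable def slot (i : Fin n) : E d →L[ℝ] Conf d n :=
  ContinuousLinearMap.single ℝ (fun _ : Fin n => E d) i

theorem hasFDerivAt_comp_update {F : Type*} [NormedAddCommGroup F] [NormedSpace ℝ F]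
    {f : Conf d n → F} {x : Conf d n} (hf : DifferentiableAt ℝ f x) (i : Fin n) :
    HasFDerivAt (fun y => f (Function.update x i y)) ((fderiv ℝ f x).comp (slot i)) (x i) := by
  have h1 : HasFDerivAt (Function.update x i) (slot (d := d) i) (x i) := by
    have h3 := hasFDerivAt_update (𝕜 := ℝ) x (x i) (i := i)
    refine h3.congr_fderiv ?_
    ext v j
    by_cases hj : j = i
    · subst hj; simp [slot]
    · simp [slot, hj]
  have h2 : HasFDerivAt f (fderiv ℝ f x) (Function.update x i (x i)) := by
    rw [Function.update_eq_self]; exact hf.hasFDerivAt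
  exact h2.comp (x i) h1

theorem gradAt_eq {f : Conf d n → ℝ} {x : Conf d n} (hf : DifferentiableAt ℝ f x) (i : Fin n) :
    gradAt i f x = gradL d ((fderiv ℝ f x).comp (slot i)) := by
  rw [gradAt, gradient_eq, (hasFDerivAt_comp_update hf i).fderiv]

theorem divAt_eq {G : Conf d n → E d} {x : Conf d n} (hG : DifferentiableAt ℝ G x) (i : Fin n) :
    divAt i G x = divL d ((fderiv ℝ G x).comp (slot i)) := by
  rw [divAt, diverg_eq, (hasFDerivAt_comp_update hG i).fderiv]

/-! ### Regularity and product rules for partial gradients and divergences. -/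

section regularity

variable {U : Set (Conf d n)} {Ω : Set (E d)}

theorem contDiffOn_gradient (hΩ : IsOpen Ω) {f : E d → ℝ} {k : ℕ}
    (hf : ContDiffOn ℝ (k + 1) f Ω) : ContDiffOn ℝ k (gradient f) Ω := by
  have := (gradL d).contDiff.comp_contDiffOn (hf.fderiv_of_isOpen hΩ (m := k) le_rfl)
  exact this.congr fun x _ => gradient_eq f x

theorem continuousOn_diverg (hΩ : IsOpen Ω) {G : E d → E d} (hG : ContDiffOn ℝ 1 G Ω) :
    ContinuousOn (diverg G) Ω :=
  ((divL d).continuous.comp_continuousOn (hG.continuousOn_fderiv_of_isOpen hΩ le_rfl)).congr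
    fun x _ => diverg_eq G x

theorem contDiffOn_gradAt (hU : IsOpen U) {f : Conf d n → ℝ} {k : ℕ}
    (hf : ContDiffOn ℝ (k + 1) f U) (i : Fin n) : ContDiffOn ℝ k (gradAt i f) U := by
  have h1 := (hf.fderiv_of_isOpen hU (m := k) le_rfl).clm_comp
    (contDiffOn_const (c := slot (d := d) i))
  exact ((gradL d).contDiff.comp_contDiffOn h1).congr fun x hx =>
    gradAt_eq ((hf.differentiableOn (by simp)).differentiableAt (hU.mem_nhds hx)) i

theorem continuousOn_divAt (hU : IsOpen U) {G : Conf d n → E d} (hG : ContDiffOn ℝ 1 G U)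
    (i : Fin n) : ContinuousOn (divAt i G) U := by
  have h1 := (hG.continuousOn_fderiv_of_isOpen hU le_rfl).clm_comp
    (continuousOn_const (c := slot (d := d) i))
  exact ((divL d).continuous.comp_continuousOn h1).congr fun x hx =>
    divAt_eq ((hG.differentiableOn one_ne_zero).differentiableAt (hU.mem_nhds hx)) i

theorem divAt_const_smul (c : ℝ) (i : Fin n) (G : Conf d n → E d) (x : Conf d n) :
    divAt i (fun z => c • G z) x = c * divAt i G x := by
  simp only [divAt, diverg, Finset.mul_sum]
  refine Finset.sum_congr rfl fun a _ => ?_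
  have h' : fderiv ℝ (fun y => c • G (Function.update x i y)) (x i) =
      c • fderiv ℝ (fun y => G (Function.update x i y)) (x i) :=
    -- Valid without differentiability of `G`, since a nonzero scalar is invertible.
    congrFun (fderiv_const_smul_field (𝕜 := ℝ) (f := fun y => G (Function.update x i y)) c) (x i)
  rw [h']
  simp

theorem divAt_sub {G H : Conf d n → E d} {x : Conf d n} (i : Fin n)
    (hG : DifferentiableAt ℝ G x) (hH : DifferentiableAt ℝ H x) :
    divAt i (fun z => G z - H z) x = divAt i G x - divAt i H x := by
  rw [divAt_eq hG, divAt_eq hH, divAt_eq (G := fun z => G z - H z) (hG.sub hH), fderiv_fun_sub hG hH,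
    ContinuousLinearMap.sub_comp, map_sub]

theorem diverg_smul {φ : E d → ℝ} {G : E d → E d} {x : E d} (hφ : DifferentiableAt ℝ φ x)
    (hG : DifferentiableAt ℝ G x) :
    diverg (fun y => φ y • G y) x = φ x * diverg G x + inner ℝ (gradient φ x) (G x) := by
  rw [inner_gradient, diverg, fderiv_fun_smul hφ hG]
  conv_rhs => rw [← sum_smul_single (G x)]
  simp [diverg, Finset.sum_add_distrib, Finset.mul_sum, mul_comm]

end regularity

/-! ### Integration by parts -/

theorem contDiff_of_contDiffOn_tsupport {X F : Type*} [NormedAddCommGroup X] [NormedSpace ℝ X]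
    [NormedAddCommGroup F] [NormedSpace ℝ F] {k : WithTop ℕ∞} {U : Set X} (hU : IsOpen U)
    {f : X → F} (hf : ContDiffOn ℝ k f U) (hs : tsupport f ⊆ U) : ContDiff ℝ k f := by
  rw [contDiff_iff_contDiffAt]
  intro x
  by_cases hx : x ∈ tsupport f
  · exact hf.contDiffAt (hU.mem_nhds (hs hx))
  · exact contDiffAt_const.congr_of_eventuallyEq (notMem_tsupport_iff_eventuallyEq.mp hx)

/-- Integration by parts against the constant function `1`. -/
theorem integral_fderiv_apply_eq_zero {X : Type*} [NormedAddCommGroup X] [NormedSpace ℝ X]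
    [FiniteDimensional ℝ X] [MeasurableSpace X] [BorelSpace X] {μ : Measure X}
    [μ.IsAddHaarMeasure] {f : X → ℝ} (hf : ContDiff ℝ 1 f) (hs : HasCompactSupport f) (v : X) :
    ∫ x, fderiv ℝ f x v ∂μ = 0 := by
  have hd := hf.differentiable one_ne_zero
  have hi : Integrable (fun x => fderiv ℝ f x v) μ :=
    (hf.continuous_fderiv_apply one_ne_zero |>.comp
      (continuous_id.prodMk continuous_const)).integrable_of_hasCompactSupport
      (hs.fderiv_apply (𝕜 := ℝ) v)
  have := integral_mul_fderiv_eq_neg_fderiv_mul_of_integrable (μ := μ) (f := fun _ => (1 : ℝ))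
    (g := f) (v := v) (by simp) (by simpa using hi)
    (by simpa using hf.continuous.integrable_of_hasCompactSupport hs) (by simp)
    (fun x _ => hd x)
  simpa using this

theorem setIntegral_diverg_eq_zero {Ω : Set (E d)} (hΩ : IsOpen Ω) {H : E d → E d}
    (hH : ContDiffOn ℝ 1 H Ω) (hc : HasCompactSupport H) (hs : tsupport H ⊆ Ω) :
    ∫ x in Ω, diverg H x = 0 := by
  have hH' := contDiff_of_contDiffOn_tsupport hΩ hH hs
  have hd := hH'.differentiable one_ne_zero
  rw [setIntegral_eq_integral_of_forall_compl_eq_zero fun x hx => by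
    have h1 : fderiv ℝ H x = 0 := by
      by_contra h
      exact hx (hs (support_fderiv_subset ℝ h))
    simp [diverg, h1]]
  have hcomp : ∀ a x, fderiv ℝ H x (EuclideanSpace.single a 1) a =
      fderiv ℝ (fun y => H y a) x (EuclideanSpace.single a 1) := fun a x => by
    have := ((EuclideanSpace.proj a : E d →L[ℝ] ℝ).hasFDerivAt.comp x (hd x).hasFDerivAt).fderiv
    have h2 : fderiv ℝ (fun y => H y a) x =
      (EuclideanSpace.proj a : E d →L[ℝ] ℝ).comp (fderiv ℝ H x) := this
    rw [h2]; rfl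
  have hC : ∀ a : Fin d, ContDiff ℝ 1 (fun y => H y a) := fun a =>
    (EuclideanSpace.proj a : E d →L[ℝ] ℝ).contDiff.comp hH'
  have hS : ∀ a : Fin d, HasCompactSupport (fun y => H y a) := fun a =>
    hc.comp_left (g := fun v : E d => v a) rfl
  simp only [diverg, hcomp]
  rw [integral_finsetSum]
  · exact Finset.sum_eq_zero fun a _ => integral_fderiv_apply_eq_zero (hC a) (hS a) _
  · intro a _
    exact ((hC a).continuous_fderiv_apply one_ne_zero |>.comp
      (continuous_id.prodMk continuous_const)).integrable_of_hasCompactSupport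
      ((hS a).fderiv_apply (𝕜 := ℝ) _)

/-- Only the product must have compact support, so that either factor can play the role of the test
function; both cases occur later. -/
theorem setIntegral_mul_diverg_add_inner_eq_zero {Ω : Set (E d)} (hΩ : IsOpen Ω) {φ : E d → ℝ}
    {G : E d → E d} (hφ : ContDiffOn ℝ 1 φ Ω) (hG : ContDiffOn ℝ 1 G Ω)
    (hc : HasCompactSupport (fun y => φ y • G y)) (hs : tsupport (fun y => φ y • G y) ⊆ Ω) :
    ∫ x in Ω, (φ x * diverg G x + inner ℝ (gradient φ x) (G x)) = 0 := by
  rw [← setIntegral_diverg_eq_zero hΩ (hφ.smul hG) hc hs]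
  refine setIntegral_congr_fun hΩ.measurableSet fun x hx => ?_
  exact (diverg_smul ((hφ.differentiableOn one_ne_zero).differentiableAt (hΩ.mem_nhds hx))
    ((hG.differentiableOn one_ne_zero).differentiableAt (hΩ.mem_nhds hx))).symm

/-! ### Integration over one particle -/

theorem integrableOn_of_continuousOn_of_bounded {X F : Type*} [TopologicalSpace X]
    [TopologicalSpace.PseudoMetrizableSpace X] [MeasurableSpace X] [OpensMeasurableSpace X] [SecondCountableTopology X] {μ : Measure X}
    [NormedAddCommGroup F] {A : Set X} (hA : MeasurableSet A) (hμ : μ A < ⊤) {f : X → F} {C : ℝ}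
    (hf : ContinuousOn f A) (hC : ∀ x ∈ A, ‖f x‖ ≤ C) : IntegrableOn f A μ := by
  have : IsFiniteMeasure (μ.restrict A) := ⟨by simpa using hμ⟩
  refine Integrable.of_bound
    (hf.aestronglyMeasurable_of_isSeparable hA (TopologicalSpace.IsSeparable.of_separableSpace _))
    C ?_
  exact (ae_restrict_iff' hA).mpr (Eventually.of_forall hC)

section slices

variable {Ω : Set (E d)} {F : Type*} [NormedAddCommGroup F]

theorem preimage_piFinSuccAbove_symm_pi (i : Fin (n + 1)) :
    (MeasurableEquiv.piFinSuccAbove (fun _ : Fin (n + 1) => E d) i).symm ⁻¹'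
      (univ.pi fun _ => Ω) = Ω ×ˢ univ.pi fun _ => Ω := by
  ext p
  simp [MeasurableEquiv.piFinSuccAbove_symm_apply, Fin.insertNthEquiv,
    Fin.forall_iff_succAbove i]

theorem integrableOn_insertNth {h : Conf d (n + 1) → F}
    (hh : IntegrableOn h (univ.pi fun _ => Ω)) (i : Fin (n + 1)) :
    IntegrableOn (fun p : E d × Conf d n => h (i.insertNth (α := fun _ => E d) p.1 p.2))
      (Ω ×ˢ univ.pi fun _ => Ω) := by
  have hm := (volume_preserving_piFinSuccAbove (fun _ : Fin (n + 1) => E d) i).symm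
  have he := (MeasurableEquiv.piFinSuccAbove (fun _ : Fin (n + 1) => E d) i).symm.measurableEmbedding
  have h1 := (hm.integrableOn_comp_preimage he (f := h) (s := univ.pi fun _ => Ω)).mpr hh
  rwa [preimage_piFinSuccAbove_symm_pi] at h1

variable [NormedSpace ℝ F]

theorem setIntegral_insertNth (h : Conf d (n + 1) → F) (i : Fin (n + 1)) :
    ∫ x in univ.pi fun _ => Ω, h x = ∫ p in (Ω ×ˢ univ.pi fun _ => Ω : Set (E d × Conf d n)),
      h (i.insertNth (α := fun _ => E d) p.1 p.2) := by
  have hm := (volume_preserving_piFinSuccAbove (fun _ : Fin (n + 1) => E d) i).symm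
  have he := (MeasurableEquiv.piFinSuccAbove (fun _ : Fin (n + 1) => E d) i).symm.measurableEmbedding
  rw [← hm.setIntegral_preimage_emb he, preimage_piFinSuccAbove_symm_pi]
  rfl

/-- If the integrals over the position of the `i`-th particle vanish, then so does the integral over
the configuration space. -/
theorem setIntegral_pi_eq_zero_of_update (hΩ : MeasurableSet Ω) {h : Conf d (n + 1) → F}
    (hh : IntegrableOn h (univ.pi fun _ => Ω)) (i : Fin (n + 1))
    (h0 : ∀ x ∈ univ.pi fun _ => Ω, ∫ y in Ω, h (Function.update x i y) = 0) :
    ∫ x in univ.pi fun _ => Ω, h x = 0 := by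
  have h1 := integrableOn_insertNth hh i
  rw [setIntegral_insertNth h i]
  have hvol : (volume : Measure (E d × Conf d n)) = Measure.prod volume volume := rfl
  -- The swap makes the position of the `i`-th particle the inner variable of Fubini's theorem.
  rw [hvol, ← Measure.prod_restrict, ← integral_prod_swap,
    integral_prod]
  · refine integral_eq_zero_of_ae ?_
    rw [EventuallyEq, ae_restrict_iff' (MeasurableSet.univ_pi fun _ => hΩ)]
    refine Eventually.of_forall fun z hz => ?_
    rcases Ω.eq_empty_or_nonempty with rfl | ⟨y, hy⟩
    · simp
    · have := h0 (i.insertNth (α := fun _ => E d) y z) (by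
        simpa [Fin.forall_iff_succAbove i] using ⟨hy, by simpa using hz⟩)
      simpa using this
  · rw [IntegrableOn, hvol, ← Measure.prod_restrict] at h1
    exact h1.swap

theorem setIntegral_pi_cons {h : Conf d (n + 1) → F}
    (hh : IntegrableOn h (univ.pi fun _ => Ω)) :
    ∫ x in univ.pi fun _ => Ω, h x =
      ∫ y in Ω, ∫ z in univ.pi fun _ => Ω, h (Fin.cons (α := fun _ => E d) y z) := by
  have h1 := integrableOn_insertNth hh 0
  have hvol : (volume : Measure (E d × Conf d n)) = Measure.prod volume volume := rfl
  rw [IntegrableOn, hvol, ← Measure.prod_restrict] at h1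
  rw [setIntegral_insertNth h 0, hvol, ← Measure.prod_restrict, integral_prod _ h1]
  simp

end slices

end Overdamped

namespace Overdamped

variable {d : ℕ}

/-! ### Boundary layers -/

/-- `s ↦ step s` is smooth, `0` for `s ≤ 1` and `1` for `2 ≤ s`. -/
noncomputable def step (s : ℝ) : ℝ := Real.smoothTransition (s - 1)

theorem contDiff_step {k : ℕ∞} : ContDiff ℝ k step :=
  Real.smoothTransition.contDiff.comp (contDiff_id.sub contDiff_const)

theorem step_nonneg (s : ℝ) : 0 ≤ step s := Real.smoothTransition.nonneg _

theorem step_le_one (s : ℝ) : step s ≤ 1 := Real.smoothTransition.le_one _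

theorem step_of_le {s : ℝ} (h : s ≤ 1) : step s = 0 :=
  Real.smoothTransition.zero_of_nonpos (by linarith)

theorem step_of_ge {s : ℝ} (h : 2 ≤ s) : step s = 1 :=
  Real.smoothTransition.one_of_one_le (by linarith)

/-- With `e = expNegInvGlue` the function is `e(s) / (e(s) + e(1 - s))`. After clearing
denominators, monotonicity reduces to `e(a) e(1 - b) ≤ e(b) e(1 - a)`. -/
theorem monotone_smoothTransition : Monotone Real.smoothTransition := by
  intro a b hab
  unfold Real.smoothTransition
  have ha := Real.smoothTransition.pos_denom a
  have hb := Real.smoothTransition.pos_denom b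
  have h1 := expNegInvGlue.monotone hab
  have h2 := expNegInvGlue.monotone (sub_le_sub_left hab 1)
  rw [div_le_div_iff₀ ha hb]
  have h3 := mul_le_mul h1 h2 (expNegInvGlue.nonneg _) (expNegInvGlue.nonneg _)
  nlinarith

theorem deriv_step_nonneg (s : ℝ) : 0 ≤ deriv step s :=
  (monotone_smoothTransition.comp fun _ _ h => sub_le_sub_right h 1 : Monotone step).deriv_nonneg

theorem deriv_step_of_gt {s : ℝ} (h : 2 < s) : deriv step s = 0 := by
  have : step =ᶠ[𝓝 s] fun _ => 1 := by
    filter_upwards [Ioi_mem_nhds h] with r hr using step_of_ge (le_of_lt hr)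
  rw [this.deriv_eq]; simp

/-- The density `step'(-g / ε) / ε` of the boundary layer of width `ε` of `{g < 0}`. -/
noncomputable def layer (g : E d → ℝ) (ε : ℝ) (y : E d) : ℝ := deriv step (-g y / ε) / ε

/-- A smooth cutoff function of `{g < 0}`. -/
noncomputable def cutoff (g : E d → ℝ) (ε : ℝ) (y : E d) : ℝ := step (-g y / ε)

section layers

variable {g : E d → ℝ} {ε : ℝ}

theorem cutoff_nonneg (y : E d) : 0 ≤ cutoff g ε y := step_nonneg _

theorem cutoff_le_one (y : E d) : cutoff g ε y ≤ 1 := step_le_one _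

theorem contDiff_cutoff {k : ℕ∞} (hg : ContDiff ℝ ∞ g) : ContDiff ℝ k (cutoff g ε) :=
  contDiff_step.comp ((hg.of_le (by exact_mod_cast le_top)).neg.div_const ε)

theorem fderiv_cutoff (hg : ContDiff ℝ ∞ g) (y v : E d) :
    fderiv ℝ (cutoff g ε) y v = -(layer g ε y * fderiv ℝ g y v) := by
  have h1 : HasFDerivAt (fun z => -g z / ε) (-(ε⁻¹ • fderiv ℝ g y)) y := by
    have := ((hg.differentiable (by simp) y).hasFDerivAt.neg).mul_const ε⁻¹
    simpa [div_eq_mul_inv] using this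
  have h2 : HasDerivAt step (deriv step (-g y / ε)) (-g y / ε) :=
    ((contDiff_step (k := 1)).differentiable one_ne_zero _).hasDerivAt
  have h3 := (h2.comp_hasFDerivAt y h1).fderiv
  have h4 : fderiv ℝ (cutoff g ε) y = deriv step (-g y / ε) • -(ε⁻¹ • fderiv ℝ g y) := h3
  rw [h4]
  simp only [layer, _root_.smul_apply, _root_.neg_apply, smul_eq_mul]
  ring

theorem continuous_layer (hg : ContDiff ℝ ∞ g) : Continuous (layer g ε) := by
  have h1 : Continuous (deriv step) := (contDiff_step (k := 1)).continuous_deriv le_rfl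
  exact (h1.comp (hg.continuous.neg.div_const ε)).div_const ε

theorem layer_nonneg (hε : 0 < ε) (y : E d) : 0 ≤ layer g ε y :=
  div_nonneg (deriv_step_nonneg _) hε.le

theorem layer_eq_zero (hε : 0 < ε) {y : E d} (h : g y < -(2 * ε)) : layer g ε y = 0 := by
  rw [layer, deriv_step_of_gt, zero_div]
  rw [lt_div_iff₀ hε]; linarith

/-- The mass of boundary layers is bounded. -/
theorem integral_mul_layer_le (hg : ContDiff ℝ ∞ g) (hε : 0 < ε) {θ : E d → ℝ}
    (hθ : ContDiff ℝ 1 θ) (hθc : HasCompactSupport θ) (hθ0 : ∀ y, 0 ≤ θ y) {e : E d} {c : ℝ}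
    (hc : ∀ y ∈ Function.support θ, c ≤ fderiv ℝ g y e) :
    c * ∫ y, θ y * layer g ε y ≤ ∫ y, |fderiv ℝ θ y e| := by
  have hχ : ContDiff ℝ 1 (cutoff g ε) := contDiff_cutoff (k := 1) hg
  -- The layer is, up to the factor `fderiv ℝ g y e`, minus the derivative of the cutoff. Moving
  -- this derivative onto `θ` yields a bound that does not depend on `ε`.
  have h0 := integral_fderiv_apply_eq_zero (μ := volume) (f := fun y => θ y * cutoff g ε y)
    (hθ.mul hχ) hθc.mul_right e
  have hdg : Continuous fun y => fderiv ℝ g y e :=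
    (hg.continuous_fderiv (by simp)).clm_apply continuous_const
  have hdθ : Continuous fun y => fderiv ℝ θ y e :=
    (hθ.continuous_fderiv (by simp)).clm_apply continuous_const
  have hdθc : HasCompactSupport fun y => fderiv ℝ θ y e := hθc.fderiv_apply (𝕜 := ℝ) e
  have i1 : Integrable fun y => θ y * (layer g ε y * fderiv ℝ g y e) :=
    (hθ.continuous.mul ((continuous_layer hg).mul hdg)).integrable_of_hasCompactSupport
      hθc.mul_right
  have i2 : Integrable fun y => cutoff g ε y * fderiv ℝ θ y e :=
    (hχ.continuous.mul hdθ).integrable_of_hasCompactSupport hdθc.mul_left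
  have i3 : Integrable fun y => c * (θ y * layer g ε y) :=
    ((hθ.continuous.mul (continuous_layer hg)).integrable_of_hasCompactSupport
      hθc.mul_right).const_mul c
  have i4 : Integrable fun y => |fderiv ℝ θ y e| :=
    (hdθ.integrable_of_hasCompactSupport hdθc).abs
  have h1 : ∀ y, fderiv ℝ (fun y => θ y * cutoff g ε y) y e =
      cutoff g ε y * fderiv ℝ θ y e - θ y * (layer g ε y * fderiv ℝ g y e) := fun y => by
    rw [fderiv_fun_mul (hθ.differentiable one_ne_zero y) (hχ.differentiable one_ne_zero y)]
    simp only [_root_.add_apply, _root_.smul_apply, smul_eq_mul, fderiv_cutoff hg]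
    ring
  simp only [h1] at h0
  rw [integral_sub i2 i1, sub_eq_zero] at h0
  rw [← integral_const_mul]
  calc ∫ y, c * (θ y * layer g ε y) ≤ ∫ y, θ y * (layer g ε y * fderiv ℝ g y e) := by
        refine integral_mono i3 i1 fun y => ?_
        by_cases hy : θ y = 0
        · simp [hy]
        · have h2 := mul_le_mul_of_nonneg_left (hc y hy)
            (mul_nonneg (hθ0 y) (layer_nonneg (g := g) hε y))
          simp only
          linarith
    _ = ∫ y, cutoff g ε y * fderiv ℝ θ y e := h0.symm
    _ ≤ ∫ y, |fderiv ℝ θ y e| := by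
        refine integral_mono i2 i4 fun y => ?_
        have h3 : cutoff g ε y ≤ 1 := step_le_one _
        have h4 : 0 ≤ cutoff g ε y := step_nonneg _
        have h5 := le_abs_self (fderiv ℝ θ y e)
        have h6 := abs_nonneg (fderiv ℝ θ y e)
        simp only
        nlinarith

end layers

/-- A bounded continuous vector field on `Ω` without normal component at the boundary. -/
structure IsTangentField (Ω : Set (E d)) (G : E d → E d) : Prop where
  continuousOn : ContinuousOn G Ω
  bounded : ∃ C, ∀ x ∈ Ω, ‖G x‖ ≤ C
  tangent : ∀ x ∈ frontier Ω, ∀ ν, IsOutwardUnitNormal Ω x ν →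
    Tendsto (fun y => inner ℝ ν (G y)) (𝓝[Ω] x) (𝓝 0)

/-- The divergence of `G` vanishes in the weak sense. -/
def IsWeaklyDivFree (Ω : Set (E d)) (G : E d → E d) : Prop :=
  ∀ φ : E d → ℝ, ContDiff ℝ 2 φ → HasCompactSupport φ → tsupport φ ⊆ Ω →
    ∫ x in Ω, fderiv ℝ φ x (G x) = 0

/-- The boundary condition uses the normal frozen at `x`. Replacing it by the derivative of `g` at
the moving point costs at most `‖fderiv ℝ g y - fderiv ℝ g x‖ * C`, which tends to `0`. -/
theorem IsTangentField.tendsto_fderiv {Ω : Set (E d)} {G : E d → E d} (hG : IsTangentField Ω G)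
    {x : E d} (hx : x ∈ frontier Ω) {g : E d → ℝ} (hg : IsLocalDefiningFunction Ω x g) :
    Tendsto (fun y => fderiv ℝ g y (G y)) (𝓝[Ω] x) (𝓝 0) := by
  obtain ⟨C, hC⟩ := hG.bounded
  have h1 := hG.tangent x hx _ ⟨g, hg, rfl⟩
  have hne : ‖gradient g x‖ ≠ 0 := norm_ne_zero_iff.mpr hg.2.1
  have h2 : Tendsto (fun y => fderiv ℝ g x (G y)) (𝓝[Ω] x) (𝓝 0) := by
    have := h1.const_mul ‖gradient g x‖
    simp only [inner_smul_left, inner_gradient, mul_zero] at this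
    refine this.congr fun y => ?_
    simp [hne]
  have h3 : Tendsto (fun y => ‖fderiv ℝ g y - fderiv ℝ g x‖ * C) (𝓝[Ω] x) (𝓝 0) := by
    have hc : Continuous (fun y => ‖fderiv ℝ g y - fderiv ℝ g x‖ * C) :=
      ((hg.1.continuous_fderiv (by simp)).sub continuous_const).norm.mul continuous_const
    have := (hc.tendsto x).mono_left (nhdsWithin_le_nhds (s := Ω))
    simpa using this
  have h4 : Tendsto (fun y => (fderiv ℝ g y - fderiv ℝ g x) (G y)) (𝓝[Ω] x) (𝓝 0) := by
    refine squeeze_zero_norm' ?_ h3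
    filter_upwards [self_mem_nhdsWithin] with y hy
    exact (ContinuousLinearMap.le_opNorm _ _).trans (by gcongr; exact hC y hy)
  have := h2.add h4
  simpa using this

/-- Compactness turns the pointwise limits at the boundary into a uniform one. Near a boundary point
the limit gives the bound, near an interior point the layer is empty for small `ε`, and near an
exterior point there is nothing to show. -/
theorem IsTangentField.exists_layer_bound {Ω : Set (E d)} (hΩ : IsOpen Ω) {G : E d → E d}
    (hG : IsTangentField Ω G) {g : E d → ℝ} {K : Set (E d)} (hK : IsCompact K)
    (hgK : ∀ x ∈ K, x ∈ frontier Ω → IsLocalDefiningFunction Ω x g)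
    (hgc : Continuous g) (hneg : ∀ x ∈ K, x ∈ Ω → g x < 0) {δ : ℝ} (hδ : 0 < δ) :
    ∃ ε > 0, ∀ y ∈ K, y ∈ Ω → -ε < g y → |fderiv ℝ g y (G y)| ≤ δ := by
  -- The membership in `K` is doubled because the compactness induction replaces one copy by
  -- membership in a subset.
  suffices h : ∃ ε > 0, ∀ y ∈ K, y ∈ K → y ∈ Ω → -ε < g y → |fderiv ℝ g y (G y)| ≤ δ by
    obtain ⟨ε, hε, h⟩ := h
    exact ⟨ε, hε, fun y hy => h y hy hy⟩
  refine hK.induction_on (p := fun s => ∃ ε > 0, ∀ y ∈ s, y ∈ K → y ∈ Ω → -ε < g y →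
    |fderiv ℝ g y (G y)| ≤ δ) ⟨1, one_pos, by simp⟩ ?_ ?_ ?_
  · rintro s t hst ⟨ε, hε, h⟩
    exact ⟨ε, hε, fun y hy => h y (hst hy)⟩
  · rintro s t ⟨ε, hε, h⟩ ⟨ε', hε', h'⟩
    refine ⟨min ε ε', lt_min hε hε', ?_⟩
    rintro y (hy | hy) hyK hyΩ hgy
    · exact h y hy hyK hyΩ (lt_of_le_of_lt (neg_le_neg (min_le_left _ _)) hgy)
    · exact h' y hy hyK hyΩ (lt_of_le_of_lt (neg_le_neg (min_le_right _ _)) hgy)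
  · intro x hx
    by_cases hxc : x ∈ closure Ω
    · by_cases hxΩ : x ∈ Ω
      · have h1 : g x < g x / 2 := by linarith [hneg x hx hxΩ]
        -- With `ε = -(g x / 2)` no point of this neighbourhood satisfies `-ε < g y`.
        refine ⟨{y | g y < g x / 2}, mem_nhdsWithin_of_mem_nhds
          ((isOpen_lt hgc continuous_const).mem_nhds h1), -(g x / 2),
          by linarith [hneg x hx hxΩ], fun y hy _ _ hgy => ?_⟩
        change g y < g x / 2 at hy
        linarith
      · have hfr : x ∈ frontier Ω := by rw [hΩ.frontier_eq]; exact ⟨hxc, hxΩ⟩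
        have h1 := hG.tendsto_fderiv hfr (hgK x hx hfr)
        have h2 := h1.eventually (Metric.closedBall_mem_nhds 0 hδ)
        rw [eventually_nhdsWithin_iff] at h2
        refine ⟨_, mem_nhdsWithin_of_mem_nhds h2, 1, one_pos, fun y hy _ hyΩ _ => ?_⟩
        simpa using hy hyΩ
    · refine ⟨(closure Ω)ᶜ, mem_nhdsWithin_of_mem_nhds (isClosed_closure.isOpen_compl.mem_nhds hxc),
        1, one_pos, fun y hy _ hyΩ _ => absurd (subset_closure hyΩ) hy⟩

/-- The test functions that are smooth up to the boundary: the products of a smooth function and a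
bounded `C²` function with bounded derivative. -/
structure IsBoundedC2 (Ω : Set (E d)) (w : E d → ℝ) : Prop where
  contDiffOn : ContDiffOn ℝ 2 w Ω
  bounded : ∃ C, ∀ x ∈ Ω, |w x| ≤ C
  fderiv_bounded : ∃ C, ∀ x ∈ Ω, ‖fderiv ℝ w x‖ ≤ C

/-! ### The divergence theorem for tangent fields and the energy identity. -/

section energy

variable {Ω : Set (E d)} {G : E d → E d} {w ψ : E d → ℝ}

theorem contDiff_two_of_infty {X F : Type*} [NormedAddCommGroup X] [NormedSpace ℝ X]
    [NormedAddCommGroup F] [NormedSpace ℝ F] {f : X → F} (hf : ContDiff ℝ ∞ f) : ContDiff ℝ 2 f :=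
  contDiff_infty.mp hf 2

theorem IsBoundedC2.mul_smooth (hΩ : IsOpen Ω) (hw : IsBoundedC2 Ω w) (hψ : ContDiff ℝ ∞ ψ)
    (hψc : HasCompactSupport ψ) : IsBoundedC2 Ω (fun y => ψ y * w y) := by
  obtain ⟨C, hC⟩ := hw.bounded
  obtain ⟨C', hC'⟩ := hw.fderiv_bounded
  obtain ⟨B, hB⟩ := hψ.continuous.bounded_above_of_compact_support hψc
  obtain ⟨B', hB'⟩ := (hψ.continuous_fderiv (by simp)).bounded_above_of_compact_support
    (hψc.fderiv (𝕜 := ℝ))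
  refine ⟨(contDiff_two_of_infty hψ).contDiffOn.mul hw.contDiffOn, ⟨B * C, fun x hx => ?_⟩,
    ⟨B * C' + C * B', fun x hx => ?_⟩⟩
  · rw [abs_mul]
    exact mul_le_mul (hB x) (hC x hx) (abs_nonneg _) ((norm_nonneg _).trans (hB x))
  · rw [fderiv_fun_mul (hψ.differentiable (by simp) x)
      ((hw.contDiffOn.differentiableOn two_ne_zero).differentiableAt (hΩ.mem_nhds hx))]
    refine (norm_add_le _ _).trans ?_
    rw [norm_smul, norm_smul]
    exact add_le_add
      (mul_le_mul (hB x) (hC' x hx) (norm_nonneg _) ((norm_nonneg _).trans (hB x)))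
      (mul_le_mul (hC x hx) (hB' x) (norm_nonneg _) ((abs_nonneg _).trans (hC x hx)))

theorem IsBoundedC2.continuousOn_fderiv_apply (hΩ : IsOpen Ω) (hw : IsBoundedC2 Ω w)
    (hG : ContinuousOn G Ω) : ContinuousOn (fun y => fderiv ℝ w y (G y)) Ω :=
  (hw.contDiffOn.continuousOn_fderiv_of_isOpen hΩ (by norm_num)).clm_apply hG

theorem IsBoundedC2.exists_bound_apply (hw : IsBoundedC2 Ω w) (hG : IsTangentField Ω G) :
    ∃ C, ∀ y ∈ Ω, ‖fderiv ℝ w y (G y)‖ ≤ C := by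
  obtain ⟨C, hC⟩ := hw.fderiv_bounded
  obtain ⟨B, hB⟩ := hG.bounded
  refine ⟨C * B, fun y hy => (ContinuousLinearMap.le_opNorm _ _).trans ?_⟩
  exact mul_le_mul (hC y hy) (hB y hy) (norm_nonneg _) ((norm_nonneg _).trans (hC y hy))

theorem IsBoundedC2.integrableOn_apply (hΩ : IsOpen Ω) (hΩb : volume Ω < ⊤)
    (hw : IsBoundedC2 Ω w) (hG : IsTangentField Ω G) :
    IntegrableOn (fun y => fderiv ℝ w y (G y)) Ω := by
  obtain ⟨C, hC⟩ := hw.exists_bound_apply hG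
  exact integrableOn_of_continuousOn_of_bounded hΩ.measurableSet hΩb
    (hw.continuousOn_fderiv_apply hΩ hG.continuousOn) hC

/-- The product `ψ w` is `C²` on the whole space because it vanishes off the support of `ψ`, hence
it is an admissible test function. -/
theorem setIntegral_fderiv_mul_eq_zero_of_tsupport (hΩ : IsOpen Ω) (hdiv : IsWeaklyDivFree Ω G)
    (hw : ContDiffOn ℝ 2 w Ω) (hψ : ContDiff ℝ ∞ ψ) (hψc : HasCompactSupport ψ)
    (hs : tsupport ψ ⊆ Ω) : ∫ x in Ω, fderiv ℝ (fun y => ψ y * w y) x (G x) = 0 := by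
  have hs' : tsupport (fun y => ψ y * w y) ⊆ Ω := (tsupport_mul_subset_left).trans hs
  exact hdiv _ (contDiff_of_contDiffOn_tsupport hΩ
    ((contDiff_two_of_infty hψ).contDiffOn.mul hw) hs') hψc.mul_right hs'

/-- Multiply `ψ w` by the cutoff of width `ε`, which makes it an admissible test function. The
integral of the cutoff times `A` then equals the integral of the layer term `L ε`. As `ε → 0` the
former tends to `∫ A` by dominated convergence. The latter is at most a constant times `δ`, since
the layers have bounded mass and the normal component of `G` is at most `δ` on them. -/
theorem exists_ball_setIntegral_fderiv_mul_eq_zero (hΩ : IsOpen Ω) (hΩb : volume Ω < ⊤)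
    (hG : IsTangentField Ω G) (hdiv : IsWeaklyDivFree Ω G) (hw : IsBoundedC2 Ω w) {x₀ : E d}
    (hx₀ : x₀ ∈ closure Ω) {g : E d → ℝ} (hg : IsLocalDefiningFunction Ω x₀ g) :
    ∃ r > 0, ∀ ψ : E d → ℝ, ContDiff ℝ ∞ ψ → tsupport ψ ⊆ Metric.ball x₀ r →
      ∫ x in Ω, fderiv ℝ (fun y => ψ y * w y) x (G x) = 0 := by
  obtain ⟨hgs, hg0, hgΩ⟩ := hg
  set e := gradient g x₀ with he
  -- At `x₀` the derivative of `g` along its gradient `e` is `‖e‖ ^ 2`; half of it survives as a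
  -- lower bound nearby.
  set c := ‖e‖ ^ 2 / 2 with hc
  have hcpos : 0 < c := by have := norm_pos_iff.mpr hg0; positivity
  have hdg : Continuous fun y => fderiv ℝ g y e :=
    (hgs.continuous_fderiv (by simp)).clm_apply continuous_const
  have hge : c < fderiv ℝ g x₀ e := by
    rw [← inner_gradient, real_inner_self_eq_norm_sq, hc]
    have := norm_pos_iff.mpr hg0
    have : 0 < ‖e‖ ^ 2 := by positivity
    linarith
  have hev : ∀ᶠ y in 𝓝 x₀, (y ∈ Ω ↔ g y < 0) ∧ (∀ᶠ z in 𝓝 y, (z ∈ Ω ↔ g z < 0)) ∧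
      c < fderiv ℝ g y e := by
    filter_upwards [hgΩ, eventually_eventually_nhds.mpr hgΩ,
      (isOpen_lt continuous_const hdg).mem_nhds hge] with y h1 h2 h3 using ⟨h1, h2, h3⟩
  obtain ⟨R, hR, hball⟩ := Metric.eventually_nhds_iff_ball.mp hev
  -- Half the radius leaves room for a bump `θ` that is `1` on the support of `ψ` and lives where
  -- the lower bound `c` holds.
  refine ⟨R / 2, by positivity, fun ψ hψ hψs => ?_⟩
  have hψc : HasCompactSupport ψ := (isCompact_closedBall x₀ (R / 2)).of_isClosed_subset
    (isClosed_tsupport ψ) (hψs.trans Metric.ball_subset_closedBall)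
  have hψR : tsupport ψ ⊆ Metric.ball x₀ R :=
    hψs.trans (Metric.ball_subset_ball (by linarith))
  let θ : ContDiffBump x₀ := ⟨R / 2, R, by positivity, by linarith⟩
  have hθs : Function.support θ = Metric.ball x₀ R := θ.support_eq
  have hθ1 : ∀ y ∈ tsupport ψ, θ y = 1 := fun y hy =>
    θ.one_of_mem_closedBall (Metric.ball_subset_closedBall (hψs hy))
  set M := ∫ y, |fderiv ℝ θ y e| with hM
  have hlayer : ∀ ε, 0 < ε → ∫ y, θ y * layer g ε y ≤ M / c := fun ε hε => by
    rw [le_div_iff₀' hcpos]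
    refine integral_mul_layer_le hgs hε (θ.contDiff (n := 1)) θ.hasCompactSupport
      (fun y => θ.nonneg) fun y hy => ?_
    rw [hθs] at hy
    exact (hball y hy).2.2.le
  have hMnn : 0 ≤ M := integral_nonneg fun _ => abs_nonneg _
  have hint : ∀ ε, Integrable fun y => θ y * layer g ε y := fun ε =>
    (θ.continuous.mul (continuous_layer hgs)).integrable_of_hasCompactSupport
      θ.hasCompactSupport.mul_right
  have hψw := hw.mul_smooth hΩ hψ hψc
  set A : E d → ℝ := fun x => fderiv ℝ (fun y => ψ y * w y) x (G x) with hA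
  have hAi : IntegrableOn A Ω := hψw.integrableOn_apply hΩ hΩb hG
  have hAc : ContinuousOn A Ω := hψw.continuousOn_fderiv_apply hΩ hG.continuousOn
  obtain ⟨B, hB⟩ := hψw.bounded
  -- the contribution of a boundary layer
  set L : ℝ → E d → ℝ := fun ε x => ψ x * w x * (layer g ε x * fderiv ℝ g x (G x)) with hL
  have hχA : ∀ ε, 0 < ε → ∫ x in Ω, (cutoff g ε x * A x - L ε x) = 0 := fun ε hε => by
    have hχ : ContDiff ℝ ∞ (cutoff g ε) := contDiff_cutoff (k := ⊤) hgs
    have hs : tsupport (fun y => ψ y * cutoff g ε y) ⊆ Ω := by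
      -- The cutoff vanishes where `g > -ε`, so the closed support keeps away from the boundary.
      have h1 : tsupport (fun y => ψ y * cutoff g ε y) ⊆ tsupport ψ ∩ {y | g y ≤ -ε} := by
        refine closure_minimal (fun y hy => ?_)
          ((isClosed_tsupport ψ).inter (isClosed_le hgs.continuous continuous_const))
        have hy' : ψ y * cutoff g ε y ≠ 0 := hy
        refine ⟨subset_tsupport ψ (left_ne_zero_of_mul hy'), ?_⟩
        by_contra hcon
        refine right_ne_zero_of_mul hy' (step_of_le ?_)
        have : -ε < g y := not_le.mp hcon
        rw [div_le_one hε]; linarith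
      intro y hy
      have h2 := h1 hy
      refine (hball y (hψR h2.1)).1.mpr ?_
      have : g y ≤ -ε := h2.2
      linarith
    have h0 := setIntegral_fderiv_mul_eq_zero_of_tsupport hΩ hdiv hw.contDiffOn (hψ.mul hχ)
      hψc.mul_right hs
    rw [← h0]
    refine setIntegral_congr_fun hΩ.measurableSet fun x hx => ?_
    have hd1 : DifferentiableAt ℝ (fun y => ψ y * w y) x :=
      (hψw.contDiffOn.differentiableOn two_ne_zero).differentiableAt (hΩ.mem_nhds hx)
    have h2 : (fun y => ψ y * cutoff g ε y * w y) = fun y => cutoff g ε y * (ψ y * w y) := by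
      funext y; ring
    have h3 := fderiv_cutoff (ε := ε) hgs x (G x)
    simp only [h2]
    rw [fderiv_fun_mul (hχ.differentiable (by simp) x) hd1]
    simp only [_root_.add_apply, _root_.smul_apply, smul_eq_mul, h3, hA, hL]
    ring
  -- The depth `2 * ε` appears because the layer vanishes where `g < -(2 * ε)`.
  have hLb : ∀ ε, 0 < ε → ∀ C, 0 ≤ C → (∀ x ∈ tsupport ψ, x ∈ Ω → -(2 * ε) ≤ g x →
      |fderiv ℝ g x (G x)| ≤ C) → ∀ x ∈ Ω, ‖L ε x‖ ≤ B * C * (θ x * layer g ε x) := by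
    intro ε hε C hCn hC x hx
    have hln := layer_nonneg (g := g) hε x
    have hBn : 0 ≤ B := (abs_nonneg _).trans (hB x hx)
    by_cases hxψ : x ∈ tsupport ψ
    · by_cases hgx : g x < -(2 * ε)
      · simp [hL, layer_eq_zero hε hgx]
      · have h1 := hC x hxψ hx (not_lt.mp hgx)
        rw [hθ1 x hxψ, one_mul, Real.norm_eq_abs, hL, abs_mul, abs_mul (layer g ε x),
          abs_of_nonneg hln]
        have h2 := mul_le_mul (hB x hx) h1 (abs_nonneg _) hBn
        calc |ψ x * w x| * (layer g ε x * |fderiv ℝ g x (G x)|)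
            = |ψ x * w x| * |fderiv ℝ g x (G x)| * layer g ε x := by ring
          _ ≤ B * C * layer g ε x := by gcongr
    · have h0 : ψ x = 0 := image_eq_zero_of_notMem_tsupport hxψ
      have h1 : L ε x = 0 := by simp [hL, h0]
      rw [h1, norm_zero]
      have := θ.nonneg (x := x)
      have hBn : 0 ≤ B := (abs_nonneg _).trans (hB x hx)
      positivity
  have hLi : ∀ ε, 0 < ε → IntegrableOn (L ε) Ω := fun ε hε => by
    obtain ⟨D, hD⟩ := hψc.isCompact.exists_bound_of_continuousOn
      (hgs.continuous_fderiv (by simp)).continuousOn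
    obtain ⟨D', hD'⟩ := hG.bounded
    refine Integrable.mono' (((hint ε).const_mul (B * (|D| * |D'|))).integrableOn) ?_ ?_
    · refine ContinuousOn.aestronglyMeasurable ?_ hΩ.measurableSet
      exact hψw.contDiffOn.continuousOn.mul ((continuous_layer hgs).continuousOn.mul
        ((hgs.continuous_fderiv (by simp)).continuousOn.clm_apply hG.continuousOn))
    · refine (ae_restrict_iff' hΩ.measurableSet).mpr (Eventually.of_forall ?_)
      refine hLb ε hε _ (by positivity) fun x hx hxΩ _ => ?_
      refine ((fderiv ℝ g x).le_opNorm (G x)).trans ?_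
      exact mul_le_mul ((hD x hx).trans (le_abs_self D)) ((hD' x hxΩ).trans (le_abs_self D'))
        (norm_nonneg _) (abs_nonneg _)
  have hχAi : ∀ ε, IntegrableOn (fun x => cutoff g ε x * A x) Ω := fun ε => by
    refine Integrable.mono hAi (((contDiff_cutoff (k := 0) hgs).continuous.continuousOn.mul
      hAc).aestronglyMeasurable hΩ.measurableSet) (Eventually.of_forall fun x => ?_)
    rw [norm_mul, Real.norm_eq_abs, abs_of_nonneg (cutoff_nonneg _)]
    exact mul_le_of_le_one_left (norm_nonneg _) (cutoff_le_one _)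
  have hlim : Tendsto (fun n : ℕ => ∫ x in Ω, cutoff g (1 / ((n : ℝ) + 1)) x * A x) atTop
      (𝓝 (∫ x in Ω, A x)) := by
    refine tendsto_integral_of_dominated_convergence (fun x => ‖A x‖)
      (fun n => (hχAi _).aestronglyMeasurable) hAi.norm (fun n => Eventually.of_forall fun x => ?_)
      ?_
    · rw [norm_mul, Real.norm_eq_abs, abs_of_nonneg (cutoff_nonneg _)]
      exact mul_le_of_le_one_left (norm_nonneg _) (cutoff_le_one _)
    · refine (ae_restrict_iff' hΩ.measurableSet).mpr (Eventually.of_forall fun x hx => ?_)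
      by_cases hxψ : x ∈ tsupport ψ
      · have hgx : g x < 0 := (hball x (hψR hxψ)).1.mp hx
        refine tendsto_const_nhds.congr' ?_
        have h1 : ∀ᶠ n : ℕ in atTop, 1 / ((n : ℝ) + 1) < -g x / 2 :=
          (tendsto_one_div_add_atTop_nhds_zero_nat (𝕜 := ℝ)).eventually
            (Iio_mem_nhds (by linarith))
        filter_upwards [h1] with n hn
        rw [cutoff, step_of_ge, one_mul]
        have hpos : 0 < 1 / ((n : ℝ) + 1) := by positivity
        rw [le_div_iff₀ hpos]
        linarith
      · have h0 : A x = 0 := by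
          have h1 : (fun y => ψ y * w y) =ᶠ[𝓝 x] fun _ => 0 := by
            filter_upwards [notMem_tsupport_iff_eventuallyEq.mp hxψ] with y hy
            simp [hy]
          simp [hA, h1.fderiv_eq]
        simp [h0]
  have hbound : ∀ δ, 0 < δ → |∫ x in Ω, A x| ≤ B * δ * (M / c) := by
    intro δ hδ
    obtain ⟨ε₀, hε₀, hδb⟩ := hG.exists_layer_bound hΩ (K := tsupport ψ) hψc.isCompact
      (g := g) (fun x hx _ => ⟨hgs, fun h0 => by
        have h1 := (hball x (hψR hx)).2.2
        rw [← inner_gradient, h0, inner_zero_left] at h1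
        linarith, (hball x (hψR hx)).2.1⟩) hgs.continuous
      (fun x hx hxΩ => (hball x (hψR hx)).1.mp hxΩ) hδ
    refine le_of_tendsto hlim.abs ?_
    have h1 : ∀ᶠ n : ℕ in atTop, 1 / ((n : ℝ) + 1) < ε₀ / 2 :=
      (tendsto_one_div_add_atTop_nhds_zero_nat (𝕜 := ℝ)).eventually (Iio_mem_nhds (by linarith))
    filter_upwards [h1] with n hn
    have hpos : 0 < 1 / ((n : ℝ) + 1) := by positivity
    set ε := 1 / ((n : ℝ) + 1)
    have h2 := hχA ε hpos
    rw [integral_sub (hχAi ε) (hLi ε hpos), sub_eq_zero] at h2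
    rw [h2]
    rcases Ω.eq_empty_or_nonempty with hΩe | ⟨x₁, hx₁⟩
    · exact absurd hx₀ (by simp [hΩe])
    have hBn : 0 ≤ B := (abs_nonneg _).trans (hB x₁ hx₁)
    calc |∫ x in Ω, L ε x| ≤ ∫ x in Ω, B * δ * (θ x * layer g ε x) := by
          rw [← Real.norm_eq_abs]
          refine norm_integral_le_of_norm_le ((hint ε).const_mul _).integrableOn ?_
          refine (ae_restrict_iff' hΩ.measurableSet).mpr (Eventually.of_forall ?_)
          exact hLb ε hpos δ hδ.le fun x hx hxΩ hgx => hδb x hx hxΩ (by linarith)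
      _ ≤ ∫ x, B * δ * (θ x * layer g ε x) := by
          refine setIntegral_le_integral ((hint ε).const_mul _) (Eventually.of_forall fun x => ?_)
          have := θ.nonneg (x := x)
          have := layer_nonneg (g := g) hpos x
          simp only [Pi.zero_apply]
          positivity
      _ ≤ B * δ * (M / c) := by
          rw [integral_const_mul]
          exact mul_le_mul_of_nonneg_left (hlayer ε hpos) (by positivity)
  have hle : |∫ x in Ω, A x| ≤ 0 := by
    refine le_of_forall_gt_imp_ge_of_dense fun a ha => ?_
    -- The choice of `δ` makes the bound at most `a`; adding `1` avoids a division by zero.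
    have h1 := hbound (a / (|B * (M / c)| + 1)) (by positivity)
    have h2 := le_abs_self (B * (M / c))
    have h3 : a / (|B * (M / c)| + 1) * (|B * (M / c)| + 1) = a := by field_simp
    have h4 : 0 < a / (|B * (M / c)| + 1) := by positivity
    nlinarith
  exact abs_nonpos_iff.mp hle

open scoped Manifold in
/-- The divergence theorem for a tangent field without divergence. -/
theorem setIntegral_fderiv_apply_eq_zero (hΩ : IsOpen Ω) (hΩb : Bornology.IsBounded Ω)
    (hsm : HasSmoothBoundary Ω) (hG : IsTangentField Ω G) (hdiv : IsWeaklyDivFree Ω G)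
    (hw : IsBoundedC2 Ω w) : ∫ x in Ω, fderiv ℝ w x (G x) = 0 := by
  have hvol : volume Ω < ⊤ := hΩb.measure_lt_top
  have hloc : ∀ x ∈ closure Ω, ∃ r > 0, ∀ ψ : E d → ℝ, ContDiff ℝ ∞ ψ →
      tsupport ψ ⊆ Metric.ball x r → ∫ x in Ω, fderiv ℝ (fun y => ψ y * w y) x (G x) = 0 := by
    intro x hx
    by_cases hxΩ : x ∈ Ω
    · obtain ⟨r, hr, hball⟩ := Metric.isOpen_iff.mp hΩ x hxΩ
      refine ⟨r, hr, fun ψ hψ hs => ?_⟩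
      refine setIntegral_fderiv_mul_eq_zero_of_tsupport hΩ hdiv hw.contDiffOn hψ ?_
        (hs.trans hball)
      exact (isCompact_closedBall x r).of_isClosed_subset (isClosed_tsupport ψ)
        (hs.trans Metric.ball_subset_closedBall)
    · have hfr : x ∈ frontier Ω := by rw [hΩ.frontier_eq]; exact ⟨hx, hxΩ⟩
      obtain ⟨g, hg⟩ := hsm x hfr
      exact exists_ball_setIntegral_fderiv_mul_eq_zero hΩ hvol hG hdiv hw hx hg
  choose! r hr hψ using hloc
  -- Finitely many of the local balls cover the closure, and a smooth partition of unity splits `w`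
  -- into pieces to which the local statement applies.
  obtain ⟨T, hTs, hT⟩ := hΩb.isCompact_closure.elim_nhds_subcover (fun x => Metric.ball x (r x))
    fun x hx => Metric.ball_mem_nhds x (hr x hx)
  obtain ⟨f, hf⟩ := SmoothPartitionOfUnity.exists_isSubordinate 𝓘(ℝ, E d) isClosed_closure
    (fun i : T => Metric.ball (i : E d) (r i)) (fun i => Metric.isOpen_ball)
    (hT.trans fun y hy => by simpa using hy)
  have hfs : ∀ i, ContDiff ℝ ∞ (f i) := fun i => (f i).contMDiff.contDiff
  have hfc : ∀ i, HasCompactSupport (f i) := fun i =>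
    (isCompact_closedBall (i : E d) (r i)).of_isClosed_subset (isClosed_tsupport _)
      ((hf i).trans Metric.ball_subset_closedBall)
  have hsum : ∀ y ∈ Ω, ∑ i, f i y = 1 := fun y hy => by
    rw [← finsum_eq_sum_of_fintype]; exact f.sum_eq_one (subset_closure hy)
  have hdec : ∀ x ∈ Ω, fderiv ℝ w x (G x) = ∑ i, fderiv ℝ (fun y => f i y * w y) x (G x) := by
    intro x hx
    have h1 : w =ᶠ[𝓝 x] fun y => ∑ i, f i y * w y := by
      filter_upwards [hΩ.mem_nhds hx] with y hy
      rw [← Finset.sum_mul, hsum y hy, one_mul]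
    rw [h1.fderiv_eq, fderiv_fun_sum, _root_.sum_apply]
    exact fun i _ => ((hw.mul_smooth hΩ (hfs i) (hfc i)).contDiffOn.differentiableOn
      two_ne_zero).differentiableAt (hΩ.mem_nhds hx)
  rw [setIntegral_congr_fun hΩ.measurableSet hdec, integral_finsetSum]
  · exact Finset.sum_eq_zero fun i _ => hψ i (hTs i i.2) _ (hfs i) (hf i)
  · exact fun i _ => (hw.mul_smooth hΩ (hfs i) (hfc i)).integrableOn_apply hΩ hvol hG

/-- A weighted harmonic function without normal derivative at the boundary is locally constant. -/
theorem gradient_eq_zero_of_weaklyDivFree {ρ : E d → ℝ} (hΩ : IsOpen Ω)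
    (hΩb : Bornology.IsBounded Ω) (hsm : HasSmoothBoundary Ω) (hw : IsBoundedC2 Ω w)
    (hρ : ∀ x ∈ Ω, 0 < ρ x) (hG : IsTangentField Ω fun x => ρ x • gradient w x)
    (hdiv : IsWeaklyDivFree Ω fun x => ρ x • gradient w x) : ∀ x ∈ Ω, gradient w x = 0 := by
  have h0 := setIntegral_fderiv_apply_eq_zero hΩ hΩb hsm hG hdiv hw
  have hi := hw.integrableOn_apply hΩ hΩb.measure_lt_top hG
  have hc := hw.continuousOn_fderiv_apply hΩ hG.continuousOn
  have heq : ∀ x, fderiv ℝ w x (ρ x • gradient w x) = ρ x * ‖gradient w x‖ ^ 2 := fun x => by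
    rw [map_smul, ← inner_gradient, real_inner_self_eq_norm_sq, smul_eq_mul]
  simp only [heq] at h0 hi hc
  have hnn : 0 ≤ᵐ[volume.restrict Ω] fun x => ρ x * ‖gradient w x‖ ^ 2 :=
    (ae_restrict_iff' hΩ.measurableSet).mpr (Eventually.of_forall fun x hx =>
      mul_nonneg (hρ x hx).le (by positivity))
  have hae := (integral_eq_zero_iff_of_nonneg_ae hnn hi).mp h0
  -- A continuous function that vanishes almost everywhere on an open set vanishes there everywhere.
  have := Measure.eqOn_open_of_ae_eq hae hΩ hc continuousOn_const
  intro x hx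
  have h1 := this hx
  simpa [(hρ x hx).ne'] using h1

end energy

end Overdamped

namespace Overdamped

/-! ### Functions that are smooth in time -/

/-- `f` is smooth in time, and its time derivatives are `C²` on space-time. -/
structure SmoothInTime {X : Type*} [NormedAddCommGroup X] [NormedSpace ℝ X] (U : Set X)
    (f : X → ℝ → ℝ) : Prop where
  time : ∀ x ∈ U, ContDiffOn ℝ ∞ (f x) (Ici 0)
  spaceTime : ∀ k : ℕ, SpaceTimeC 2 U (timeDeriv k f)

namespace SmoothInTime

variable {X : Type*} [NormedAddCommGroup X] [NormedSpace ℝ X] {U : Set X} {f g : X → ℝ → ℝ}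

theorem timeDeriv_sub (hf : SmoothInTime U f) (hg : SmoothInTime U g) (k : ℕ) {x : X} (hx : x ∈ U)
    {t : ℝ} (ht : 0 ≤ t) :
    timeDeriv k (fun x t => f x t - g x t) x t = timeDeriv k f x t - timeDeriv k g x t :=
  iteratedDerivWithin_sub ht (uniqueDiffOn_Ici 0)
    ((hf.time x hx).of_le (by exact_mod_cast le_top) t ht)
    ((hg.time x hx).of_le (by exact_mod_cast le_top) t ht)

theorem sub (hf : SmoothInTime U f) (hg : SmoothInTime U g) :
    SmoothInTime U (fun x t => f x t - g x t) where
  time x hx := (hf.time x hx).sub (hg.time x hx)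
  spaceTime k := (ContDiffOn.sub (hf.spaceTime k) (hg.spaceTime k)).congr fun _ hp =>
    hf.timeDeriv_sub hg k hp.1 hp.2

theorem timeDeriv_const_mul (hf : SmoothInTime U f) (c : ℝ) (k : ℕ) {x : X} (hx : x ∈ U)
    {t : ℝ} (ht : 0 ≤ t) :
    timeDeriv k (fun x t => c * f x t) x t = c * timeDeriv k f x t :=
  iteratedDerivWithin_const_mul ht (uniqueDiffOn_Ici 0) c
    ((hf.time x hx).of_le (by exact_mod_cast le_top) t ht)

theorem const_mul (hf : SmoothInTime U f) (c : ℝ) : SmoothInTime U (fun x t => c * f x t) where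
  time x hx := contDiffOn_const.mul (hf.time x hx)
  spaceTime k := (contDiffOn_const.mul (hf.spaceTime k)).congr fun _ hp =>
    hf.timeDeriv_const_mul c k hp.1 hp.2

theorem contDiffOn_timeDeriv (hf : SmoothInTime U f) (k : ℕ) {t : ℝ} (ht : 0 ≤ t) :
    ContDiffOn ℝ 2 (fun x => timeDeriv k f x t) U :=
  (hf.spaceTime k).contDiffOn ht

theorem contDiffOn (hf : SmoothInTime U f) {t : ℝ} (ht : 0 ≤ t) :
    ContDiffOn ℝ 2 (fun x => f x t) U := by
  simpa only [timeDeriv_zero] using hf.contDiffOn_timeDeriv 0 ht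

theorem differentiableAt (hU : IsOpen U) (hf : SmoothInTime U f) {x : X} (hx : x ∈ U) {t : ℝ}
    (ht : 0 ≤ t) : DifferentiableAt ℝ (fun z => f z t) x :=
  ((hf.contDiffOn ht).differentiableOn two_ne_zero).differentiableAt (hU.mem_nhds hx)

theorem continuousOn_fderiv (hU : IsOpen U) (hf : SmoothInTime U f) (k : ℕ) :
    ContinuousOn (fun p : X × ℝ => fderiv ℝ (fun z => timeDeriv k f z p.2) p.1) (U ×ˢ Ici 0) :=
  SpaceTimeC.continuousOn_fderiv hU (ContDiffOn.of_le (hf.spaceTime k) (by norm_num))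

theorem uniformO_fderiv (hU : IsOpen U) (hf : SmoothInTime U f) {K : Set X} (hK : IsCompact K)
    (hKU : K ⊆ U) (k : ℕ) (T : ℝ) :
    UniformO K T 0 fun x t => fderiv ℝ (fun z => timeDeriv k f z t) x :=
  uniformO_of_continuousOn hK ((hf.continuousOn_fderiv hU k).mono (prod_mono_left hKU))

/-- The bound on the next derivative is a hypothesis so that `A` may touch the boundary of `U`,
where it does not follow from compactness. -/
theorem uniformO_fderiv_sub (hU : IsOpen U) (hf : SmoothInTime U f) {A : Set X} (hA : A ⊆ U)
    {k : ℕ} (h0 : ∀ l < k, ∀ x ∈ U, fderiv ℝ (fun z => timeDeriv l f z 0) x = 0) {T : ℝ}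
    (hb : UniformO A T 0 fun x t => fderiv ℝ (fun z => timeDeriv (k + 1) f z t) x) :
    UniformO A T (k + 1) fun x t => fderiv ℝ (fun z => f z t) x -
      (t ^ k / k.factorial : ℝ) • fderiv ℝ (fun z => timeDeriv k f z 0) x := by
  have := uniformO_sub_pow_smul (A := A) (T := T) (k := k)
    (g := fun l x t => fderiv ℝ (fun z => timeDeriv l f z t) x)
    (fun x hx l t ht => hasDerivWithinAt_fderiv_timeDeriv hU hf.time hf.spaceTime l (hA hx) ht)
    (fun x hx l hl => h0 l hl x (hA hx)) hb
  simpa only [timeDeriv_zero] using this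

theorem uniformO_fderiv_of_vanishing (hU : IsOpen U) (hf : SmoothInTime U f) {K : Set X}
    (hK : IsCompact K) (hKU : K ⊆ U) {k : ℕ}
    (h0 : ∀ l < k, ∀ x ∈ U, fderiv ℝ (fun z => timeDeriv l f z 0) x = 0) (T : ℝ) :
    UniformO K T k fun x t => fderiv ℝ (fun z => f z t) x := by
  have := uniformO_of_vanishing (A := K) (T := T) (k := k)
    (g := fun l x t => fderiv ℝ (fun z => timeDeriv l f z t) x)
    (fun x hx l t ht => hasDerivWithinAt_fderiv_timeDeriv hU hf.time hf.spaceTime l (hKU hx) ht)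
    (fun x hx l hl => h0 l hl x (hKU hx)) (hf.uniformO_fderiv hU hK hKU k T)
  simpa only [timeDeriv_zero] using this

theorem fderiv_timeDeriv_eq_zero (hU : IsOpen U) {l : ℕ} {t : ℝ}
    (h0 : ∀ x ∈ U, timeDeriv l f x t = 0) {x : X} (hx : x ∈ U) :
    fderiv ℝ (fun z => timeDeriv l f z t) x = 0 := by
  have h1 : (fun z => timeDeriv l f z t) =ᶠ[𝓝 x] fun _ => 0 := by
    filter_upwards [hU.mem_nhds hx] with z hz using h0 z hz
  rw [h1.fderiv_eq]; simp

/-- The shift `m` serves to expand both the function (`m = 0`) and its first time derivative (`m =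
1`), which is what the evolution equation controls. -/
theorem uniformO_timeDeriv_sub (hf : SmoothInTime U f) {k m : ℕ}
    (h0 : ∀ l < k, ∀ x ∈ U, timeDeriv (m + l) f x 0 = 0) {T : ℝ}
    (hb : SpaceTimeBounded U (timeDeriv (m + k + 1) f)) :
    UniformO U T (k + 1) fun x t => timeDeriv m f x t -
      (t ^ k / k.factorial : ℝ) * timeDeriv (m + k) f x 0 := by
  obtain ⟨C, hC⟩ := hb
  exact uniformO_sub_pow_smul (A := U) (T := T) (k := k) (g := fun l => timeDeriv (m + l) f)
    (fun x hx l t ht => hasDerivWithinAt_timeDeriv (hf.time x hx) (m + l) ht)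
    (fun x hx l hl => h0 l hl x hx) (UniformO.of_bound fun x hx t ht => hC x hx t ht.1)

theorem uniformO_of_vanishing (hf : SmoothInTime U f) {k : ℕ}
    (h0 : ∀ l < k, ∀ x ∈ U, timeDeriv l f x 0 = 0) {T : ℝ}
    (hb : SpaceTimeBounded U (timeDeriv k f)) : UniformO U T k f := by
  obtain ⟨C, hC⟩ := hb
  have := Overdamped.uniformO_of_vanishing (A := U) (T := T) (k := k) (g := fun l => timeDeriv l f)
    (fun x hx l t ht => hasDerivWithinAt_timeDeriv (hf.time x hx) l ht)
    (fun x hx l hl => h0 l hl x hx) (UniformO.of_bound fun x hx t ht => hC x hx t ht.1)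
  simpa only [timeDeriv_zero] using this

end SmoothInTime

/-- Extraction of the leading term in an integral identity. -/
theorem setIntegral_eq_zero_of_uniformO {X : Type*} [MeasurableSpace X] {μ : Measure X} {A : Set X}
    (hμ : μ A < ⊤) {m : ℕ} {b : X → ℝ} {z : ℝ → X → ℝ}
    (hb : IntegrableOn b A μ) (hz : ∀ t, 0 ≤ t → IntegrableOn (z t) A μ ∧ ∫ x in A, z t x ∂μ = 0)
    (h : UniformO A 1 (m + 1) fun x t => (t ^ m / m.factorial : ℝ) * b x + z t x) :
    ∫ x in A, b x ∂μ = 0 := by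
  have h1 : UniformO (univ : Set Unit) 1 (m + 1) fun _ t =>
      ∫ x in A, ((t ^ m / m.factorial : ℝ) * b x + z t x) ∂μ :=
    UniformO.setIntegral (f := fun _ x t => (t ^ m / m.factorial : ℝ) * b x + z t x)
      (h.comp (A' := univ ×ˢ A) Prod.snd fun p hp => hp.2) hμ
  obtain ⟨C, hC, h1⟩ := h1
  refine eq_zero_of_mul_pow_le (k := m) (C := C * m.factorial) (T := 1) one_pos fun t ht => ?_
  have h2 := h1 () (mem_univ _) t ⟨ht.1.le, ht.2⟩
  beta_reduce at h2
  rw [integral_add (hb.const_mul _) (hz t ht.1.le).1, (hz t ht.1.le).2, add_zero,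
    integral_const_mul, norm_mul, norm_div, norm_pow, Real.norm_of_nonneg ht.1.le,
    Real.norm_natCast, Real.norm_eq_abs] at h2
  have hm : (0 : ℝ) < m.factorial := by positivity
  have h3 : t ^ m / (m.factorial : ℝ) * |∫ x in A, b x ∂μ| * m.factorial =
      |∫ x in A, b x ∂μ| * t ^ m := by field_simp
  rw [← h3, mul_right_comm C]
  exact mul_le_mul_of_nonneg_right h2 hm.le

/-! ### Configuration space and integration by parts in one particle. -/

namespace Setting

variable {d N n : ℕ} (S : Setting d) {V V' : E d → ℝ → ℝ} {P P' : Conf d N → ℝ → ℝ}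

theorem isOpen_dom (n : ℕ) : IsOpen (S.dom n) :=
  isOpen_set_pi finite_univ fun _ _ => S.isOpen_Ω

theorem measurableSet_dom (n : ℕ) : MeasurableSet (S.dom n) := (S.isOpen_dom n).measurableSet

theorem volume_dom_lt_top (n : ℕ) : volume (S.dom n) < ⊤ :=
  (Bornology.IsBounded.pi fun _ => S.isBounded_Ω).measure_lt_top

theorem volume_Ω_lt_top : volume S.Ω < ⊤ := S.isBounded_Ω.measure_lt_top

theorem mem_dom {x : Conf d n} : x ∈ S.dom n ↔ ∀ i, x i ∈ S.Ω := by simp [dom]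

theorem update_mem_dom {x : Conf d n} (hx : x ∈ S.dom n) (i : Fin n) {y : E d} (hy : y ∈ S.Ω) :
    Function.update x i y ∈ S.dom n := by
  rw [mem_dom] at hx ⊢
  intro j
  by_cases hj : j = i
  · subst hj; simpa
  · simpa [hj] using hx j

theorem integrableOn_dom {f : Conf d n → ℝ} {C : ℝ} (hf : ContinuousOn f (S.dom n))
    (hC : ∀ x ∈ S.dom n, ‖f x‖ ≤ C) : IntegrableOn f (S.dom n) :=
  integrableOn_of_continuousOn_of_bounded (S.measurableSet_dom n) (S.volume_dom_lt_top n) hf hC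

/-- No particle is left to integrate over: the remaining configuration space is a single point of
mass one. -/
theorem density_self (x : Conf d N) (t : ℝ) : S.density P N x t = N.factorial * P x t := by
  have : IsEmpty (Fin (N - N)) := by rw [Nat.sub_self]; infer_instance
  have hdom : S.dom (N - N) = univ := by
    ext y; simp [mem_dom]
  have hj : ∀ y : Conf d (N - N), join x y = x := fun y => by
    funext i; simp [join]
  have hv : (volume : Measure (Conf d (N - N))) = Measure.dirac isEmptyElim := by
    rw [volume_pi, Measure.pi_of_empty]
  simp only [density, hdom, hj, Nat.descFactorial_self]
  rw [hv]
  simp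

/-- Integration by parts in the position of one particle. -/
theorem setIntegral_mul_divAt_add_inner_eq_zero {f : Conf d (n + 1) → ℝ} {G : Conf d (n + 1) → E d}
    (hf : ContDiffOn ℝ 1 f (S.dom (n + 1))) (hG : ContDiffOn ℝ 1 G (S.dom (n + 1)))
    (i : Fin (n + 1)) {K : Set (E d)} (hK : IsCompact K) (hKΩ : K ⊆ S.Ω)
    (h0 : ∀ x, x i ∉ K → f x • G x = 0)
    (hi : IntegrableOn (fun x => f x * divAt i G x + inner ℝ (gradAt i f x) (G x))
      (S.dom (n + 1))) :
    ∫ x in S.dom (n + 1), (f x * divAt i G x + inner ℝ (gradAt i f x) (G x)) = 0 := by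
  refine setIntegral_pi_eq_zero_of_update S.isOpen_Ω.measurableSet hi i fun x hx => ?_
  have hu : ContDiff ℝ 1 (Function.update x i) := contDiff_update 1 x i
  have hm : MapsTo (Function.update x i) S.Ω (S.dom (n + 1)) := fun y hy =>
    S.update_mem_dom hx i hy
  have h1 : ∀ y ∉ K, f (Function.update x i y) • G (Function.update x i y) = 0 := fun y hy =>
    h0 _ (by simpa using hy)
  have h2 := setIntegral_mul_diverg_add_inner_eq_zero S.isOpen_Ω
    (φ := fun y => f (Function.update x i y)) (G := fun y => G (Function.update x i y))
    (hf.comp hu.contDiffOn hm) (hG.comp hu.contDiffOn hm) (HasCompactSupport.intro hK h1)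
    ((closure_minimal (fun y hy => by
      by_contra hcon; exact hy (h1 y hcon)) hK.isClosed).trans hKΩ)
  simpa [divAt, gradAt] using h2

end Setting

end Overdamped

/-! ### Regularity and bounds for a single system. -/

namespace Overdamped

namespace Setting

variable {d N n : ℕ} (S : Setting d) {V : E d → ℝ → ℝ} {P : Conf d N → ℝ → ℝ}

/-- A well-behaved, analytically accessible solution in an external potential. -/
structure IsSystem (V : E d → ℝ → ℝ) (P : Conf d N → ℝ → ℝ) : Prop where
  potential : S.IsPotential V
  solution : S.IsSolution V P
  accessible : S.IsAnalyticallyAccessible V P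

theorem contDiffOn_K₂ : ContDiffOn ℝ 1 (fun p : E d × E d => S.K₂ p.1 p.2) (S.Ω ×ˢ S.Ω) :=
  S.K₂_contDiff

theorem contDiffOn_K₂_apply (i j : Fin N) :
    ContDiffOn ℝ 1 (fun x : Conf d N => S.K₂ (x i) (x j)) (S.dom N) := by
  have hm : MapsTo (fun x : Conf d N => (x i, x j)) (S.dom N) (S.Ω ×ˢ S.Ω) := fun x hx =>
    ⟨S.mem_dom.mp hx i, S.mem_dom.mp hx j⟩
  have hp : ContDiff ℝ 1 (fun x : Conf d N => (x i, x j)) := by fun_prop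
  have := ContDiffOn.comp (g := fun p : E d × E d => S.K₂ p.1 p.2)
    (f := fun x : Conf d N => (x i, x j)) S.contDiffOn_K₂ hp.contDiffOn hm
  exact this

namespace IsSystem

variable {S}

theorem smoothInTime_potential (h : S.IsSystem V P) : SmoothInTime S.Ω V where
  time x hx := (h.accessible.V_analytic x hx).contDiffOn (uniqueDiffOn_Ici 0)
  spaceTime := h.accessible.V_contDiff

theorem smoothInTime_density (h : S.IsSystem V P) (hn : 1 ≤ n) (hnN : n ≤ N) :
    SmoothInTime (S.dom n) (S.density P n) where
  time := h.accessible.density_time n hn hnN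
  spaceTime := h.accessible.density_contDiff n hn hnN

/-- Transfers the assumptions on the `N`-body density, in particular smoothness in time and
boundedness, to `P`. -/
theorem eq_const_mul_density (S : Setting d) (P : Conf d N → ℝ → ℝ) :
    P = fun x t => (N.factorial : ℝ)⁻¹ * S.density P N x t := by
  funext x t
  have : (N.factorial : ℝ) ≠ 0 := by positivity
  rw [S.density_self, inv_mul_cancel_left₀ this]

theorem smoothInTime (h : S.IsSystem V P) (hN : 1 ≤ N) : SmoothInTime (S.dom N) P := by
  rw [eq_const_mul_density S P]
  exact (h.smoothInTime_density hN le_rfl).const_mul _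

theorem bounded_timeDeriv (h : S.IsSystem V P) (hN : 1 ≤ N) (k : ℕ) :
    SpaceTimeBounded (S.dom N) (timeDeriv k P) := by
  obtain ⟨C, hC⟩ := h.accessible.density_bounded N hN le_rfl k
  refine ⟨|(N.factorial : ℝ)⁻¹| * C, fun x hx t ht => ?_⟩
  rw [eq_const_mul_density S P,
    (h.smoothInTime_density hN le_rfl).timeDeriv_const_mul _ _ hx ht, norm_mul]
  gcongr
  · exact le_rfl
  · exact hC x hx t ht

theorem bounded (h : S.IsSystem V P) (hN : 1 ≤ N) : SpaceTimeBounded (S.dom N) P := by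
  simpa only [timeDeriv_zero] using h.bounded_timeDeriv hN 0

/-! #### Forces -/

theorem continuousOn_K₁ (h : S.IsSystem V P) :
    ContinuousOn (fun p : E d × ℝ => S.K₁ V p.1 p.2) (S.Ω ×ˢ Ici 0) := by
  have h1 := h.smoothInTime_potential.continuousOn_fderiv S.isOpen_Ω 0
  simp only [timeDeriv_zero] at h1
  have h2 : ContinuousOn (fun p : E d × ℝ => S.R p.1 p.2) (S.Ω ×ˢ Ici 0) := by
    have := ContDiffOn.continuousOn (h.accessible.R_contDiff 0)
    simpa only [timeDeriv_zero] using this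
  refine (((gradL d).continuous.comp_continuousOn h1).neg.add h2).congr fun p _ => ?_
  simp [K₁, gradient_eq]

theorem contDiffOn_force (h : S.IsSystem V P) (s : Finset (Fin N)) (i : Fin N) {t : ℝ}
    (ht : 0 ≤ t) : ContDiffOn ℝ 1 (fun x => S.force V s i x t) (S.dom N) := by
  have hp : ∀ j : Fin N, ContDiff ℝ 1 (fun x : Conf d N => x j) := fun j => contDiff_apply ℝ (E d) j
  have hm : ∀ j : Fin N, MapsTo (fun x : Conf d N => x j) (S.dom N) S.Ω := fun j x hx =>
    S.mem_dom.mp hx j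
  have h1 : ContDiffOn ℝ 1 (fun x => gradient (fun z => V z t) x) S.Ω := by
    have := contDiffOn_gradient (k := 1) S.isOpen_Ω (f := fun z => V z t)
      (by simpa [one_add_one_eq_two] using h.potential.contDiff t ht)
    simpa using this
  have h2 : ContDiffOn ℝ 1 (fun x => S.K₁ V x t) S.Ω := h1.neg.add (S.R_space t ht)
  have h3 : ContDiffOn ℝ 1 (fun x : Conf d N => S.K₁ V (x i) t) (S.dom N) :=
    ContDiffOn.comp (g := fun x => S.K₁ V x t) h2 (hp i).contDiffOn (hm i)
  exact h3.add (ContDiffOn.sum fun j _ => S.contDiffOn_K₂_apply i j)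

/-- The one-body force is controlled on compact subsets of `Ω`, the two-body force everywhere. So
only the position of particle `i` has to be confined. -/
theorem uniformO_force (h : S.IsSystem V P) (s : Finset (Fin N)) (i : Fin N) {K : Set (E d)}
    (hK : IsCompact K) (hKΩ : K ⊆ S.Ω) (T : ℝ) :
    UniformO {x ∈ S.dom N | x i ∈ K} T 0 (S.force V s i) := by
  have h1 : UniformO K T 0 (S.K₁ V) :=
    uniformO_of_continuousOn hK (h.continuousOn_K₁.mono (prod_mono_left hKΩ))
  obtain ⟨C, hC⟩ := S.K₂_bounded
  refine (h1.comp (fun x : Conf d N => x i) fun x hx => hx.2).add (UniformO.sum _ fun j _ => ?_)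
  exact UniformO.of_bound (C := C) fun x hx t _ =>
    hC _ (S.mem_dom.mp hx.1 i) _ (S.mem_dom.mp hx.1 j)

/-! #### Currents -/

theorem contDiffOn_current (h : S.IsSystem V P) (i : Fin N) {t : ℝ} (ht : 0 ≤ t) :
    ContDiffOn ℝ 1 (fun x => S.current V P i x t) (S.dom N) := by
  have hP : ContDiffOn ℝ 2 (fun x => P x t) (S.dom N) :=
    SpaceTimeC.contDiffOn h.solution.contDiff ht
  have h1 : ContDiffOn ℝ 1 (gradAt i fun w => P w t) (S.dom N) := by
    have := contDiffOn_gradAt (k := 1) (S.isOpen_dom N) (f := fun w => P w t)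
      (by simpa [one_add_one_eq_two] using hP) i
    simpa using this
  have h2 : ContDiffOn ℝ 1 (fun x => S.D • gradAt i (fun w => P w t) x) (S.dom N) :=
    h1.const_smul S.D
  have h3 : ContDiffOn ℝ 1 (fun x => S.D * S.β * P x t) (S.dom N) :=
    contDiffOn_const.mul (hP.of_le (by norm_num))
  have h4 : ContDiffOn ℝ 1 (fun x => (S.D * S.β * P x t) • S.force V Finset.univ i x t)
      (S.dom N) := h3.smul (h.contDiffOn_force _ i ht)
  exact h2.neg.add h4

theorem divAt_current (S : Setting d) (V : E d → ℝ → ℝ) (P : Conf d N → ℝ → ℝ) (i : Fin N)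
    (x : Conf d N) (t : ℝ) :
    divAt i (fun z => S.current V P i z t) x = -(S.D * divAt i
      (fun z => gradAt i (fun w => P w t) z - (S.β * P z t) • S.force V Finset.univ i z t) x) := by
  rw [← neg_mul, ← divAt_const_smul]
  congr 1
  funext z
  simp only [current]
  module

theorem timeDeriv_one_eq (h : S.IsSystem V P) {x : Conf d N} (hx : x ∈ S.dom N) {t : ℝ}
    (ht : 0 ≤ t) :
    timeDeriv 1 P x t = -∑ i, divAt i (fun z => S.current V P i z t) x := by
  rw [h.solution.smoluchowski x hx t ht, smolOp, Finset.mul_sum, ← Finset.sum_neg_distrib]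
  exact Finset.sum_congr rfl fun i _ => by rw [divAt_current, neg_neg]

/-- The assumed bounds concern sums over the first `m` particles; the contribution of one particle
is a difference of two consecutive sums. -/
theorem bounded_divAt_current (h : S.IsSystem V P) (i : Fin N) :
    SpaceTimeBounded (S.dom N) (fun x t => divAt i (fun z => S.current V P i z t) x) := by
  -- The assumption starts at `m = 1`; the empty sum is needed for the first particle.
  have hb : ∀ m ≤ N, SpaceTimeBounded (S.dom N) (S.smolOp V (first N m) Finset.univ P) := by
    intro m hm
    rcases Nat.eq_zero_or_pos m with rfl | hm0
    · exact ⟨0, fun x _ t _ => by simp [smolOp, first]⟩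
    · exact h.solution.bdd_op_minus m hm0 hm
  obtain ⟨C, hC⟩ := hb (i + 1) i.2
  obtain ⟨C', hC'⟩ := hb i i.2.le
  refine ⟨C + C', fun x hx t ht => ?_⟩
  have h1 : first N (i + 1) = insert i (first N i) := by
    ext j
    simp only [first, Finset.mem_filter, Finset.mem_univ, true_and, Finset.mem_insert, Fin.ext_iff]
    omega
  have h2 : i ∉ first N i := by simp [first]
  have h3 : divAt i (fun z => S.current V P i z t) x =
      S.smolOp V (first N i) Finset.univ P x t - S.smolOp V (first N (i + 1)) Finset.univ P x t := by
    rw [divAt_current, h1, smolOp, smolOp, Finset.sum_insert h2]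
    ring
  beta_reduce
  rw [h3]
  exact (norm_sub_le _ _).trans (by linarith [hC x hx t ht, hC' x hx t ht])

theorem bounded_current (h : S.IsSystem V P) (hN : 1 ≤ N) (i : Fin N) {K : Set (E d)}
    (hK : IsCompact K) (hKΩ : K ⊆ S.Ω) {t : ℝ} (ht : 0 ≤ t) :
    ∃ C, ∀ x ∈ S.dom N, x i ∈ K → ‖S.current V P i x t‖ ≤ C := by
  obtain ⟨C₁, h₁⟩ := h.solution.bdd_grad i
  obtain ⟨C₂, h₂⟩ := h.bounded hN
  have hg : UniformO {x ∈ S.dom N | x i ∈ K} t 0 (S.current V P i) := by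
    refine UniformO.add (UniformO.neg (UniformO.const_smul _
      (UniformO.of_bound (C := C₁) fun x hx s hs => h₁ x hx.1 s hs.1))) ?_
    refine (((UniformO.of_bound (C := C₂) fun x hx s hs => h₂ x hx.1 s hs.1).const_smul
      (S.D * S.β)).smul (h.uniformO_force Finset.univ i hK hKΩ t) : UniformO _ t (0 + 0) _)
  obtain ⟨C, -, hC⟩ := hg
  exact ⟨C, fun x hx hxK => by simpa using hC x ⟨hx, hxK⟩ t ⟨ht, le_rfl⟩⟩

/-- The total flux of the other particles vanishes when the first position is tested. -/
theorem setIntegral_mul_divAt_current_eq_zero {P : Conf d (n + 1) → ℝ → ℝ} (h : S.IsSystem V P)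
    {φ : E d → ℝ} (hφ : Continuous φ) (hφc : HasCompactSupport φ) {i : Fin (n + 1)} (hi : i ≠ 0)
    {t : ℝ} (ht : 0 ≤ t) :
    IntegrableOn (fun x => φ (x 0) * divAt i (fun z => S.current V P i z t) x) (S.dom (n + 1)) ∧
      ∫ x in S.dom (n + 1), φ (x 0) * divAt i (fun z => S.current V P i z t) x = 0 := by
  obtain ⟨B, hB⟩ := hφ.bounded_above_of_compact_support hφc
  obtain ⟨C, hC⟩ := h.bounded_divAt_current i
  have hint : IntegrableOn (fun x => φ (x 0) * divAt i (fun z => S.current V P i z t) x)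
      (S.dom (n + 1)) := by
    refine S.integrableOn_dom (C := B * C) ?_ fun x hx => ?_
    · exact (hφ.comp (continuous_apply 0)).continuousOn.mul
        (continuousOn_divAt (S.isOpen_dom _) (h.contDiffOn_current i ht) i)
    · rw [norm_mul]
      exact mul_le_mul (hB _) (hC x hx t ht) (norm_nonneg _) ((norm_nonneg _).trans (hB (x 0)))
  refine ⟨hint, setIntegral_pi_eq_zero_of_update S.isOpen_Ω.measurableSet hint i fun x hx => ?_⟩
  -- Moving particle `i` leaves `φ (x 0)` unchanged, so it comes out of the integral and the
  -- no-net-flux condition applies.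
  simp only [Function.update_of_ne hi.symm]
  rw [integral_const_mul, h.solution.no_net_flux i x hx t ht, mul_zero]

end IsSystem

end Setting

end Overdamped

/-! ### Two systems: agreement of the densities to order `k` at the initial time. -/

namespace Overdamped

namespace Setting

variable {d n : ℕ} (S : Setting d) {V V' : E d → ℝ → ℝ} {P P' : Conf d (n + 1) → ℝ → ℝ}

/-- Two systems with the same positive initial state, the same one-body density and no normal
flux. -/
structure IsPair (V V' : E d → ℝ → ℝ) (P P' : Conf d (n + 1) → ℝ → ℝ) : Prop where
  fst : S.IsSystem V P
  snd : S.IsSystem V' P'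
  init : ∀ x ∈ S.dom (n + 1), P x 0 = P' x 0
  pos : ∀ x ∈ S.dom (n + 1), 0 < P x 0
  flux : S.NoNormalFlux V P
  flux' : S.NoNormalFlux V' P'
  density : ∀ x ∈ S.Ω, ∀ t : ℝ, 0 ≤ t → S.density₁ P x t = S.density₁ P' x t

/-- The potentials differ at the initial time by functions of time only, up to the time derivative
of order `k - 1`. -/
def GradAgreeUpTo (V V' : E d → ℝ → ℝ) (k : ℕ) : Prop :=
  ∀ l < k, ∀ x ∈ S.Ω, fderiv ℝ (fun z => timeDeriv l (V - V') z 0) x = 0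

namespace IsPair

variable {S}

theorem smoothInTime (h : S.IsPair V V' P P') : SmoothInTime (S.dom (n + 1)) (P - P') :=
  (h.fst.smoothInTime (by omega)).sub (h.snd.smoothInTime (by omega))

theorem smoothInTime_potential (h : S.IsPair V V' P P') : SmoothInTime S.Ω (V - V') :=
  h.fst.smoothInTime_potential.sub h.snd.smoothInTime_potential

theorem bounded_timeDeriv (h : S.IsPair V V' P P') (k : ℕ) :
    SpaceTimeBounded (S.dom (n + 1)) (timeDeriv k (P - P')) := by
  obtain ⟨C, hC⟩ := h.fst.bounded_timeDeriv (by omega) k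
  obtain ⟨C', hC'⟩ := h.snd.bounded_timeDeriv (by omega) k
  refine ⟨C + C', fun x hx t ht => ?_⟩
  have h1 : timeDeriv k (P - P') x t = timeDeriv k P x t - timeDeriv k P' x t :=
    (h.fst.smoothInTime (by omega)).timeDeriv_sub (h.snd.smoothInTime (by omega)) k hx ht
  rw [h1]
  exact (norm_sub_le _ _).trans (add_le_add (hC x hx t ht) (hC' x hx t ht))

theorem gradient_sub (h : S.IsPair V V' P P') {x : E d} (hx : x ∈ S.Ω) {t : ℝ} (ht : 0 ≤ t) :
    gradient (fun z => (V - V') z t) x =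
      gradient (fun z => V z t) x - gradient (fun z => V' z t) x := by
  rw [gradient_eq, gradient_eq, gradient_eq, ← map_sub]
  congr 1
  exact fderiv_fun_sub (h.fst.smoothInTime_potential.differentiableAt S.isOpen_Ω hx ht)
    (h.snd.smoothInTime_potential.differentiableAt S.isOpen_Ω hx ht)

theorem force_sub (h : S.IsPair V V' P P') {x : Conf d (n + 1)} (hx : x ∈ S.dom (n + 1)) {t : ℝ}
    (ht : 0 ≤ t) (s : Finset (Fin (n + 1))) (i : Fin (n + 1)) :
    S.force V' s i x t = S.force V s i x t + gradient (fun z => (V - V') z t) (x i) := by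
  rw [h.gradient_sub (S.mem_dom.mp hx i) ht]
  simp only [force, K₁]
  abel

theorem gradAt_sub (h : S.IsPair V V' P P') {x : Conf d (n + 1)} (hx : x ∈ S.dom (n + 1)) {t : ℝ}
    (ht : 0 ≤ t) (i : Fin (n + 1)) :
    gradAt i (fun w => (P - P') w t) x =
      gradAt i (fun w => P w t) x - gradAt i (fun w => P' w t) x := by
  have h1 := (h.fst.smoothInTime (by omega)).differentiableAt (S.isOpen_dom _) hx ht
  have h2 := (h.snd.smoothInTime (by omega)).differentiableAt (S.isOpen_dom _) hx ht
  rw [gradAt_eq h1, gradAt_eq h2, gradAt_eq (h.smoothInTime.differentiableAt (S.isOpen_dom _) hx ht),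
    ← map_sub, ← ContinuousLinearMap.sub_comp]
  congr 2
  exact fderiv_fun_sub h1 h2

/-- The difference of the currents. -/
theorem current_sub (h : S.IsPair V V' P P') {x : Conf d (n + 1)} (hx : x ∈ S.dom (n + 1)) {t : ℝ}
    (ht : 0 ≤ t) (i : Fin (n + 1)) :
    S.current V P i x t - S.current V' P' i x t =
      (-S.D) • gradAt i (fun w => (P - P') w t) x
        + (S.D * S.β) • ((P - P') x t • S.force V Finset.univ i x t)
        + (-(S.D * S.β)) • (P' x t • gradient (fun z => (V - V') z t) (x i)) := by
  rw [h.gradAt_sub hx ht, current, current, h.force_sub hx ht]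
  simp only [Pi.sub_apply]
  module

theorem contDiffOn_current_sub (h : S.IsPair V V' P P') (i : Fin (n + 1)) {t : ℝ} (ht : 0 ≤ t) :
    ContDiffOn ℝ 1 (fun x => S.current V P i x t - S.current V' P' i x t) (S.dom (n + 1)) :=
  (h.fst.contDiffOn_current i ht).sub (h.snd.contDiffOn_current i ht)

theorem divAt_current_sub (h : S.IsPair V V' P P') {x : Conf d (n + 1)} (hx : x ∈ S.dom (n + 1))
    {t : ℝ} (ht : 0 ≤ t) (i : Fin (n + 1)) :
    divAt i (fun z => S.current V P i z t - S.current V' P' i z t) x =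
      divAt i (fun z => S.current V P i z t) x - divAt i (fun z => S.current V' P' i z t) x := by
  have hd : ∀ {f : Conf d (n + 1) → E d}, ContDiffOn ℝ 1 f (S.dom (n + 1)) →
      DifferentiableAt ℝ f x := fun hf =>
    (hf.differentiableOn one_ne_zero).differentiableAt ((S.isOpen_dom _).mem_nhds hx)
  exact divAt_sub i (hd (h.fst.contDiffOn_current i ht)) (hd (h.snd.contDiffOn_current i ht))

theorem timeDeriv_one_eq (h : S.IsPair V V' P P') {x : Conf d (n + 1)} (hx : x ∈ S.dom (n + 1))
    {t : ℝ} (ht : 0 ≤ t) :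
    timeDeriv 1 (P - P') x t =
      -∑ i, divAt i (fun z => S.current V P i z t - S.current V' P' i z t) x := by
  have h1 : timeDeriv 1 (P - P') x t = timeDeriv 1 P x t - timeDeriv 1 P' x t :=
    (h.fst.smoothInTime (by omega)).timeDeriv_sub (h.snd.smoothInTime (by omega)) 1 hx ht
  rw [h1, h.fst.timeDeriv_one_eq hx ht, h.snd.timeDeriv_one_eq hx ht,
    Finset.sum_congr rfl fun i _ => h.divAt_current_sub hx ht i, Finset.sum_sub_distrib]
  ring

theorem uniformO_gradient (h : S.IsPair V V' P P') {k : ℕ} (hk : S.GradAgreeUpTo V V' k)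
    {K : Set (E d)} (hK : IsCompact K) (hKΩ : K ⊆ S.Ω) (T : ℝ) :
    UniformO K T k fun x t => gradient (fun z => (V - V') z t) x :=
  ((h.smoothInTime_potential.uniformO_fderiv_of_vanishing S.isOpen_Ω hK hKΩ hk T).clm
    (gradL d)).congr fun _ _ _ _ => gradient_eq _ _

theorem uniformO_sub (h : S.IsPair V V' P P') {m : ℕ}
    (hm : ∀ l < m, ∀ x ∈ S.dom (n + 1), timeDeriv l (P - P') x 0 = 0) (T : ℝ) :
    UniformO (S.dom (n + 1)) T m (P - P') :=
  h.smoothInTime.uniformO_of_vanishing hm (h.bounded_timeDeriv m)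

theorem uniformO_snd (h : S.IsPair V V' P P') (T : ℝ) : UniformO (S.dom (n + 1)) T 0 P' := by
  obtain ⟨C, hC⟩ := h.snd.bounded (by omega)
  exact UniformO.of_bound fun x hx t ht => hC x hx t ht.1

/-- By `current_sub` the difference has two terms that are linear in `P - P'` and one linear in the
gradient of `V - V'`, and each is `O(t ^ m)`. Compactness controls the gradients and the force. -/
theorem uniformO_current_sub (h : S.IsPair V V' P P') {k m : ℕ} (hk : S.GradAgreeUpTo V V' k)
    (hmk : m ≤ k) (hm : ∀ l < m, ∀ x ∈ S.dom (n + 1), timeDeriv l (P - P') x 0 = 0)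
    {K : Set (Conf d (n + 1))} (hK : IsCompact K) (hKd : K ⊆ S.dom (n + 1)) (i : Fin (n + 1))
    (T : ℝ) :
    UniformO K T m fun x t => S.current V P i x t - S.current V' P' i x t := by
  have hKi : IsCompact ((fun x : Conf d (n + 1) => x i) '' K) := hK.image (continuous_apply i)
  have hKiΩ : (fun x : Conf d (n + 1) => x i) '' K ⊆ S.Ω := by
    rintro _ ⟨x, hx, rfl⟩; exact S.mem_dom.mp (hKd hx) i
  have h1 : UniformO K T m fun x t => gradAt i (fun w => (P - P') w t) x := by
    have := ((h.smoothInTime.uniformO_fderiv_of_vanishing (S.isOpen_dom _) hK hKd (k := m)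
      (fun l hl x hx => SmoothInTime.fderiv_timeDeriv_eq_zero (S.isOpen_dom _) (hm l hl) hx) T).clm
      ((ContinuousLinearMap.compL ℝ (E d) (Conf d (n + 1)) ℝ).flip (slot i))).clm (gradL d)
    refine this.congr fun x hx t ht => ?_
    rw [gradAt_eq (h.smoothInTime.differentiableAt (S.isOpen_dom _) (hKd hx) ht.1)]
    rfl
  have h2 : UniformO K T m fun x t => (P - P') x t • S.force V Finset.univ i x t :=
    ((h.uniformO_sub hm T).mono hKd).smul ((h.fst.uniformO_force Finset.univ i hKi hKiΩ T).mono
      fun x hx => ⟨hKd hx, x, hx, rfl⟩)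
  have h3 : UniformO K T m fun x t => P' x t • gradient (fun z => (V - V') z t) (x i) := by
    have := ((h.uniformO_snd T).mono hKd).smul
      (((h.uniformO_gradient hk hKi hKiΩ T).of_le hmk).comp (fun x : Conf d (n + 1) => x i)
        (mapsTo_image _ K))
    simpa only [zero_add] using this
  refine (((h1.const_smul (-S.D)).add (h2.const_smul (S.D * S.β))).add
    (h3.const_smul (-(S.D * S.β)))).congr fun x hx t ht => ?_
  exact h.current_sub (hKd hx) ht.1 i

/-- The coefficient of `t ^ m` in `∂ₜ(P - P')` is the derivative of order `m + 1` over `m!`. In the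
weak sense `∂ₜ(P - P')` is the divergence of a current difference of order `t ^ (m + 1)`, so this
coefficient vanishes. Testing with `ψ` means that only the currents, not their divergences, must be
estimated. -/
theorem timeDeriv_succ_eq_zero (h : S.IsPair V V' P P') {k m : ℕ} (hk : S.GradAgreeUpTo V V' k)
    (hmk : m + 1 ≤ k) (hm : ∀ l < m + 1, ∀ x ∈ S.dom (n + 1), timeDeriv l (P - P') x 0 = 0) :
    ∀ x ∈ S.dom (n + 1), timeDeriv (m + 1) (P - P') x 0 = 0 := by
  set U := S.dom (n + 1)
  have hU : IsOpen U := S.isOpen_dom _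
  have hac : ContinuousOn (fun x => timeDeriv (m + 1) (P - P') x 0) U :=
    (h.smoothInTime.contDiffOn_timeDeriv (m + 1) le_rfl).continuousOn
  suffices hae : ∀ᵐ x, x ∈ U → timeDeriv (m + 1) (P - P') x 0 = 0 by
    have := Measure.eqOn_open_of_ae_eq ((ae_restrict_iff' hU.measurableSet).mpr hae) hU hac
      continuousOn_const
    exact fun x hx => this hx
  refine hU.ae_eq_zero_of_integral_contDiff_smul_eq_zero
    (hac.locallyIntegrableOn hU.measurableSet) fun ψ hψ hψc hψs => ?_
  have hK : IsCompact (tsupport ψ) := hψc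
  have hψ0 : ∀ x ∉ tsupport ψ, ψ x = 0 := fun x hx => image_eq_zero_of_notMem_tsupport hx
  have hψ1 : ContDiff ℝ 1 ψ := hψ.of_le (by exact_mod_cast le_top)
  have hg0 : ∀ i, ∀ x ∉ tsupport ψ, gradAt i ψ x = 0 := fun i x hx => by
    rw [gradAt_eq (hψ1.differentiable one_ne_zero x)]
    have : fderiv ℝ ψ x = 0 := by
      by_contra hne
      exact hx (support_fderiv_subset ℝ hne)
    simp [this]
  have hgc : ∀ i, ContinuousOn (gradAt i ψ) U := fun i => by
    have := contDiffOn_gradAt (k := 0) hU (f := ψ) (by simpa using hψ1.contDiffOn) i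
    exact this.continuousOn
  have hci : ∀ f : Conf d (n + 1) → ℝ, ContinuousOn f U → (∀ x ∉ tsupport ψ, f x = 0) →
      IntegrableOn f U := fun f hf hf0 => by
    obtain ⟨C, hC⟩ := hK.exists_bound_of_continuousOn (hf.mono hψs)
    refine S.integrableOn_dom (C := max C 0) hf fun x _ => ?_
    by_cases hx : x ∈ tsupport ψ
    · exact (hC x hx).trans (le_max_left _ _)
    · rw [hf0 x hx, norm_zero]; exact le_max_right _ _
  rw [← setIntegral_eq_integral_of_forall_compl_eq_zero (s := U) fun x hx => by
    rw [hψ0 x fun hx' => hx (hψs hx'), zero_smul]]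
  simp only [smul_eq_mul]
  set δJ : Fin (n + 1) → ℝ → Conf d (n + 1) → E d := fun i t x =>
    S.current V P i x t - S.current V' P' i x t with hδJ
  have hJc : ∀ i t, 0 ≤ t → ContDiffOn ℝ 1 (δJ i t) U := fun i t ht =>
    h.contDiffOn_current_sub i ht
  have hzi : ∀ i t, 0 ≤ t → IntegrableOn
      (fun x => ψ x * divAt i (δJ i t) x + inner ℝ (gradAt i ψ x) (δJ i t x)) U := by
    intro i t ht
    refine hci _ ?_ fun x hx => by rw [hψ0 x hx, hg0 i x hx, zero_mul, inner_zero_left, add_zero]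
    exact (hψ1.continuous.continuousOn.mul (continuousOn_divAt hU (hJc i t ht) i)).add
      ((hgc i).inner (hJc i t ht).continuousOn)
  have hz0 : ∀ i t, 0 ≤ t → ∫ x in U,
      (ψ x * divAt i (δJ i t) x + inner ℝ (gradAt i ψ x) (δJ i t x)) = 0 := by
    intro i t ht
    refine S.setIntegral_mul_divAt_add_inner_eq_zero hψ1.contDiffOn (hJc i t ht) i
      (hK.image (continuous_apply i)) ?_ (fun x hx => ?_) (hzi i t ht)
    · rintro _ ⟨x, hx, rfl⟩; exact S.mem_dom.mp (hψs hx) i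
    · rw [hψ0 x fun hx' => hx ⟨x, hx', rfl⟩, zero_smul]
  -- The term `z` is the sum of the integrations by parts, of integral zero. It replaces `ψ` times
  -- the divergences, hence `-ψ ∂ₜ(P - P')`, by the small terms with `gradAt i ψ`.
  refine setIntegral_eq_zero_of_uniformO (m := m) (S.volume_dom_lt_top _)
    (z := fun t x => ∑ i, (ψ x * divAt i (δJ i t) x + inner ℝ (gradAt i ψ x) (δJ i t x)))
    (hci _ (hψ1.continuous.continuousOn.mul hac) fun x hx => by rw [hψ0 x hx, zero_mul])
    (fun t ht => ⟨integrable_finsetSum _ fun i _ => hzi i t ht, by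
      rw [integral_finsetSum _ fun i _ => hzi i t ht]
      exact Finset.sum_eq_zero fun i _ => hz0 i t ht⟩) ?_
  have hT : UniformO U 1 (m + 1) fun x t => timeDeriv 1 (P - P') x t -
      (t ^ m / m.factorial : ℝ) * timeDeriv (1 + m) (P - P') x 0 :=
    h.smoothInTime.uniformO_timeDeriv_sub (fun l hl x hx => hm (1 + l) (by omega) x hx)
      (h.bounded_timeDeriv _)
  have hψO : UniformO U 1 0 fun x (_ : ℝ) => ψ x := by
    obtain ⟨B, hB⟩ := hψ1.continuous.bounded_above_of_compact_support hψc
    exact UniformO.of_bound fun x _ t _ => hB x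
  have hJO : ∀ i, UniformO U 1 (m + 1) fun x t => inner ℝ (gradAt i ψ x) (δJ i t x) := by
    intro i
    obtain ⟨B, hB⟩ := hK.exists_bound_of_continuousOn ((hgc i).mono hψs)
    have h1 : UniformO (tsupport ψ) 1 (0 + (m + 1)) fun x t =>
        inner ℝ (gradAt i ψ x) (δJ i t x) :=
      UniformO.inner (UniformO.of_bound (f := fun x _ => gradAt i ψ x) fun x hx t _ => hB x hx)
        (h.uniformO_current_sub hk hmk hm hK hψs i 1)
    rw [zero_add] at h1
    obtain ⟨C, hC, h1⟩ := h1
    refine ⟨C, hC, fun x _ t ht => ?_⟩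
    by_cases hx : x ∈ tsupport ψ
    · exact h1 x hx t ht
    · beta_reduce
      rw [hg0 i x hx, inner_zero_left, norm_zero]
      exact mul_nonneg hC (pow_nonneg ht.1 _)
  have hψT := hψO.smul hT
  rw [zero_add] at hψT
  refine ((UniformO.sum Finset.univ fun i _ => hJO i).sub hψT).congr fun x hx t ht => ?_
  rw [h.timeDeriv_one_eq hx ht.1, add_comm 1 m, Finset.sum_add_distrib, ← Finset.mul_sum,
    smul_eq_mul]
  ring

/-- The initial time derivatives of the probability densities agree up to order `k`. -/
theorem timeDeriv_eq_zero (h : S.IsPair V V' P P') {k : ℕ} (hk : S.GradAgreeUpTo V V' k) :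
    ∀ l ≤ k, ∀ x ∈ S.dom (n + 1), timeDeriv l (P - P') x 0 = 0 := by
  intro l
  induction l using Nat.strong_induction_on with
  | _ l ih =>
    intro hl
    cases l with
    | zero =>
      intro x hx
      rw [timeDeriv_zero]
      exact sub_eq_zero.mpr (h.init x hx)
    | succ m => exact h.timeDeriv_succ_eq_zero hk hl fun l hl' => ih l hl' (by omega)

end IsPair

end Setting

end Overdamped

/-! ### The weighted harmonic equation in the interior. -/

namespace Overdamped

theorem UniformO.extend {X F : Type*} [NormedAddCommGroup F] {A B : Set X} {T : ℝ} {m : ℕ}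
    {f : X → ℝ → F} (h : UniformO B T m f) (h0 : ∀ x ∈ A, x ∉ B → ∀ t, f x t = 0) :
    UniformO A T m f := by
  obtain ⟨C, hC, h⟩ := h
  refine ⟨C, hC, fun x hx t ht => ?_⟩
  by_cases hB : x ∈ B
  · exact h x hB t ht
  · rw [h0 x hx hB, norm_zero]
    exact mul_nonneg hC (pow_nonneg ht.1 _)

theorem uniformO_pow_div_factorial {X : Type*} {A : Set X} {T : ℝ} (k : ℕ) :
    UniformO A T k fun _ t => (t ^ k / k.factorial : ℝ) := by
  refine ⟨1, zero_le_one, fun x _ t ht => ?_⟩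
  have h1 : (1 : ℝ) ≤ k.factorial := by exact_mod_cast Nat.one_le_iff_ne_zero.mpr k.factorial_ne_zero
  rw [Real.norm_of_nonneg (div_nonneg (pow_nonneg ht.1 _) (by positivity)), one_mul]
  exact div_le_self (pow_nonneg ht.1 _) h1

section ZeroIntegral

variable {X : Type*} [MeasurableSpace X] {μ : Measure X} {A : Set X} {f g : X → ℝ}

theorem integrableOn_add_and_eq_zero (hf : IntegrableOn f A μ ∧ ∫ x in A, f x ∂μ = 0)
    (hg : IntegrableOn g A μ ∧ ∫ x in A, g x ∂μ = 0) :
    IntegrableOn (fun x => f x + g x) A μ ∧ ∫ x in A, (f x + g x) ∂μ = 0 :=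
  ⟨hf.1.add hg.1, by rw [integral_add hf.1 hg.1, hf.2, hg.2, add_zero]⟩

theorem integrableOn_const_mul_and_eq_zero (c : ℝ)
    (hf : IntegrableOn f A μ ∧ ∫ x in A, f x ∂μ = 0) :
    IntegrableOn (fun x => c * f x) A μ ∧ ∫ x in A, c * f x ∂μ = 0 :=
  ⟨hf.1.const_mul c, by rw [integral_const_mul, hf.2, mul_zero]⟩

end ZeroIntegral

namespace Setting

variable {d n : ℕ} {S : Setting d} {V V' : E d → ℝ → ℝ} {P P' : Conf d (n + 1) → ℝ → ℝ}

theorem join_one (y : E d) (z : Conf d n) :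
    join (N := n + 1) (n := 1) (fun _ => y) z = Fin.cons (α := fun _ => E d) y z := by
  funext i
  refine Fin.cases ?_ (fun j => ?_) i
  · simp [join]
  · simp [join]

theorem density₁_eq (S : Setting d) (P : Conf d (n + 1) → ℝ → ℝ) (y : E d) (t : ℝ) :
    S.density₁ P y t =
      (n + 1 : ℝ) * ∫ z in S.dom n, P (Fin.cons (α := fun _ => E d) y z) t := by
  have h1 : S.density₁ P y t = ((n + 1).descFactorial 1 : ℝ) *
    ∫ z in S.dom n, P (join (N := n + 1) (n := 1) (fun _ => y) z) t := rfl
  rw [h1, Nat.descFactorial_one]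
  simp only [join_one]
  push_cast
  rfl

/-- Averages of functions of one position depend on the one-body density only. Through this identity
the equality of the one-body densities enters the weak equation. -/
theorem setIntegral_mul_eq_density₁ {f : E d → ℝ} {t : ℝ}
    (hi : IntegrableOn (fun x => f (x 0) * P x t) (S.dom (n + 1))) :
    ∫ x in S.dom (n + 1), f (x 0) * P x t = ∫ y in S.Ω, f y * ((n + 1 : ℝ)⁻¹ * S.density₁ P y t) := by
  have hn : (n + 1 : ℝ) ≠ 0 := by positivity
  simp only [density₁_eq, inv_mul_cancel_left₀ hn]
  have h1 := setIntegral_pi_cons hi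
  simp only [Fin.cons_zero, integral_const_mul] at h1
  exact h1

theorem gradAt_comp_apply (φ : E d → ℝ) (i : Fin n) (x : Conf d n) :
    gradAt i (fun x => φ (x i)) x = gradient φ (x i) := by
  simp [gradAt]

theorem divAt_comp_apply (G : E d → E d) (i : Fin n) (x : Conf d n) :
    divAt i (fun x => G (x i)) x = diverg G (x i) := by
  simp [divAt]

namespace IsSystem

theorem integrableOn_mul (h : S.IsSystem V P) {f : E d → ℝ} {C : ℝ} (hf : ContinuousOn f S.Ω)
    (hC : ∀ y ∈ S.Ω, ‖f y‖ ≤ C) {t : ℝ} (ht : 0 ≤ t) :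
    IntegrableOn (fun x => f (x 0) * P x t) (S.dom (n + 1)) := by
  obtain ⟨B, hB⟩ := h.bounded (by omega)
  refine S.integrableOn_dom (C := C * B) ?_ fun x hx => ?_
  · exact (hf.comp (continuous_apply 0).continuousOn fun x hx => S.mem_dom.mp hx 0).mul
      ((h.smoothInTime (by omega)).contDiffOn ht).continuousOn
  · rw [norm_mul]
    have h1 := hC _ (S.mem_dom.mp hx 0)
    exact mul_le_mul h1 (hB x hx t ht) (norm_nonneg _) ((norm_nonneg _).trans h1)

end IsSystem

namespace IsPair

theorem setIntegral_mul_sub_eq_zero (h : S.IsPair V V' P P') {φ : E d → ℝ} (hφ : Continuous φ)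
    (hφc : HasCompactSupport φ) {t : ℝ} (ht : 0 ≤ t) :
    IntegrableOn (fun x => φ (x 0) * (P - P') x t) (S.dom (n + 1)) ∧
      ∫ x in S.dom (n + 1), φ (x 0) * (P - P') x t = 0 := by
  obtain ⟨B, hB⟩ := hφ.bounded_above_of_compact_support hφc
  have h1 := h.fst.integrableOn_mul hφ.continuousOn (fun y _ => hB y) ht
  have h2 := h.snd.integrableOn_mul hφ.continuousOn (fun y _ => hB y) ht
  simp only [Pi.sub_apply, mul_sub]
  refine ⟨h1.sub h2, ?_⟩
  rw [integral_sub h1 h2, setIntegral_mul_eq_density₁ h1, setIntegral_mul_eq_density₁ h2, sub_eq_zero]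
  exact setIntegral_congr_fun S.isOpen_Ω.measurableSet fun y hy => by
    simp only [h.density y hy t ht]

/-- Leading-term extraction from `setIntegral_mul_sub_eq_zero` takes the place of differentiation
under the integral sign. -/
theorem setIntegral_mul_timeDeriv_eq_zero (h : S.IsPair V V' P P') {k : ℕ}
    (hm : ∀ l < k, ∀ x ∈ S.dom (n + 1), timeDeriv l (P - P') x 0 = 0) {φ : E d → ℝ}
    (hφ : Continuous φ) (hφc : HasCompactSupport φ) :
    IntegrableOn (fun x => φ (x 0) * timeDeriv k (P - P') x 0) (S.dom (n + 1)) ∧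
      ∫ x in S.dom (n + 1), φ (x 0) * timeDeriv k (P - P') x 0 = 0 := by
  obtain ⟨B, hB⟩ := hφ.bounded_above_of_compact_support hφc
  obtain ⟨C, hC⟩ := h.bounded_timeDeriv k
  have hi : IntegrableOn (fun x => φ (x 0) * timeDeriv k (P - P') x 0) (S.dom (n + 1)) := by
    refine S.integrableOn_dom (C := B * C) ?_ fun x hx => ?_
    · exact (hφ.comp (continuous_apply 0)).continuousOn.mul
        (h.smoothInTime.contDiffOn_timeDeriv k le_rfl).continuousOn
    · rw [norm_mul]
      exact mul_le_mul (hB _) (hC x hx 0 le_rfl) (norm_nonneg _) ((norm_nonneg _).trans (hB (x 0)))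
  refine ⟨hi, setIntegral_eq_zero_of_uniformO (m := k) (S.volume_dom_lt_top _) hi
    (z := fun t x => -(φ (x 0) * (P - P') x t)) (fun t ht => ?_) ?_⟩
  · obtain ⟨h1, h2⟩ := h.setIntegral_mul_sub_eq_zero hφ hφc ht
    exact ⟨h1.neg, by rw [integral_neg, h2, neg_zero]⟩
  · have h1 : UniformO (S.dom (n + 1)) 1 (k + 1) fun x t => timeDeriv 0 (P - P') x t -
        (t ^ k / k.factorial : ℝ) * timeDeriv (0 + k) (P - P') x 0 :=
      h.smoothInTime.uniformO_timeDeriv_sub (fun l hl x hx => by rw [zero_add]; exact hm l hl x hx)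
        (h.bounded_timeDeriv _)
    have h2 : UniformO (S.dom (n + 1)) 1 0 fun x (_ : ℝ) => φ (x 0) :=
      UniformO.of_bound fun x _ t _ => hB (x 0)
    have h3 := (h2.smul h1).neg
    rw [zero_add] at h3
    refine h3.congr fun x _ t _ => ?_
    rw [zero_add, timeDeriv_zero, smul_eq_mul]
    ring

theorem uniformO_gradient_sub (h : S.IsPair V V' P P') {k : ℕ} (hk : S.GradAgreeUpTo V V' k)
    {A : Set (E d)} (hA : A ⊆ S.Ω) {T : ℝ}
    (hb : UniformO A T 0 fun x t => fderiv ℝ (fun z => timeDeriv (k + 1) (V - V') z t) x) :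
    UniformO A T (k + 1) fun x t => gradient (fun z => (V - V') z t) x -
      (t ^ k / k.factorial : ℝ) • gradient (fun z => timeDeriv k (V - V') z 0) x := by
  refine ((h.smoothInTime_potential.uniformO_fderiv_sub S.isOpen_Ω hA hk hb).clm
    (gradL d)).congr fun x _ t _ => ?_
  rw [map_sub, map_smul, gradient_eq, gradient_eq]

theorem uniformO_leading_term (h : S.IsPair V V' P P') {k : ℕ} (hk : S.GradAgreeUpTo V V' k)
    {K : Set (E d)} (hK : IsCompact K) (hKΩ : K ⊆ S.Ω) :
    UniformO {x ∈ S.dom (n + 1) | x 0 ∈ K} 1 (k + 1) fun x t =>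
      P' x t • gradient (fun z => (V - V') z t) (x 0) - (t ^ k / k.factorial : ℝ) •
        (P' x 0 • gradient (fun z => timeDeriv k (V - V') z 0) (x 0)) := by
  set A := {x ∈ S.dom (n + 1) | x 0 ∈ K}
  have hA : A ⊆ S.dom (n + 1) := fun x hx => hx.1
  have hAK : MapsTo (fun x : Conf d (n + 1) => x 0) A K := fun x hx => hx.2
  -- The error is split into `P'(t)` times the Taylor remainder of the gradient (`h1`) and `P'(t) -
  -- P'(0)` times the leading term (`h4`).
  have h1 := ((h.uniformO_snd 1).mono hA).smul ((h.uniformO_gradient_sub hk hKΩ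
    (h.smoothInTime_potential.uniformO_fderiv S.isOpen_Ω hK hKΩ (k + 1) 1)).comp _ hAK)
  have h2 : UniformO (S.dom (n + 1)) 1 (0 + 1) fun x t => timeDeriv 0 P' x t -
      (t ^ 0 / Nat.factorial 0 : ℝ) * timeDeriv (0 + 0) P' x 0 :=
    (h.snd.smoothInTime (by omega)).uniformO_timeDeriv_sub (by simp)
      (h.snd.bounded_timeDeriv (by omega) _)
  have h3 : UniformO A 1 0 fun x (_ : ℝ) =>
      gradient (fun z => timeDeriv k (V - V') z 0) (x 0) := by
    obtain ⟨C, hC⟩ := hK.exists_bound_of_continuousOn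
      (((contDiffOn_gradient (k := 1) S.isOpen_Ω (by
        simpa [one_add_one_eq_two] using
          h.smoothInTime_potential.contDiffOn_timeDeriv k le_rfl)).continuousOn).mono hKΩ)
    exact UniformO.of_bound fun x hx t _ => hC _ hx.2
  have h4 := ((h2.mono hA).smul (uniformO_pow_div_factorial k)).smul h3
  simp only [timeDeriv_zero, zero_add, pow_zero, Nat.factorial_zero, Nat.cast_one, div_one, one_mul,
    add_zero, add_comm 1 k] at h1 h4
  refine (h1.add h4).congr fun x hx t ht => ?_
  module

/-- The one-body continuity equation, to leading order in time. -/
theorem setIntegral_fderiv_gradient_eq_zero (h : S.IsPair V V' P P') {k : ℕ}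
    (hk : S.GradAgreeUpTo V V' k) {φ : E d → ℝ} (hφ : ContDiff ℝ 2 φ) (hφc : HasCompactSupport φ)
    (hφs : tsupport φ ⊆ S.Ω) :
    ∫ x in S.dom (n + 1), fderiv ℝ φ (x 0)
      (gradient (fun z => timeDeriv k (V - V') z 0) (x 0)) * P' x 0 = 0 := by
  set U := S.dom (n + 1) with hUdef
  have hU : IsOpen U := S.isOpen_dom _
  set K := tsupport φ with hKdef
  have hK : IsCompact K := hφc
  set w : E d → ℝ := fun z => timeDeriv k (V - V') z 0 with hw
  have hm := h.timeDeriv_eq_zero hk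
  have hφ1 : ContDiff ℝ 1 φ := hφ.of_le (by norm_num)
  have hproj : ContDiff ℝ 1 (fun x : Conf d (n + 1) => x 0) := contDiff_apply ℝ (E d) 0
  have hφx : ContDiff ℝ 1 (fun x : Conf d (n + 1) => φ (x 0)) := hφ1.comp hproj
  have hg1 : ContDiff ℝ 1 (gradient φ) := by
    rw [← contDiffOn_univ]
    have := contDiffOn_gradient (k := 1) isOpen_univ (f := φ)
      (by simpa [one_add_one_eq_two] using hφ.contDiffOn)
    simpa using this
  have hgx : ContDiff ℝ 1 (fun x : Conf d (n + 1) => gradient φ (x 0)) := hg1.comp hproj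
  have hg0 : ∀ y ∉ K, gradient φ y = 0 := fun y hy => by
    rw [gradient_eq]
    have : fderiv ℝ φ y = 0 := by
      by_contra hne
      exact hy (support_fderiv_subset ℝ hne)
    rw [this, map_zero]
  have hφ0 : ∀ y ∉ K, φ y = 0 := fun y hy => image_eq_zero_of_notMem_tsupport hy
  have hgc : HasCompactSupport (gradient φ) := HasCompactSupport.intro hK hg0
  have hlc : Continuous (diverg (gradient φ)) := by
    have := continuousOn_diverg isOpen_univ hg1.contDiffOn
    exact continuousOn_univ.mp this
  have hl0 : ∀ y ∉ K, diverg (gradient φ) y = 0 := fun y hy => by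
    have h1 : gradient φ =ᶠ[𝓝 y] fun _ => 0 := by
      filter_upwards [(isClosed_tsupport φ).isOpen_compl.mem_nhds hy] with z hz using hg0 z hz
    rw [diverg_eq, h1.fderiv_eq]
    simp
  obtain ⟨Bφ, hBφ⟩ := hφ.continuous.bounded_above_of_compact_support hφc
  obtain ⟨Bg, hBg⟩ := hg1.continuous.bounded_above_of_compact_support hgc
  obtain ⟨Bl, hBl⟩ := hlc.bounded_above_of_compact_support (HasCompactSupport.intro hK hl0)
  have hBφn : 0 ≤ Bφ := (norm_nonneg _).trans (hBφ 0)
  have hBgn : 0 ≤ Bg := (norm_nonneg _).trans (hBg 0)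
  have hBln : 0 ≤ Bl := (norm_nonneg _).trans (hBl 0)
  set δJ : Fin (n + 1) → ℝ → Conf d (n + 1) → E d := fun i t x =>
    S.current V P i x t - S.current V' P' i x t with hδJ
  have hJc : ∀ i t, 0 ≤ t → ContDiffOn ℝ 1 (δJ i t) U := fun i t ht =>
    h.contDiffOn_current_sub i ht
  have hJdb : ∀ i t, 0 ≤ t → ∃ C, ∀ x ∈ U, ‖divAt i (δJ i t) x‖ ≤ C := fun i t ht => by
    obtain ⟨C, hC⟩ := h.fst.bounded_divAt_current i
    obtain ⟨C', hC'⟩ := h.snd.bounded_divAt_current i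
    refine ⟨C + C', fun x hx => ?_⟩
    have h1 : divAt i (δJ i t) x = _ := h.divAt_current_sub hx ht i
    rw [h1]
    exact (norm_sub_le _ _).trans (add_le_add (hC x hx t ht) (hC' x hx t ht))
  -- the fluxes of the other particles
  have hothers : ∀ j : Fin n, ∀ t, 0 ≤ t →
      IntegrableOn (fun x => φ (x 0) * divAt j.succ (δJ j.succ t) x) U ∧
      ∫ x in U, φ (x 0) * divAt j.succ (δJ j.succ t) x = 0 := by
    intro j t ht
    obtain ⟨i1, e1⟩ := h.fst.setIntegral_mul_divAt_current_eq_zero hφ.continuous hφc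
      (Fin.succ_ne_zero j) ht
    obtain ⟨i2, e2⟩ := h.snd.setIntegral_mul_divAt_current_eq_zero hφ.continuous hφc
      (Fin.succ_ne_zero j) ht
    have h1 : EqOn (fun x => φ (x 0) * divAt j.succ (δJ j.succ t) x)
        (fun x => φ (x 0) * divAt j.succ (fun z => S.current V P j.succ z t) x -
          φ (x 0) * divAt j.succ (fun z => S.current V' P' j.succ z t) x) U := fun x hx => by
      have h2 : divAt j.succ (δJ j.succ t) x = _ := h.divAt_current_sub hx ht j.succ
      simp only [h2]
      ring
    refine ⟨(i1.sub i2).congr_fun h1.symm hU.measurableSet, ?_⟩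
    rw [setIntegral_congr_fun hU.measurableSet h1, integral_sub i1 i2, e1, e2, sub_zero]
  -- integration by parts in the first position
  have hfirst : ∀ t, 0 ≤ t →
      IntegrableOn (fun x => φ (x 0) * divAt 0 (δJ 0 t) x + inner ℝ (gradient φ (x 0)) (δJ 0 t x)) U ∧
      ∫ x in U, (φ (x 0) * divAt 0 (δJ 0 t) x + inner ℝ (gradient φ (x 0)) (δJ 0 t x)) = 0 := by
    intro t ht
    obtain ⟨C, hC⟩ := hJdb 0 t ht
    obtain ⟨C₁, hC₁⟩ := h.fst.bounded_current (by omega) 0 hK hφs ht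
    obtain ⟨C₂, hC₂⟩ := h.snd.bounded_current (by omega) 0 hK hφs ht
    have hi : IntegrableOn
        (fun x => φ (x 0) * divAt 0 (δJ 0 t) x + inner ℝ (gradient φ (x 0)) (δJ 0 t x)) U := by
      refine Integrable.add (S.integrableOn_dom (C := Bφ * C) ?_ fun x hx => ?_)
        (S.integrableOn_dom (C := max (Bg * (C₁ + C₂)) 0) ?_ fun x hx => ?_)
      · exact hφx.continuous.continuousOn.mul (continuousOn_divAt hU (hJc 0 t ht) 0)
      · rw [norm_mul]
        exact mul_le_mul (hBφ _) (hC x hx) (norm_nonneg _) hBφn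
      · exact hgx.continuous.continuousOn.inner (hJc 0 t ht).continuousOn
      · by_cases hx0 : x 0 ∈ K
        · refine le_trans ?_ (le_max_left _ _)
          refine (norm_inner_le_norm _ _).trans (mul_le_mul (hBg _) ?_ (norm_nonneg _) hBgn)
          exact (norm_sub_le _ _).trans (add_le_add (hC₁ x hx hx0) (hC₂ x hx hx0))
        · rw [hg0 _ hx0, inner_zero_left, norm_zero]
          exact le_max_right _ _
    refine ⟨hi, ?_⟩
    have := S.setIntegral_mul_divAt_add_inner_eq_zero hφx.contDiffOn (hJc 0 t ht) 0 hK hφs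
      (fun x hx => by rw [hφ0 _ hx, zero_smul]) (by simpa only [gradAt_comp_apply] using hi)
    simpa only [gradAt_comp_apply] using this
  have hΔc : ∀ t, 0 ≤ t → ContDiffOn ℝ 2 (fun x => (P - P') x t) U := fun t ht =>
    h.smoothInTime.contDiffOn ht
  -- A second integration by parts moves the gradient of `P - P'` onto `φ`. Its smallness is not
  -- known up to the boundary in the other positions, whereas `P - P'` is uniformly small.
  have hlap : ∀ t, 0 ≤ t →
      IntegrableOn (fun x => (P - P') x t * diverg (gradient φ) (x 0) +
        inner ℝ (gradAt 0 (fun x => (P - P') x t) x) (gradient φ (x 0))) U ∧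
      ∫ x in U, ((P - P') x t * diverg (gradient φ) (x 0) +
        inner ℝ (gradAt 0 (fun x => (P - P') x t) x) (gradient φ (x 0))) = 0 := by
    intro t ht
    obtain ⟨C, hC⟩ := h.bounded_timeDeriv 0
    obtain ⟨C₁, hC₁⟩ := h.fst.solution.bdd_grad 0
    obtain ⟨C₂, hC₂⟩ := h.snd.solution.bdd_grad 0
    rw [timeDeriv_zero] at hC
    have hi : IntegrableOn (fun x => (P - P') x t * diverg (gradient φ) (x 0) +
        inner ℝ (gradAt 0 (fun x => (P - P') x t) x) (gradient φ (x 0))) U := by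
      refine Integrable.add (S.integrableOn_dom (C := C * Bl) ?_ fun x hx => ?_)
        (S.integrableOn_dom (C := (C₁ + C₂) * Bg) ?_ fun x hx => ?_)
      · exact (hΔc t ht).continuousOn.mul (hlc.comp (continuous_apply 0)).continuousOn
      · rw [norm_mul]
        exact mul_le_mul (hC x hx t ht) (hBl _) (norm_nonneg _)
          ((norm_nonneg _).trans (hC x hx t ht))
      · refine ContinuousOn.inner ?_ hgx.continuous.continuousOn
        exact (contDiffOn_gradAt (k := 1) hU
          (by simpa [one_add_one_eq_two] using hΔc t ht) 0).continuousOn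
      · have h1 : gradAt 0 (fun x => (P - P') x t) x = _ := h.gradAt_sub hx ht 0
        have h2 : ‖gradAt 0 (fun x => (P - P') x t) x‖ ≤ C₁ + C₂ := by
          rw [h1]
          exact (norm_sub_le _ _).trans (add_le_add (hC₁ x hx t ht) (hC₂ x hx t ht))
        exact (norm_inner_le_norm _ _).trans
          (mul_le_mul h2 (hBg _) (norm_nonneg _) ((norm_nonneg _).trans h2))
    refine ⟨hi, ?_⟩
    have := S.setIntegral_mul_divAt_add_inner_eq_zero (f := fun x => (P - P') x t)
      (G := fun x => gradient φ (x 0)) ((hΔc t ht).of_le (by norm_num)) hgx.contDiffOn 0 hK hφs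
      (fun x hx => by rw [hg0 _ hx, smul_zero])
      (by simpa only [divAt_comp_apply] using hi)
    simpa only [divAt_comp_apply] using this
  -- The time derivative of order `k + 1` need not vanish pointwise, but its integral against `φ (x
  -- 0)` does, since the one-body densities agree.
  obtain ⟨hai, ha0⟩ := h.setIntegral_mul_timeDeriv_eq_zero (k := k + 1)
    (fun l hl => hm l (by omega)) hφ.continuous hφc
  have hwc : ContinuousOn (gradient w) S.Ω := (contDiffOn_gradient (k := 1) S.isOpen_Ω (by
    simpa [one_add_one_eq_two] using
      h.smoothInTime_potential.contDiffOn_timeDeriv k le_rfl)).continuousOn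
  have hfw : ContinuousOn (fun y => fderiv ℝ φ y (gradient w y)) S.Ω :=
    (hφ.continuous_fderiv two_ne_zero).continuousOn.clm_apply hwc
  obtain ⟨Bw, hBw⟩ := hK.exists_bound_of_continuousOn (hfw.mono hφs)
  have hbi : IntegrableOn (fun x => fderiv ℝ φ (x 0) (gradient w (x 0)) * P' x 0) U := by
    refine h.snd.integrableOn_mul (C := max Bw 0) hfw (fun y _ => ?_) le_rfl
    by_cases hy : y ∈ K
    · exact (hBw y hy).trans (le_max_left _ _)
    · rw [← inner_gradient, hg0 y hy, inner_zero_left, norm_zero]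
      exact le_max_right _ _
  have hDβ : S.D * S.β ≠ 0 := mul_ne_zero S.D_pos.ne' S.β_pos.ne'
  suffices hsuff : ∫ x in U, S.D * S.β *
      (fderiv ℝ φ (x 0) (gradient w (x 0)) * P' x 0) = 0 by
    rw [integral_const_mul] at hsuff
    exact (mul_eq_zero.mp hsuff).resolve_left hDβ
  -- The pieces of `z`, each of integral zero, are: the leading part of `∂ₜ(P - P')`, the fluxes of
  -- the other particles, and the two integrations by parts in the first position. Added to the
  -- leading potential term they leave only `O(t ^ (k + 1))`.
  refine setIntegral_eq_zero_of_uniformO (m := k) (S.volume_dom_lt_top _) (hbi.const_mul _)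
    (z := fun t x => (t ^ k / k.factorial : ℝ) * (φ (x 0) * timeDeriv (k + 1) (P - P') x 0)
      + (∑ j : Fin n, φ (x 0) * divAt j.succ (δJ j.succ t) x
      + ((φ (x 0) * divAt 0 (δJ 0 t) x + inner ℝ (gradient φ (x 0)) (δJ 0 t x))
      + S.D * ((P - P') x t * diverg (gradient φ) (x 0) +
        inner ℝ (gradAt 0 (fun x => (P - P') x t) x) (gradient φ (x 0))))))
    (fun t ht => ?_) ?_
  · have i1 := integrableOn_const_mul_and_eq_zero (t ^ k / k.factorial : ℝ) ⟨hai, ha0⟩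
    have i2 : IntegrableOn (fun x => ∑ j : Fin n, φ (x 0) * divAt j.succ (δJ j.succ t) x) U ∧
        ∫ x in U, ∑ j : Fin n, φ (x 0) * divAt j.succ (δJ j.succ t) x = 0 :=
      ⟨integrable_finsetSum _ fun j _ => (hothers j t ht).1, by
        rw [integral_finsetSum _ fun j _ => (hothers j t ht).1,
          Finset.sum_eq_zero fun j _ => (hothers j t ht).2]⟩
    exact integrableOn_add_and_eq_zero i1 (integrableOn_add_and_eq_zero i2
      (integrableOn_add_and_eq_zero (hfirst t ht)
        (integrableOn_const_mul_and_eq_zero S.D (hlap t ht))))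
  · have hΔO : UniformO U 1 (k + 1) (P - P') :=
      h.uniformO_sub (fun l hl => hm l (by omega)) 1
    have hT : UniformO U 1 (k + 1) fun x t => timeDeriv 1 (P - P') x t -
        (t ^ k / k.factorial : ℝ) * timeDeriv (1 + k) (P - P') x 0 :=
      h.smoothInTime.uniformO_timeDeriv_sub (fun l hl x hx => hm (1 + l) (by omega) x hx)
        (h.bounded_timeDeriv _)
    have hφO : UniformO U 1 0 fun x (_ : ℝ) => φ (x 0) :=
      UniformO.of_bound fun x _ t _ => hBφ (x 0)
    have hlO : UniformO U 1 0 fun x (_ : ℝ) => diverg (gradient φ) (x 0) :=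
      UniformO.of_bound fun x _ t _ => hBl (x 0)
    set A := {x ∈ U | x 0 ∈ K}
    have hgO : UniformO A 1 0 fun x (_ : ℝ) => gradient φ (x 0) :=
      UniformO.of_bound fun x _ t _ => hBg (x 0)
    have h1 : UniformO U 1 (0 + (k + 1)) _ := hφO.smul hT
    have h2 : UniformO U 1 (k + 1) _ := (hΔO.smul hlO).const_smul S.D
    have h3 : UniformO U 1 (0 + ((k + 1) + 0)) fun x t => inner ℝ (gradient φ (x 0))
        ((P - P') x t • S.force V Finset.univ 0 x t) := by
      refine (hgO.inner ((hΔO.mono fun x hx => hx.1).smul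
        (h.fst.uniformO_force Finset.univ 0 hK hφs 1))).extend fun x hx hxA t => ?_
      rw [hg0 _ fun hx0 => hxA ⟨hx, hx0⟩, inner_zero_left]
    have h4 := (hgO.inner (h.uniformO_leading_term hk hK hφs)).extend (A := U) fun x hx hxA t => by
      rw [hg0 _ fun hx0 => hxA ⟨hx, hx0⟩, inner_zero_left]
    simp only [zero_add, add_zero] at h1 h2 h3 h4
    refine (((h2.sub h1).add (h3.const_smul (S.D * S.β))).sub
      (h4.const_smul (S.D * S.β))).congr fun x hx t ht => ?_
    -- The continuity equation eliminates the divergence in the first position; the gradient of `P -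
    -- P'` in the current then cancels against the one in the Laplacian identity.
    have e1 := h.timeDeriv_one_eq hx ht.1
    rw [Fin.sum_univ_succ] at e1
    have e2 : δJ 0 t x = _ := h.current_sub hx ht.1 0
    have e3 : divAt 0 (δJ 0 t) x = -timeDeriv 1 (P - P') x t -
        ∑ j : Fin n, divAt j.succ (δJ j.succ t) x := by
      rw [e1]; simp only [hδJ]; ring
    rw [e3, e2, add_comm 1 k, ← Finset.mul_sum, ← inner_gradient]
    simp only [inner_add_right, inner_sub_right, inner_smul_right, smul_eq_mul]
    rw [real_inner_comm (gradient φ (x 0)) (gradAt 0 _ x)]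
    ring

/-- The leading time derivative of the difference of the potentials satisfies a weighted harmonic
equation. -/
theorem isWeaklyDivFree (h : S.IsPair V V' P P') {k : ℕ} (hk : S.GradAgreeUpTo V V' k) :
    IsWeaklyDivFree S.Ω fun y =>
      S.density₁ P y 0 • gradient (fun z => timeDeriv k (V - V') z 0) y := by
  intro φ hφ hφc hφs
  have hK : IsCompact (tsupport φ) := hφc
  have h0 := h.setIntegral_fderiv_gradient_eq_zero hk hφ hφc hφs
  set w : E d → ℝ := fun z => timeDeriv k (V - V') z 0 with hw
  have hwc : ContinuousOn (gradient w) S.Ω := (contDiffOn_gradient (k := 1) S.isOpen_Ω (by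
    simpa [one_add_one_eq_two] using
      h.smoothInTime_potential.contDiffOn_timeDeriv k le_rfl)).continuousOn
  have hfw : ContinuousOn (fun y => fderiv ℝ φ y (gradient w y)) S.Ω :=
    (hφ.continuous_fderiv two_ne_zero).continuousOn.clm_apply hwc
  obtain ⟨B, hB⟩ := hK.exists_bound_of_continuousOn (hfw.mono hφs)
  have hi := h.snd.integrableOn_mul (C := max B 0) hfw (fun y _ => by
    by_cases hy : y ∈ tsupport φ
    · exact (hB y hy).trans (le_max_left _ _)
    · have : fderiv ℝ φ y = 0 := by
        by_contra hne
        exact hy (support_fderiv_subset ℝ hne)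
      rw [this, _root_.zero_apply, norm_zero]
      exact le_max_right _ _) le_rfl
  rw [setIntegral_mul_eq_density₁ (f := fun y => fderiv ℝ φ y (gradient w y)) hi] at h0
  have hn : (n + 1 : ℝ) ≠ 0 := by positivity
  calc ∫ y in S.Ω, fderiv ℝ φ y (S.density₁ P y 0 • gradient w y)
      = ∫ y in S.Ω, (n + 1 : ℝ) *
          (fderiv ℝ φ y (gradient w y) * ((n + 1 : ℝ)⁻¹ * S.density₁ P' y 0)) := by
        refine setIntegral_congr_fun S.isOpen_Ω.measurableSet fun y hy => ?_
        simp only [map_smul, smul_eq_mul, h.density y hy 0 le_rfl]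
        field_simp
    _ = 0 := by rw [integral_const_mul, h0, mul_zero]

end IsPair

end Setting

end Overdamped

namespace Overdamped

/-- Leading coefficients inherit limits that hold at all positive times. -/
theorem tendsto_zero_of_leading_term {X : Type*} {l : Filter X} {A : Set X} (hA : A ∈ l)
    {T : ℝ} (hT : 0 < T) {k : ℕ} {q : X → ℝ} {h : X → ℝ → ℝ}
    (hh : ∀ t, 0 ≤ t → Tendsto (fun y => h y t) l (𝓝 0))
    (hO : UniformO A T (k + 1) fun y t => h y t - (t ^ k / k.factorial : ℝ) * q y) :
    Tendsto q l (𝓝 0) := by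
  obtain ⟨C, hC, hO⟩ := hO
  rw [Metric.tendsto_nhds]
  intro ε hε
  have hk : (0 : ℝ) < k.factorial := by positivity
  -- First a time is fixed, independent of `y`, at which the error relative to `t ^ k / k!` is below
  -- `ε / 2`; only then is the limit in `y` used, at that time.
  set t := min T (ε / (2 * (k.factorial * C + 1))) with ht
  have htpos : 0 < t := lt_min hT (by positivity)
  have htk : 0 < t ^ k := pow_pos htpos k
  have hCt : k.factorial * C * t < ε / 2 := by
    have h1 : t * (2 * (k.factorial * C + 1)) ≤ ε := by
      rw [← le_div_iff₀ (by positivity)]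
      exact min_le_right _ _
    nlinarith
  have h1 := (Metric.tendsto_nhds.mp (hh t htpos.le)) (t ^ k / k.factorial * (ε / 2)) (by positivity)
  filter_upwards [h1, hA] with y hy hyA
  have h2 := hO y hyA t ⟨htpos.le, min_le_left _ _⟩
  rw [Real.norm_eq_abs] at h2
  rw [Real.dist_eq, sub_zero] at hy ⊢
  have h3 : t ^ k / k.factorial * |q y| ≤ |h y t| + C * t ^ (k + 1) := by
    have h4 := abs_sub_abs_le_abs_sub (t ^ k / k.factorial * q y) (h y t)
    rw [abs_mul, abs_of_pos (by positivity : 0 < t ^ k / (k.factorial : ℝ)), abs_sub_comm] at h4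
    linarith
  have h5 : C * t ^ (k + 1) = t ^ k / k.factorial * (k.factorial * C * t) := by
    field_simp
    ring
  have h6 : t ^ k / (k.factorial : ℝ) * |q y| < t ^ k / k.factorial * ε := by
    calc t ^ k / (k.factorial : ℝ) * |q y| ≤ |h y t| + C * t ^ (k + 1) := h3
      _ < t ^ k / k.factorial * (ε / 2) + t ^ k / k.factorial * (ε / 2) := by
          rw [h5]
          exact add_lt_add hy (mul_lt_mul_of_pos_left hCt (by positivity))
      _ = t ^ k / k.factorial * ε := by ring
  exact lt_of_mul_lt_mul_left h6 (by positivity)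

/-! ### The boundary condition, the induction on the order, and the conclusion. -/

namespace Setting

variable {d n : ℕ} {S : Setting d} {V V' : E d → ℝ → ℝ} {P P' : Conf d (n + 1) → ℝ → ℝ}

theorem continuous_join {N m : ℕ} (x : Conf d m) : Continuous (join (N := N) x) := by
  refine continuous_pi fun i => ?_
  by_cases hi : (i : ℕ) < m
  · simp only [join, hi, dif_pos]; exact continuous_const
  · simp only [join, hi, dif_neg, not_false_eq_true]; exact continuous_apply _

theorem join_mem_dom {N m : ℕ} {x : Conf d m} (hx : x ∈ S.dom m) {y : Conf d (N - m)}
    (hy : y ∈ S.dom (N - m)) : join x y ∈ S.dom N := by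
  rw [mem_dom] at *
  intro i
  by_cases hi : (i : ℕ) < m
  · simp only [join, hi, dif_pos]; exact hx _
  · simp only [join, hi, dif_neg, not_false_eq_true]; exact hy _

theorem snoc_mem_dom {m : ℕ} {x : Conf d m} (hx : x ∈ S.dom m) {y : E d} (hy : y ∈ S.Ω) :
    Fin.snoc (α := fun _ => E d) x y ∈ S.dom (m + 1) := by
  rw [mem_dom] at *
  intro i
  refine Fin.lastCases ?_ (fun j => ?_) i
  · simpa using hy
  · simpa using hx j

namespace IsSystem

variable {N : ℕ} {Q : Conf d N → ℝ → ℝ}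

theorem integrableOn_join (h : S.IsSystem V Q) (hN : 1 ≤ N) {m : ℕ} {x : Conf d m}
    (hx : x ∈ S.dom m) {t : ℝ} (ht : 0 ≤ t) :
    IntegrableOn (fun y => Q (join x y) t) (S.dom (N - m)) := by
  obtain ⟨C, hC⟩ := h.bounded hN
  refine S.integrableOn_dom (C := C) ?_ fun y hy => hC _ (join_mem_dom hx hy) t ht
  exact ((h.smoothInTime hN).contDiffOn ht).continuousOn.comp (continuous_join x).continuousOn
    fun y hy => join_mem_dom hx hy

theorem density₁_pos {Q : Conf d (n + 1) → ℝ → ℝ} (h : S.IsSystem V Q)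
    (hpos : ∀ x ∈ S.dom (n + 1), 0 < Q x 0) {y : E d} (hy : y ∈ S.Ω) : 0 < S.density₁ Q y 0 := by
  rw [density₁_eq]
  refine mul_pos (by positivity) ?_
  have hx : (fun _ : Fin 1 => y) ∈ S.dom 1 := S.mem_dom.mpr fun _ => hy
  have hi : IntegrableOn (fun z => Q (Fin.cons (α := fun _ => E d) y z) 0) (S.dom n) := by
    have h1 := h.integrableOn_join (by omega) hx le_rfl
    simp only [join_one] at h1
    exact h1
  have hp : ∀ z ∈ S.dom n, 0 < Q (Fin.cons (α := fun _ => E d) y z) 0 := fun z hz => by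
    rw [← join_one]; exact hpos _ (join_mem_dom hx hz)
  rw [setIntegral_pos_iff_support_of_nonneg_ae _ hi]
  · have h1 : Function.support (fun z => Q (Fin.cons (α := fun _ => E d) y z) 0) ∩ S.dom n =
        S.dom n := inter_eq_right.mpr fun z hz => (hp z hz).ne'
    rw [h1]
    exact (S.isOpen_dom n).measure_pos _ ⟨fun _ => y, S.mem_dom.mpr fun _ => hy⟩
  · exact (ae_restrict_iff' (S.measurableSet_dom n)).mpr
      (Eventually.of_forall fun z hz => (hp z hz).le)

theorem uniformO_density₁ (h : S.IsSystem V P) (T : ℝ) : UniformO S.Ω T 0 (S.density₁ P) := by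
  obtain ⟨C, hC⟩ := h.accessible.density_bounded 1 le_rfl (by omega) 0
  rw [timeDeriv_zero] at hC
  exact UniformO.of_bound fun y hy t ht => hC (fun _ => y) (S.mem_dom.mpr fun _ => hy) t ht.1

theorem uniformO_density₁_sub (h : S.IsSystem V P) (T : ℝ) :
    UniformO S.Ω T 1 fun y t => S.density₁ P y t - S.density₁ P y 0 := by
  have h1 : UniformO (S.dom 1) T (0 + 1) fun x t => timeDeriv 0 (S.density P 1) x t -
      (t ^ 0 / Nat.factorial 0 : ℝ) * timeDeriv (0 + 0) (S.density P 1) x 0 :=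
    (h.smoothInTime_density le_rfl (by omega)).uniformO_timeDeriv_sub (by simp)
      (h.accessible.density_bounded 1 le_rfl (by omega) _)
  simp only [timeDeriv_zero, zero_add, pow_zero, Nat.factorial_zero, Nat.cast_one, div_one,
    one_mul] at h1
  exact h1.comp (fun y => fun _ => y) fun y hy => S.mem_dom.mpr fun _ => hy

theorem continuousOn_density₁ (h : S.IsSystem V P) {t : ℝ} (ht : 0 ≤ t) :
    ContinuousOn (fun y => S.density₁ P y t) S.Ω :=
  ((h.smoothInTime_density le_rfl (by omega)).contDiffOn ht).continuousOn.comp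
    (f := fun y : E d => fun _ : Fin 1 => y) (by fun_prop) fun y hy => S.mem_dom.mpr fun _ => hy

/-- At time `0` the gradient has a continuous extension to the compact closure of `Ω`. -/
theorem exists_bound_gradient (h : S.IsSystem V Q) (k : ℕ) :
    ∃ C, ∀ y ∈ S.Ω, ‖fderiv ℝ (fun z => timeDeriv k V z 0) y‖ ≤ C := by
  obtain ⟨g, hg, hgV⟩ := h.accessible.gradV_extends k
  have hc : ContinuousOn (fun y => g (y, (0 : ℝ))) (closure S.Ω) := by
    refine hg.comp (by fun_prop) fun y hy => ?_
    by_cases hyΩ : y ∈ S.Ω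
    · exact Or.inl ⟨hyΩ, self_mem_Ici⟩
    · exact Or.inr ⟨by rw [S.isOpen_Ω.frontier_eq]; exact ⟨hy, hyΩ⟩, rfl⟩
  obtain ⟨C, hC⟩ := S.isBounded_Ω.isCompact_closure.exists_bound_of_continuousOn hc
  refine ⟨C, fun y hy => ?_⟩
  have h1 := hC y (subset_closure hy)
  rw [← hgV (⟨hy, self_mem_Ici⟩ : (y, (0 : ℝ)) ∈ S.Ω ×ˢ Ici (0 : ℝ))] at h1
  simpa [gradient] using h1

/-- Continuity of the extension at the space-time point `(x, 0)` bounds the gradient near `x` for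
short times, up to the boundary. The Taylor remainder at the boundary needs exactly this. -/
theorem exists_uniformO_gradient (h : S.IsSystem V Q) (k : ℕ) {x : E d} (hx : x ∈ frontier S.Ω) :
    ∃ r > 0, ∀ T < r, UniformO (S.Ω ∩ Metric.ball x r) T 0 fun y t =>
      fderiv ℝ (fun z => timeDeriv k V z t) y := by
  obtain ⟨g, hg, hgV⟩ := h.accessible.gradV_extends k
  have h1 := (hg (x, 0) (Or.inr ⟨hx, rfl⟩)).norm.eventually
    (Iio_mem_nhds (lt_add_one ‖g (x, 0)‖))
  obtain ⟨r, hr, hball⟩ := Metric.mem_nhdsWithin_iff.mp h1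
  refine ⟨r, hr, fun T hT => UniformO.of_bound (C := ‖g (x, 0)‖ + 1) fun y hy t ht => ?_⟩
  have h2 : (y, t) ∈ S.Ω ×ˢ Ici (0 : ℝ) := ⟨hy.1, ht.1⟩
  have h3 : ‖g (y, t)‖ < ‖g (x, 0)‖ + 1 := hball ⟨by
    rw [Metric.mem_ball, Prod.dist_eq, max_lt_iff]
    refine ⟨hy.2, ?_⟩
    rw [Real.dist_eq, sub_zero, abs_of_nonneg ht.1]
    exact ht.2.trans_lt hT, Or.inl h2⟩
  rw [← hgV h2] at h3
  simpa [gradient] using h3.le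

end IsSystem

namespace IsPair

theorem timeDeriv_potential_sub (h : S.IsPair V V' P P') (k : ℕ) {y : E d} (hy : y ∈ S.Ω) {t : ℝ}
    (ht : 0 ≤ t) : timeDeriv k (V - V') y t = timeDeriv k V y t - timeDeriv k V' y t :=
  h.fst.smoothInTime_potential.timeDeriv_sub h.snd.smoothInTime_potential k hy ht

theorem fderiv_timeDeriv_sub (h : S.IsPair V V' P P') (k : ℕ) {y : E d} (hy : y ∈ S.Ω) {t : ℝ}
    (ht : 0 ≤ t) : fderiv ℝ (fun z => timeDeriv k (V - V') z t) y =
      fderiv ℝ (fun z => timeDeriv k V z t) y - fderiv ℝ (fun z => timeDeriv k V' z t) y := by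
  have h1 : (fun z => timeDeriv k (V - V') z t) =ᶠ[𝓝 y]
      fun z => timeDeriv k V z t - timeDeriv k V' z t := by
    filter_upwards [S.isOpen_Ω.mem_nhds hy] with z hz using h.timeDeriv_potential_sub k hz ht
  rw [h1.fderiv_eq]
  exact fderiv_fun_sub
    (((h.fst.smoothInTime_potential.contDiffOn_timeDeriv k ht).differentiableOn
      two_ne_zero).differentiableAt (S.isOpen_Ω.mem_nhds hy))
    (((h.snd.smoothInTime_potential.contDiffOn_timeDeriv k ht).differentiableOn
      two_ne_zero).differentiableAt (S.isOpen_Ω.mem_nhds hy))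

theorem isBoundedC2 (h : S.IsPair V V' P P') (k : ℕ) :
    IsBoundedC2 S.Ω fun z => timeDeriv k (V - V') z 0 where
  contDiffOn := h.smoothInTime_potential.contDiffOn_timeDeriv k le_rfl
  bounded := by
    have hb : ∀ {V : E d → ℝ → ℝ} {P : Conf d (n + 1) → ℝ → ℝ}, S.IsSystem V P →
        ∃ C, ∀ y ∈ S.Ω, |timeDeriv k V y 0| ≤ C := by
      intro V P h
      obtain ⟨g, hg, hgV⟩ := h.accessible.V_extends k
      rw [← closure_eq_self_union_frontier] at hg
      obtain ⟨C, hC⟩ := S.isBounded_Ω.isCompact_closure.exists_bound_of_continuousOn hg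
      refine ⟨C, fun y hy => ?_⟩
      have h1 := hC y (subset_closure hy)
      rwa [← hgV hy] at h1
    obtain ⟨C, hC⟩ := hb h.fst
    obtain ⟨C', hC'⟩ := hb h.snd
    refine ⟨C + C', fun y hy => ?_⟩
    rw [h.timeDeriv_potential_sub k hy le_rfl]
    exact (abs_sub _ _).trans (add_le_add (hC y hy) (hC' y hy))
  fderiv_bounded := by
    obtain ⟨C, hC⟩ := h.fst.exists_bound_gradient k
    obtain ⟨C', hC'⟩ := h.snd.exists_bound_gradient k
    refine ⟨C + C', fun y hy => ?_⟩
    rw [h.fderiv_timeDeriv_sub k hy le_rfl]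
    exact (norm_sub_le _ _).trans (add_le_add (hC y hy) (hC' y hy))

theorem uniformO_density_sub (h : S.IsPair V V' P P') {k : ℕ} (hk : S.GradAgreeUpTo V V' k)
    (m : ℕ) (T : ℝ) : UniformO (S.dom m) T (k + 1) fun x t =>
      S.density P m x t - S.density P' m x t := by
  have h1 : UniformO (S.dom (n + 1)) T (k + 1) (P - P') :=
    h.uniformO_sub (fun l hl => h.timeDeriv_eq_zero hk l (by omega)) T
  have h2 : UniformO (S.dom m) T (k + 1) fun x t =>
      ∫ y in S.dom (n + 1 - m), (P - P') (join x y) t :=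
    UniformO.setIntegral (f := fun x y t => (P - P') (join x y) t)
      (h1.comp (fun p : Conf d m × Conf d (n + 1 - m) => join p.1 p.2)
        fun p hp => join_mem_dom hp.1 hp.2) (S.volume_dom_lt_top _)
  refine (h2.const_smul ((n + 1).descFactorial m : ℝ)).congr fun x hx t ht => ?_
  simp only [Setting.density, Pi.sub_apply, smul_eq_mul]
  rw [integral_sub (h.fst.integrableOn_join (by omega) hx ht.1)
    (h.snd.integrableOn_join (by omega) hx ht.1), mul_sub]

/-- `K₂` is bounded and `Ω` has finite volume, so the interaction force inherits the order of the
density difference. It therefore does not affect the leading term of the boundary condition. -/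
theorem uniformO_meanForce_sub (h : S.IsPair V V' P P') {k : ℕ} (hk : S.GradAgreeUpTo V V' k)
    {m : ℕ} (hm : 1 ≤ m) (i : Fin m) (T : ℝ) : UniformO (S.dom m) T (k + 1) fun x t =>
      S.meanForce P i x t - S.meanForce P' i x t := by
  by_cases hmn : m < n + 1
  · obtain ⟨C, hC⟩ := S.K₂_bounded
    obtain ⟨B, hB, hρ⟩ := h.uniformO_density_sub hk (m + 1) T
    have hC0 : 0 ≤ C := by
      obtain ⟨y, hy⟩ := S.isConnected_Ω.nonempty
      exact (norm_nonneg _).trans (hC y hy y hy)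
    let f : Conf d m → E d → ℝ → E d := fun x y t =>
      S.meanForceIntegrand P i x t y - S.meanForceIntegrand P' i x t y
    have h1 : UniformO (S.dom m ×ˢ S.Ω) T (k + 1) fun p t => f p.1 p.2 t := by
      refine ⟨B * C, by positivity, fun p hp t ht => ?_⟩
      have h2 : f p.1 p.2 t = (S.density P (m + 1) (Fin.snoc (α := fun _ => E d) p.1 p.2) t -
          S.density P' (m + 1) (Fin.snoc (α := fun _ => E d) p.1 p.2) t) • S.K₂ (p.1 i) p.2 :=
        (sub_smul _ _ _).symm
      beta_reduce
      rw [h2, norm_smul, mul_right_comm]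
      exact mul_le_mul (hρ _ (snoc_mem_dom hp.1 hp.2) t ht)
        (hC _ (S.mem_dom.mp hp.1 i) _ hp.2) (norm_nonneg _)
        (mul_nonneg hB (pow_nonneg ht.1 _))
    refine (UniformO.setIntegral h1 S.volume_Ω_lt_top).congr fun x hx t ht => ?_
    simp only [meanForce, if_pos hmn]
    exact (integral_sub (h.fst.solution.meanForce_exists m hm hmn i x hx t ht.1)
      (h.snd.solution.meanForce_exists m hm hmn i x hx t ht.1)).symm
  · simp only [meanForce, if_neg hmn, sub_zero]
    exact UniformO.zero

theorem current₁_sub (h : S.IsPair V V' P P') {y : E d} (hy : y ∈ S.Ω) {t : ℝ} (ht : 0 ≤ t) :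
    S.current₁ V P y t - S.current₁ V' P' y t =
      -((S.D * S.β) • (S.density₁ P y t • gradient (fun z => (V - V') z t) y -
        (S.meanForce P (0 : Fin 1) (fun _ => y) t - S.meanForce P' (0 : Fin 1) (fun _ => y) t))) := by
  have h1 : gradient (fun z => S.density₁ P z t) y = gradient (fun z => S.density₁ P' z t) y := by
    have : (fun z => S.density₁ P z t) =ᶠ[𝓝 y] fun z => S.density₁ P' z t := by
      filter_upwards [S.isOpen_Ω.mem_nhds hy] with z hz using h.density z hz t ht
    rw [gradient_eq, gradient_eq, this.fderiv_eq]
  rw [current₁, current₁, h1, ← h.density y hy t ht, h.gradient_sub hy ht]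
  module

/-- The difference of the two no-flux conditions holds at every time. Its coefficient of order `t ^
k` is the normal component of the field, and the remainder is uniform near the boundary point for
short times. -/
theorem isTangentField (h : S.IsPair V V' P P') {k : ℕ} (hk : S.GradAgreeUpTo V V' k) :
    IsTangentField S.Ω fun y =>
      S.density₁ P y 0 • gradient (fun z => timeDeriv k (V - V') z 0) y where
  continuousOn := by
    refine (h.fst.continuousOn_density₁ le_rfl).smul ?_
    exact (contDiffOn_gradient (k := 1) S.isOpen_Ω (by
      simpa [one_add_one_eq_two] using
        h.smoothInTime_potential.contDiffOn_timeDeriv k le_rfl)).continuousOn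
  bounded := by
    obtain ⟨C, hC⟩ := (h.isBoundedC2 k).fderiv_bounded
    obtain ⟨B, hB, hB'⟩ := h.fst.uniformO_density₁ 1
    refine ⟨B * C, fun y hy => ?_⟩
    rw [norm_smul]
    refine mul_le_mul ?_ ?_ (norm_nonneg _) hB
    · simpa using hB' y hy 0 ⟨le_rfl, zero_le_one⟩
    · simpa [gradient] using hC y hy
  tangent := by
    intro x hx ν hν
    obtain ⟨r₁, hr₁, h₁⟩ := h.fst.exists_uniformO_gradient (k + 1) hx
    obtain ⟨r₂, hr₂, h₂⟩ := h.snd.exists_uniformO_gradient (k + 1) hx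
    set r := min r₁ r₂
    have hr : 0 < r := lt_min hr₁ hr₂
    set A := S.Ω ∩ Metric.ball x r
    have hA : A ⊆ S.Ω := inter_subset_left
    have hrhalf : r / 2 < r := by linarith
    have hb : UniformO A (r / 2) 0 fun y t =>
        fderiv ℝ (fun z => timeDeriv (k + 1) (V - V') z t) y := by
      refine (((h₁ (r / 2) (hrhalf.trans_le (min_le_left _ _))).mono
        (inter_subset_inter_right _ (Metric.ball_subset_ball (min_le_left _ _)))).sub
        ((h₂ (r / 2) (hrhalf.trans_le (min_le_right _ _))).mono
        (inter_subset_inter_right _ (Metric.ball_subset_ball (min_le_right _ _))))).congr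
        fun y hy t ht => ?_
      exact h.fderiv_timeDeriv_sub (k + 1) (hA hy) ht.1
    refine tendsto_zero_of_leading_term (A := A) (T := r / 2) (k := k)
      (h := fun y t => inner ℝ ν (S.density₁ P y t • gradient (fun z => (V - V') z t) y -
        (S.meanForce P (0 : Fin 1) (fun _ => y) t - S.meanForce P' (0 : Fin 1) (fun _ => y) t)))
      (inter_mem self_mem_nhdsWithin (mem_nhdsWithin_of_mem_nhds (Metric.ball_mem_nhds x hr)))
      (by positivity) (fun t ht => ?_) ?_
    · have h3 := ((h.flux t ht x hx ν hν).sub (h.flux' t ht x hx ν hν)).const_mul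
        (-(S.D * S.β)⁻¹)
      rw [sub_zero, mul_zero] at h3
      refine h3.congr' ?_
      filter_upwards [self_mem_nhdsWithin] with y hy
      have hDβ : S.D * S.β ≠ 0 := mul_ne_zero S.D_pos.ne' S.β_pos.ne'
      rw [← inner_sub_right, h.current₁_sub hy ht, inner_neg_right, inner_smul_right, neg_mul_neg,
        inv_mul_cancel_left₀ hDβ]
    · have h4 := ((h.fst.uniformO_density₁ (r / 2)).mono hA).smul
        (h.uniformO_gradient_sub hk hA hb)
      have h5 : UniformO A (r / 2) 0 fun y (_ : ℝ) =>
          gradient (fun z => timeDeriv k (V - V') z 0) y := by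
        obtain ⟨C, hC⟩ := (h.isBoundedC2 k).fderiv_bounded
        exact UniformO.of_bound (C := C) fun y hy t _ => by
          simpa [gradient] using hC y (hA hy)
      -- The density in front of the leading term is replaced by its initial value, at the cost of
      -- one more power of `t`.
      have h6 := (((h.fst.uniformO_density₁_sub (r / 2)).mono hA).smul
        (uniformO_pow_div_factorial k)).smul h5
      have h7 := ((h.uniformO_meanForce_sub hk le_rfl (0 : Fin 1) (r / 2)).comp
        (fun y : E d => fun _ : Fin 1 => y) (A' := S.Ω) fun y hy => S.mem_dom.mpr fun _ => hy).mono hA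
      have h8 : UniformO A (r / 2) 0 fun (_ : E d) (_ : ℝ) => ν :=
        UniformO.of_bound (C := ‖ν‖) fun _ _ _ _ => le_rfl
      simp only [zero_add, add_zero, add_comm 1 k] at h4 h6 h7
      have h9 := h8.inner ((h4.add h6).sub h7)
      rw [zero_add] at h9
      refine h9.congr fun y _ t _ => ?_
      rw [← inner_smul_right (𝕜 := ℝ), ← inner_sub_right]
      congr 1
      module

/-- The induction step: agreement below order `l` makes the weighted gradient at order `l`
divergence free and tangent, and the energy identity annihilates it. -/
theorem gradAgreeUpTo (h : S.IsPair V V' P P') (k : ℕ) : S.GradAgreeUpTo V V' k := by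
  induction k with
  | zero => exact fun l hl => absurd hl (by omega)
  | succ k ih =>
    intro l hl x hx
    rcases Nat.lt_succ_iff_lt_or_eq.mp hl with hl | rfl
    · exact ih l hl x hx
    · have h0 := gradient_eq_zero_of_weaklyDivFree S.isOpen_Ω S.isBounded_Ω S.smooth_Ω
        (h.isBoundedC2 l) (fun y hy => h.fst.density₁_pos h.pos hy) (h.isTangentField ih)
        (h.isWeaklyDivFree ih) x hx
      simpa [gradient] using h0

/-- At time `0`, every time derivative of `V - V'` is constant on the connected set `Ω`. So its
values at `x` and `y` are analytic functions of time with equal derivatives at `0`. -/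
theorem sub_eq_sub (h : S.IsPair V V' P P') {x y : E d} (hx : x ∈ S.Ω) (hy : y ∈ S.Ω) {t : ℝ}
    (ht : 0 ≤ t) : V x t - V' x t = V y t - V' y t := by
  have han : ∀ z ∈ S.Ω, AnalyticOn ℝ ((V - V') z) (Ici 0) := fun z hz =>
    (h.fst.accessible.V_analytic z hz).sub (h.snd.accessible.V_analytic z hz)
  have hz := eqOn_zero_of_analyticOn_Ici ((han x hx).sub (han y hy)) fun k => by
    have hcd : ∀ z ∈ S.Ω, ContDiffWithinAt ℝ k ((V - V') z) (Ici 0) 0 := fun z hz =>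
      (h.smoothInTime_potential.time z hz).of_le (by exact_mod_cast le_top) 0 self_mem_Ici
    rw [iteratedDerivWithin_sub self_mem_Ici (uniqueDiffOn_Ici 0) (hcd x hx) (hcd y hy),
      sub_eq_zero]
    exact S.isOpen_Ω.is_const_of_fderiv_eq_zero (𝕜 := ℝ) (f := fun z => timeDeriv k (V - V') z 0)
      S.isConnected_Ω.isPreconnected
      ((h.smoothInTime_potential.contDiffOn_timeDeriv k le_rfl).differentiableOn two_ne_zero)
      (fun z hz => h.gradAgreeUpTo (k + 1) k (by omega) z hz) hx hy
  have := hz ht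
  simp only [Pi.sub_apply, Pi.zero_apply, sub_eq_zero] at this
  exact this

end IsPair

end Setting

end Overdamped

theorem theorem4p4 {d N : ℕ} (hd : 1 ≤ d) (hN : 1 ≤ N) (S : Overdamped.Setting d)
    (V V' : Overdamped.E d → ℝ → ℝ) (hV : S.IsPotential V) (hV' : S.IsPotential V')
    (P P' : Overdamped.Conf d N → ℝ → ℝ)
    (hP : S.IsSolution V P) (hP' : S.IsSolution V' P')
    (hA : S.IsAnalyticallyAccessible V P) (hA' : S.IsAnalyticallyAccessible V' P')
    (h_init : ∀ x ∈ S.dom N, P x 0 = P' x 0) (h_pos : ∀ x ∈ S.dom N, 0 < P x 0)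
    (h_flux : S.NoNormalFlux V P) (h_flux' : S.NoNormalFlux V' P')
    (h_density : ∀ x ∈ S.Ω, ∀ t : ℝ, 0 ≤ t → S.density₁ P x t = S.density₁ P' x t) :
    S.DiffusionEquivalent (S.density₁ P) V V' ∧
      ∃ c : ℝ → ℝ, ∀ x ∈ S.Ω, ∀ t : ℝ, 0 ≤ t → V x t - V' x t = c t := by
  obtain ⟨n, rfl⟩ : ∃ n, N = n + 1 := ⟨N - 1, by omega⟩
  have h : S.IsPair V V' P P' :=
    ⟨⟨hV, hP, hA⟩, ⟨hV', hP', hA'⟩, h_init, h_pos, h_flux, h_flux', h_density⟩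
  -- The function of time is the difference of the potentials at an arbitrary base point.
  obtain ⟨x₀, hx₀⟩ := S.isConnected_Ω.nonempty
  exact ⟨⟨fun t => V x₀ t - V' x₀ t, fun x hx t ht _ => h.sub_eq_sub hx hx₀ ht⟩,
    fun t => V x₀ t - V' x₀ t, fun x hx t ht => h.sub_eq_sub hx hx₀ ht⟩
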